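/- Let $M$ be a smooth manifold and let $A\to M$ be a smooth (real or complex) vector bundle of rank $n$ such that $A$ and its dual $A^*$ both carry Lie algebroid structures (in the complex case anchors take values in $TM\otimes\mathbb{C}$ and $C^\infty(M)$ means $C^\infty(M,\mathbb{C})$). Let $[\cdot,\cdot]$ be the Schouten bracket on $\Gamma(\wedge^\bullet A)$ extending the bracket of $\Gamma(A)$, with $[X,f]=\rho(X)f$ for $X\in\Gamma(A)$, $f\in C^\infty(M)$, where $\rho$ is the anchor of $A$, and with $$[u,v]=-(-1)^{(k-1)(l-1)}[v,u],\qquad [u,v\wedge w]=[u,v]\wedge w+(-1)^{(k-1)l}\,v\wedge[u,w]$$ for $u\in\Gamma(\wedge^kA)$, $v\in\Gamma(\wedge^lA)$, $w\in\Gamma(\wedge A)$. Let $d:\Gamma(\wedge^\bullet A^*)\to\Gamma(\wedge^{\bullet+1}A^*)$ and $d_*:\Gamma(\wedge^\bullet A)\to\Gamma(\wedge^{\bullet+1}A)$ be the differentials of the Lie algebroids $A$ and $A^*$, given by the Cartan formula. Assume that $(A,A^*)$ is a Lie bialgebroid, i.e. that $d_*$ is a derivation of degree $1$ of the Gerstenhaber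 algebra $(\Gamma(\wedge^\bullet A),\wedge,[\cdot,\cdot])$: besides the Leibniz rule for $\wedge$, $$d_*[u,v]=[d_*u,v]+(-1)^{k-1}[u,d_*v],\qquad u\in\Gamma(\wedge^kA),\ v\in\Gamma(\wedge A).$$ Assume that there is a nowhere vanishing section $\Omega\in\Gamma(\wedge^nA^*)$, and fix one. Let $\Omega^\sharp:\wedge^kA\to\wedge^{n-k}A^*$ be the isomorphism $u\mapsto i_u\Omega$, where $i_{X_1\wedge\cdots\wedge X_k}=i_{X_k}\circ\cdots\circ i_{X_1}$, and let $\partial:\Gamma(\wedge^kA)\to\Gamma(\wedge^{k-1}A)$ be the operator determined by $$\Omega^\sharp(\partial u)=(-1)^k\,d(\Omega^\sharp u),\qquad u\in\Gamma(\wedge^kA).$$ Then the Laplacian $\Delta=d_*\partial+\partial d_*$ is a derivation of degree $0$ of the Gerstenhaber algebra $\Gamma(\wedge^\bullet A)$: it is a linear map $\Gamma(\wedge^kA)\to\Gamma(\wedge^kA)$ for every $k$, and for all $u,v\in\Gamma(\wedge A)$ $$\Delta(u\wedge v)=\Delta u\wedge v+u\wedge\Delta v,\qquad \Delta[u,v]=[\Delta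 u,v]+[u,\Delta v].$$ -/

import Mathlib

open scoped Manifold ContDiff Bundle TensorProduct

noncomputable section

namespace LieBialg

/-! ### Smooth functions, sections of a vector bundle and of its dual

`𝕜` is `ℝ` or `ℂ`; `M` is a real smooth manifold of dimension `m`; vector bundles over `M` are
real (`𝕜 = ℝ`) or complex (`𝕜 = ℂ`). -/

section Functions

variable (𝕜 : Type*) [RCLike 𝕜] (m : ℕ) (M : Type*) [TopologicalSpace M]
  [ChartedSpace (EuclideanSpace ℝ (Fin m)) M]

/-- The algebra `C^∞(M)` of smooth `𝕜`-valued functions on the real manifold `M`. -/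
def smoothFun : Subalgebra 𝕜 (M → 𝕜) where
  carrier := {f | ContMDiff (𝓡 m) 𝓘(ℝ, 𝕜) ∞ f}
  mul_mem' := by
    intro f g hf hg
    exact (contDiff_mul (𝕜 := ℝ) (𝔸 := 𝕜)).contMDiff.comp (hf.prodMk_space hg)
  add_mem' := by
    intro f g hf hg
    exact hf.add hg
  algebraMap_mem' := fun _ => contMDiff_const

variable {𝕜 m M}

/-- The derivative `v f` of a function `f : M → 𝕜` along a tangent vector `v ∈ 𝕜 ⊗ T_xM`
(for `𝕜 = ℝ` this is `T_xM`, for `𝕜 = ℂ` it is the complexified tangent space). -/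
def vecDeriv {x : M} (v : 𝕜 ⊗[ℝ] TangentSpace (𝓡 m) x) (f : M → 𝕜) : 𝕜 :=
  let df : TangentSpace (𝓡 m) x →L[ℝ] 𝕜 := mfderiv (𝓡 m) 𝓘(ℝ, 𝕜) f x
  LinearMap.liftBaseChange 𝕜 df.toLinearMap v

end Functions

section Bundles

variable {𝕜 : Type*} [RCLike 𝕜] {m : ℕ} {M : Type*} [TopologicalSpace M]
  [ChartedSpace (EuclideanSpace ℝ (Fin m)) M]

/-- The `C^∞(M)`-module `Γ(A)` of smooth sections of a smooth vector bundle `A` with model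
fibre `F`. -/
def sections (𝕜 : Type*) [RCLike 𝕜] (m : ℕ) (F : Type*) [NormedAddCommGroup F]
    [NormedSpace ℝ F] [NormedSpace 𝕜 F] [IsScalarTower ℝ 𝕜 F] {M : Type*} [TopologicalSpace M]
    [ChartedSpace (EuclideanSpace ℝ (Fin m)) M]
    (A : M → Type*) [TopologicalSpace (Bundle.TotalSpace F A)]
    [∀ x, AddCommGroup (A x)] [∀ x, Module ℝ (A x)] [∀ x, Module 𝕜 (A x)]
    [∀ x, TopologicalSpace (A x)] [FiberBundle F A]
    [VectorBundle ℝ F A] [VectorBundle 𝕜 F A] :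
    Submodule (smoothFun 𝕜 m M) (∀ x, A x) where
  carrier := {s | ContMDiff (𝓡 m) ((𝓡 m).prod 𝓘(ℝ, F)) ∞
    (fun x => Bundle.TotalSpace.mk' F x (s x))}
  add_mem' := by
    intro s t hs ht
    exact ContMDiff.add_section hs ht
  zero_mem' := Bundle.contMDiff_zeroSection ℝ A
  smul_mem' := by
    intro f s hs x₀
    have hs := hs x₀
    rw [Bundle.contMDiffAt_section] at hs ⊢
    set e := trivializationAt F A x₀
    have hf : ContMDiffAt (𝓡 m) 𝓘(ℝ, 𝕜) ∞ (f : M → 𝕜) x₀ := f.2 x₀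
    have h : ContMDiffAt (𝓡 m) 𝓘(ℝ, F) ∞
        (fun x => (f : M → 𝕜) x • (e ⟨x, s x⟩).2) x₀ :=
      ((contDiff_smul (𝕜 := ℝ) (𝕜' := 𝕜) (F := F)).contMDiff.contMDiffAt).comp x₀
        (hf.prodMk_space hs)
    refine h.congr_of_eventuallyEq ?_
    filter_upwards [e.open_baseSet.mem_nhds
      (FiberBundle.mem_baseSet_trivializationAt' (F := F) (E := A) x₀)] with x hx
    exact (e.linear 𝕜 hx).2 ((f : M → 𝕜) x) (s x)

/-- Given the smooth sections `Γ` of a vector bundle with fibres `V x`, the smooth sections of the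
dual bundle: those `θ` whose pairing with every smooth section is a smooth function. -/
def dualSections {V : M → Type*} [∀ x, AddCommGroup (V x)] [∀ x, Module 𝕜 (V x)]
    (Γ : Submodule (smoothFun 𝕜 m M) (∀ x, V x)) :
    Submodule (smoothFun 𝕜 m M) (∀ x, Module.Dual 𝕜 (V x)) where
  carrier := {θ | ∀ X ∈ Γ, (fun x => θ x (X x)) ∈ smoothFun 𝕜 m M}
  add_mem' := fun hs ht X hX => add_mem (hs X hX) (ht X hX)
  zero_mem' := fun _ _ => zero_mem _
  smul_mem' := fun f _ hs X hX => mul_mem f.2 (hs X hX)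

/-! ### Lie algebroids -/

/-- A Lie algebroid structure on a vector bundle with fibres `V x` and smooth sections `Γ`:
an anchor `V → 𝕜 ⊗ TM` (a smooth bundle map, i.e. smooth sections differentiate smooth functions
to smooth functions) and a Lie bracket on `Γ`, such that the anchor is a homomorphism to vector
fields and the Leibniz rule holds. Vector fields are compared by their action on functions. -/
structure LieAlgebroid {V : M → Type*} [∀ x, AddCommGroup (V x)] [∀ x, Module 𝕜 (V x)]
    (Γ : Submodule (smoothFun 𝕜 m M) (∀ x, V x)) where
  anchor : ∀ x, V x →ₗ[𝕜] 𝕜 ⊗[ℝ] TangentSpace (𝓡 m) x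
  bracket : Γ →ₗ[𝕜] Γ →ₗ[𝕜] Γ
  anchor_smooth : ∀ X : Γ, ∀ f ∈ smoothFun 𝕜 m M,
    (fun x => vecDeriv (anchor x (X.1 x)) f) ∈ smoothFun 𝕜 m M
  bracket_self : ∀ X : Γ, bracket X X = 0
  jacobi : ∀ X Y Z : Γ,
    bracket X (bracket Y Z) = bracket (bracket X Y) Z + bracket Y (bracket X Z)
  anchor_bracket : ∀ X Y : Γ, ∀ f ∈ smoothFun 𝕜 m M, ∀ x,
    vecDeriv (anchor x ((bracket X Y).1 x)) f =
      vecDeriv (anchor x (X.1 x)) (fun y => vecDeriv (anchor y (Y.1 y)) f) -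
      vecDeriv (anchor x (Y.1 x)) (fun y => vecDeriv (anchor y (X.1 y)) f)
  leibniz : ∀ (X Y : Γ) (f : smoothFun 𝕜 m M) (x : M),
    (bracket X ⟨fun y => f.1 y • Y.1 y, Γ.smul_mem f Y.2⟩).1 x =
      vecDeriv (anchor x (X.1 x)) f.1 • Y.1 x + f.1 x • (bracket X Y).1 x

/-- The derivative `ρ(X) f` of a function `f` along the anchor of a section `X`. -/
def LieAlgebroid.act {V : M → Type*} [∀ x, AddCommGroup (V x)] [∀ x, Module 𝕜 (V x)]
    {Γ : Submodule (smoothFun 𝕜 m M) (∀ x, V x)} (L : LieAlgebroid Γ) (X : Γ) (f : M → 𝕜) :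
    M → 𝕜 :=
  fun x => vecDeriv (L.anchor x (X.1 x)) f

/-! ### Sections of exterior algebra bundles -/

/-- Evaluation of `α ∈ ⋀W` on a list of linear forms on `W`, by iterated contraction:
`α(θ, θ₁, …) = (i_θ α)(θ₁, …)`, and on the empty list the degree-zero component of `α`.
On a list of length `k` only the component of `α` of degree `k` contributes, and
`(w₁ ∧ ⋯ ∧ w_k)(θ₁, …, θ_k) = det (θ_i(w_j))`. -/
def evalList {W : Type*} [AddCommGroup W] [Module 𝕜 W] :
    List (Module.Dual 𝕜 W) → ExteriorAlgebra 𝕜 W → 𝕜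
  | [], α => ExteriorAlgebra.algebraMapInv α
  | θ :: l, α => evalList l (CliffordAlgebra.contractLeft (Q := (0 : QuadraticForm 𝕜 W)) θ α)

section Pairing

variable {V W : M → Type*} [∀ x, AddCommGroup (V x)] [∀ x, Module 𝕜 (V x)]
  [∀ x, AddCommGroup (W x)] [∀ x, Module 𝕜 (W x)]
  {Γ : Submodule (smoothFun 𝕜 m M) (∀ x, V x)}

/-- The function `α(X₁, …, X_k)` on `M`, where `α` is a section of `⋀W`, the `X_i` are sections
of `V`, and `V` is paired with `W` by `pair`. -/
def evalOn (pair : ∀ x, V x →ₗ[𝕜] Module.Dual 𝕜 (W x)) (α : ∀ x, ExteriorAlgebra 𝕜 (W x))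
    (Xs : List Γ) : M → 𝕜 :=
  fun x => evalList (Xs.map fun X => pair x (X.1 x)) (α x)

/-- Smoothness of a section `α` of `⋀W`, for `W` dual to `V`: all functions `α(X₁, …, X_k)`
with `X_i` smooth sections of `V` are smooth. -/
def IsSmoothVia (Γ : Submodule (smoothFun 𝕜 m M) (∀ x, V x))
    (pair : ∀ x, V x →ₗ[𝕜] Module.Dual 𝕜 (W x)) (α : ∀ x, ExteriorAlgebra 𝕜 (W x)) : Prop :=
  ∀ Xs : List Γ, evalOn pair α Xs ∈ smoothFun 𝕜 m M

/-- The right-hand side of the Cartan formula for `(dα)(X₀, …, X_k)`: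
`∑ᵢ (-1)ⁱ ρ(X_i) α(…, X̂_i, …) + ∑_{i<j} (-1)^{i+j} α([X_i, X_j], …, X̂_i, …, X̂_j, …)`.
For the empty list it is zero: `dα` has no component of degree zero. -/
def cartan (L : LieAlgebroid Γ) (pair : ∀ x, V x →ₗ[𝕜] Module.Dual 𝕜 (W x))
    (α : ∀ x, ExteriorAlgebra 𝕜 (W x)) (Xs : List Γ) : M → 𝕜 :=
  ∑ i : Fin Xs.length, (-1 : 𝕜) ^ (i : ℕ) •
      L.act (Xs.get i) (evalOn pair α (Xs.eraseIdx i)) +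
  ∑ i : Fin Xs.length, ∑ j ∈ Finset.Ioi i, (-1 : 𝕜) ^ ((i : ℕ) + (j : ℕ)) •
      evalOn pair α (L.bracket (Xs.get i) (Xs.get j) :: (Xs.eraseIdx j).eraseIdx i)

/-- `D` is the Lie algebroid differential `Γ(⋀W) → Γ(⋀W)`, `W = V*`: it is given by the Cartan
formula (which determines `D α` for every smooth `α`). -/
def IsDifferential (L : LieAlgebroid Γ) (pair : ∀ x, V x →ₗ[𝕜] Module.Dual 𝕜 (W x))
    (D : (∀ x, ExteriorAlgebra 𝕜 (W x)) → (∀ x, ExteriorAlgebra 𝕜 (W x))) : Prop :=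
  ∀ α, IsSmoothVia Γ pair α → ∀ Xs : List Γ, evalOn pair (D α) Xs = cartan L pair α Xs

open Classical in
/-- The Lie algebroid differential of `V`, acting on sections of `⋀W`, `W = V*`. -/
def differential (L : LieAlgebroid Γ) (pair : ∀ x, V x →ₗ[𝕜] Module.Dual 𝕜 (W x)) :
    (∀ x, ExteriorAlgebra 𝕜 (W x)) → (∀ x, ExteriorAlgebra 𝕜 (W x)) :=
  if h : ∃ D, IsDifferential L pair D then h.choose else 0

end Pairing

/-- The section `α` of `⋀W` is a section of `⋀^k W`. -/
def HasDeg {W : M → Type*} [∀ x, AddCommGroup (W x)] [∀ x, Module 𝕜 (W x)]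
    (k : ℕ) (α : ∀ x, ExteriorAlgebra 𝕜 (W x)) : Prop :=
  ∀ x, α x ∈ ⋀[𝕜]^k (W x)

/-- A function, as a section of `⋀⁰W`. -/
def ofFun {W : M → Type*} [∀ x, AddCommGroup (W x)] [∀ x, Module 𝕜 (W x)] (f : M → 𝕜) :
    ∀ x, ExteriorAlgebra 𝕜 (W x) :=
  fun x => algebraMap 𝕜 _ (f x)

/-- A section of `W`, as a section of `⋀¹W`. -/
def ofSec {W : M → Type*} [∀ x, AddCommGroup (W x)] [∀ x, Module 𝕜 (W x)] (X : ∀ x, W x) :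
    ∀ x, ExteriorAlgebra 𝕜 (W x) :=
  fun x => ExteriorAlgebra.ι 𝕜 (X x)

section Pair

variable {V : M → Type*} [∀ x, AddCommGroup (V x)] [∀ x, Module 𝕜 (V x)]
  {Γ : Submodule (smoothFun 𝕜 m M) (∀ x, V x)}

/-- `u ∈ Γ(⋀A)`: `u` is a smooth section of `⋀A`, where `Γ = Γ(A)`. -/
def IsMultivector (Γ : Submodule (smoothFun 𝕜 m M) (∀ x, V x))
    (u : ∀ x, ExteriorAlgebra 𝕜 (V x)) : Prop :=
  IsSmoothVia (dualSections Γ) (fun _ => LinearMap.id) u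

/-- `α ∈ Γ(⋀A*)`: `α` is a smooth section of `⋀A*`, where `Γ = Γ(A)`. -/
def IsForm (Γ : Submodule (smoothFun 𝕜 m M) (∀ x, V x))
    (α : ∀ x, ExteriorAlgebra 𝕜 (Module.Dual 𝕜 (V x))) : Prop :=
  IsSmoothVia Γ (fun x => Module.Dual.eval 𝕜 (V x)) α

/-- The differential `d : Γ(⋀A*) → Γ(⋀A*)` of the Lie algebroid `A`. -/
def dA (L : LieAlgebroid Γ) :
    (∀ x, ExteriorAlgebra 𝕜 (Module.Dual 𝕜 (V x))) →
      (∀ x, ExteriorAlgebra 𝕜 (Module.Dual 𝕜 (V x))) :=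
  differential L (fun x => Module.Dual.eval 𝕜 (V x))

/-- The differential `d_* : Γ(⋀A) → Γ(⋀A)` of the Lie algebroid `A*`. -/
def dStar (L' : LieAlgebroid (dualSections Γ)) :
    (∀ x, ExteriorAlgebra 𝕜 (V x)) → (∀ x, ExteriorAlgebra 𝕜 (V x)) :=
  differential L' (fun _ => LinearMap.id)

/-! ### The Gerstenhaber algebra of a Lie algebroid -/

/-- `B` is the Schouten bracket on `Γ(⋀A)`: the `𝕜`-bilinear extension of the bracket of `Γ(A)`
with `[X, f] = ρ(X) f` and `[f, g] = 0` that is graded skew-symmetric and satisfies the graded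
Leibniz rule. (These properties determine `B` on smooth sections.) -/
structure IsSchouten (L : LieAlgebroid Γ)
    (B : (∀ x, ExteriorAlgebra 𝕜 (V x)) → (∀ x, ExteriorAlgebra 𝕜 (V x)) →
      (∀ x, ExteriorAlgebra 𝕜 (V x))) : Prop where
  smooth : ∀ u v, IsMultivector Γ u → IsMultivector Γ v → IsMultivector Γ (B u v)
  add_left : ∀ u u' v, IsMultivector Γ u → IsMultivector Γ u' → IsMultivector Γ v →
    B (u + u') v = B u v + B u' v
  add_right : ∀ u v v', IsMultivector Γ u → IsMultivector Γ v → IsMultivector Γ v' →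
    B u (v + v') = B u v + B u v'
  smul_left : ∀ (c : 𝕜) u v, IsMultivector Γ u → IsMultivector Γ v → B (c • u) v = c • B u v
  smul_right : ∀ (c : 𝕜) u v, IsMultivector Γ u → IsMultivector Γ v → B u (c • v) = c • B u v
  fun_fun : ∀ f ∈ smoothFun 𝕜 m M, ∀ g ∈ smoothFun 𝕜 m M, B (ofFun f) (ofFun g) = 0
  sec_fun : ∀ X : Γ, ∀ f ∈ smoothFun 𝕜 m M, B (ofSec X.1) (ofFun f) = ofFun (L.act X f)
  sec_sec : ∀ X Y : Γ, B (ofSec X.1) (ofSec Y.1) = ofSec (L.bracket X Y).1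
  skew : ∀ (k l : ℕ) (u v), IsMultivector Γ u → IsMultivector Γ v → HasDeg k u → HasDeg l v →
    B u v = -((-1 : 𝕜) ^ ((k + 1) * (l + 1)) • B v u)
  leibniz : ∀ (k l : ℕ) (u v w), IsMultivector Γ u → IsMultivector Γ v → IsMultivector Γ w →
    HasDeg k u → HasDeg l v →
    B u (v * w) = B u v * w + (-1 : 𝕜) ^ ((k + 1) * l) • (v * B u w)

open Classical in
/-- The Schouten bracket on `Γ(⋀A)`. -/
def schouten (L : LieAlgebroid Γ) :
    (∀ x, ExteriorAlgebra 𝕜 (V x)) → (∀ x, ExteriorAlgebra 𝕜 (V x)) →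
      (∀ x, ExteriorAlgebra 𝕜 (V x)) :=
  if h : ∃ B, IsSchouten L B then h.choose else 0

/-- `D` is a derivation of degree `p` of the Gerstenhaber algebra `(Γ(⋀A), ∧, [·,·])`: a linear
map `Γ(⋀^k A) → Γ(⋀^{k+p} A)` with
`D(u ∧ v) = Du ∧ v + (-1)^{pk} u ∧ Dv` and `D[u, v] = [Du, v] + (-1)^{p(k-1)} [u, Dv]`
for `u ∈ Γ(⋀^k A)`. -/
structure IsGerstenhaberDerivation (L : LieAlgebroid Γ) (p : ℕ)
    (D : (∀ x, ExteriorAlgebra 𝕜 (V x)) → (∀ x, ExteriorAlgebra 𝕜 (V x))) : Prop where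
  smooth : ∀ u, IsMultivector Γ u → IsMultivector Γ (D u)
  deg : ∀ (k : ℕ) (u), IsMultivector Γ u → HasDeg k u → HasDeg (k + p) (D u)
  add : ∀ u v, IsMultivector Γ u → IsMultivector Γ v → D (u + v) = D u + D v
  smul : ∀ (c : 𝕜) u, IsMultivector Γ u → D (c • u) = c • D u
  wedge : ∀ (k : ℕ) (u v), IsMultivector Γ u → IsMultivector Γ v → HasDeg k u →
    D (u * v) = D u * v + (-1 : 𝕜) ^ (p * k) • (u * D v)
  bracket : ∀ (k : ℕ) (u v), IsMultivector Γ u → IsMultivector Γ v → HasDeg k u →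
    D (schouten L u v) = schouten L (D u) v + (-1 : 𝕜) ^ (p * (k + 1)) • schouten L u (D v)

/-- The pair `(A, A*)` of Lie algebroids is a Lie bialgebroid: `d_*` is a degree 1 derivation of
the Gerstenhaber algebra `(Γ(⋀A), ∧, [·,·])`. -/
def IsLieBialgebroid (L : LieAlgebroid Γ) (L' : LieAlgebroid (dualSections Γ)) : Prop :=
  IsGerstenhaberDerivation L 1 (dStar L')

/-! ### The operator `∂` and the Laplacian -/

/-- Contraction of a form by a multivector, `i_{X₁ ∧ ⋯ ∧ X_k} = i_{X_k} ∘ ⋯ ∘ i_{X₁}`. -/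
def contract {E : Type*} [AddCommGroup E] [Module 𝕜 E] :
    ExteriorAlgebra 𝕜 E →ₐ[𝕜] (Module.End 𝕜 (ExteriorAlgebra 𝕜 (Module.Dual 𝕜 E)))ᵐᵒᵖ :=
  ExteriorAlgebra.lift 𝕜
    ⟨(MulOpposite.opLinearEquiv 𝕜
      (M := Module.End 𝕜 (ExteriorAlgebra 𝕜 (Module.Dual 𝕜 E)))).toLinearMap ∘ₗ
      (CliffordAlgebra.contractLeft (Q := (0 : QuadraticForm 𝕜 (Module.Dual 𝕜 E)))) ∘ₗ
        Module.Dual.eval 𝕜 E, by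
      intro X
      apply MulOpposite.unop_injective
      exact LinearMap.ext fun α => CliffordAlgebra.contractLeft_contractLeft _ _⟩

/-- The map `Ω♯ : ⋀A → ⋀A*`, `u ↦ i_u Ω`, in one fibre. -/
def sharp {E : Type*} [AddCommGroup E] [Module 𝕜 E]
    (Ω : ExteriorAlgebra 𝕜 (Module.Dual 𝕜 E)) (u : ExteriorAlgebra 𝕜 E) :
    ExteriorAlgebra 𝕜 (Module.Dual 𝕜 E) :=
  (contract (𝕜 := 𝕜) u).unop Ω

/-- The operator `∂` dual to `d` with respect to `Ω♯`: `Ω♯(∂u) = (-1)^k d(Ω♯ u)` for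
`u ∈ Γ(⋀^k A)`. Here `involute` is multiplication by `(-1)^k` in degree `k`, and `Ω♯` is
bijective on each fibre when `Ω` is a nowhere vanishing form of top degree. -/
def del (L : LieAlgebroid Γ) (Ω : ∀ x, ExteriorAlgebra 𝕜 (Module.Dual 𝕜 (V x)))
    (u : ∀ x, ExteriorAlgebra 𝕜 (V x)) : ∀ x, ExteriorAlgebra 𝕜 (V x) :=
  fun x => Function.invFun (sharp (Ω x))
    (dA L (fun y => sharp (Ω y) (CliffordAlgebra.involute (u y))) x)

/-- The Laplacian `Δ = d_* ∂ + ∂ d_*`. -/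
def laplacian (L : LieAlgebroid Γ) (L' : LieAlgebroid (dualSections Γ))
    (Ω : ∀ x, ExteriorAlgebra 𝕜 (Module.Dual 𝕜 (V x)))
    (u : ∀ x, ExteriorAlgebra 𝕜 (V x)) : ∀ x, ExteriorAlgebra 𝕜 (V x) :=
  dStar L' (del L Ω u) + del L Ω (dStar L' u)

end Pair

end Bundles

end LieBialg

end

open scoped Manifold ContDiff Bundle TensorProduct

noncomputable section

set_option linter.unusedSectionVars false

/-! The operator `∂` generates the Schouten bracket: for `u` of degree `k`, `(-1)^k [u, v] = ∂(u ∧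
v) - ∂u ∧ v - (-1)^k u ∧ ∂v`, and `∂² = 0` because `d² = 0`. Granting this, the theorem is short
algebra. Expanding `Δ(u ∧ v)`, the failure of `∂` to be a derivation of `∧` contributes brackets;
since `d_*` is a derivation of both products, these brackets and the mixed terms `∂u ∧ d_*v`, `d_*u
∧ ∂v` cancel (`lapOp_mul`). From `∂² = 0` alone, `Δ∂ = ∂d_*∂ = ∂Δ` (`lapOp_delOp`). The bracket is
built from `∂`, `∧` and signs, so `Δ` is a derivation of it too (`lapOp_delBr`).

The work lies in the generating formula (`schouten_eq_delBr`), because `schouten` is only a chosen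
operation with the characteristic properties. Existence and uniqueness of such an operation are both
needed.

For existence, compare the bracket generated by `∂` with the derived bracket `-[[i_v, d], i_u]` of
operators on forms. On local products of functions and sections the Cartan relations show that the
derived bracket is contraction by some multivector `w` (`exists_derBr`). Evaluating on `Ω`, which is
closed for degree reasons, identifies `w` with the bracket generated by `∂` (`derBr_volume`,
`derBr_eq_iOp`). Skew-symmetry, the Leibniz rule and the values on functions and sections then
follow from graded commutator identities (`isSchouten_delBracket`). For uniqueness, the Leibniz rule
makes any such bracket local, and locally multivectors are sums of products of functions and
sections (`IsSchouten.eq_of_isMultivector`).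

The Cartan calculus is done on cochains: functions on lists of sections with values in the smooth
functions. There `d` and `L_X` are defined by recursion on the list, and `IsAlt.exists_rep` turns
alternating cochains, which are tensorial, back into forms. `Ω♯` is a fibrewise bijection
(`IsVolumeForm.sharp_bijective`) and reflects smoothness (`isMultivector_of_sharp`), so `∂`
preserves smooth multivectors. -/

namespace LieBialg

/-! ### Alternating cochains as functions on lists. -/

section Cochains

variable {R G : Type*} [CommRing R] [AddCommGroup G] [Module R G]

/-- Insertion of `X` into the first slot of a cochain. -/
def ins (X : G) (Φ : List G → R) : List G → R := fun l => Φ (X :: l)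

@[simp] lemma ins_apply (X : G) (Φ : List G → R) (l : List G) : ins X Φ l = Φ (X :: l) := rfl

@[simp] lemma ins_add (X : G) (Φ Ψ : List G → R) : ins X (Φ + Ψ) = ins X Φ + ins X Ψ := rfl
@[simp] lemma ins_sub (X : G) (Φ Ψ : List G → R) : ins X (Φ - Ψ) = ins X Φ - ins X Ψ := rfl
@[simp] lemma ins_smul {S : Type*} [SMul S R] (X : G) (f : S) (Φ : List G → R) :
    ins X (f • Φ) = f • ins X Φ := rfl
@[simp] lemma ins_zero (X : G) : ins X (0 : List G → R) = 0 := rfl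

/-- The first slot of a cochain is linear, and the cochain vanishes if the first two
arguments agree. -/
structure IsHeadAlt (Φ : List G → R) : Prop where
  add : ∀ X Y, ins (X + Y) Φ = ins X Φ + ins Y Φ
  smul : ∀ (f : R) X, ins (f • X) Φ = f • ins X Φ
  alt : ∀ X, ins X (ins X Φ) = 0

/-- Insertion of a list of elements into the first slots of a cochain. -/
def insList (p : List G) (Φ : List G → R) : List G → R := fun l => Φ (p ++ l)

/-- Alternating multilinear cochains. -/
def IsAlt (Φ : List G → R) : Prop := ∀ p, IsHeadAlt (insList p Φ)

lemma IsAlt.head {Φ : List G → R} (h : IsAlt Φ) : IsHeadAlt Φ := h []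

lemma IsAlt.ins {Φ : List G → R} (h : IsAlt Φ) (X : G) : IsAlt (ins X Φ) := fun p => h (X :: p)

/-- Alternation is a coinductive condition: a class of cochains that is stable under insertion and
satisfies the conditions on the first slots consists of alternating cochains. Proofs below only have
to exhibit such a class. -/
lemma IsAlt.of_coind (P : (List G → R) → Prop) (hP : ∀ Φ, P Φ → IsHeadAlt Φ ∧ ∀ X, P (LieBialg.ins X Φ))
    {Φ : List G → R} (h : P Φ) : IsAlt Φ := by
  intro p
  induction p generalizing Φ with
  | nil => exact (hP Φ h).1
  | cons X p ih => exact ih ((hP Φ h).2 X)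

lemma IsHeadAlt.add' {Φ Ψ : List G → R} (h : IsHeadAlt Φ) (h' : IsHeadAlt Ψ) :
    IsHeadAlt (Φ + Ψ) where
  add X Y := by rw [ins_add, h.add, h'.add, ins_add, ins_add]; abel
  smul f X := by rw [ins_add, h.smul, h'.smul, ins_add, smul_add]
  alt X := by rw [ins_add, ins_add, h.alt, h'.alt, add_zero]

lemma IsHeadAlt.smul' {Φ : List G → R} (h : IsHeadAlt Φ) (f : R) : IsHeadAlt (f • Φ) where
  add X Y := by rw [ins_smul, h.add, ins_smul, ins_smul, smul_add]
  smul g X := by rw [ins_smul, h.smul, ins_smul, smul_comm]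
  alt X := by rw [ins_smul, ins_smul, h.alt, smul_zero]

lemma IsAlt.add {Φ Ψ : List G → R} (h : IsAlt Φ) (h' : IsAlt Ψ) : IsAlt (Φ + Ψ) :=
  fun p => (h p).add' (h' p)

lemma IsAlt.smul {Φ : List G → R} (h : IsAlt Φ) (f : R) : IsAlt (f • Φ) :=
  fun p => (h p).smul' f

lemma IsAlt.neg {Φ : List G → R} (h : IsAlt Φ) : IsAlt (-Φ) := by
  simpa using h.smul (-1)

lemma IsAlt.sub {Φ Ψ : List G → R} (h : IsAlt Φ) (h' : IsAlt Ψ) : IsAlt (Φ - Ψ) := by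
  rw [sub_eq_add_neg]; exact h.add h'.neg

lemma IsAlt.swap {Φ : List G → R} (h : IsAlt Φ) (X Y : G) :
    LieBialg.ins Y (LieBialg.ins X Φ) = -LieBialg.ins X (LieBialg.ins Y Φ) := by
  have h1 := h.head.alt (X + Y)
  rw [h.head.add, ins_add, (h.ins X).head.add, (h.ins Y).head.add, h.head.alt, h.head.alt] at h1
  rw [eq_neg_iff_add_eq_zero]
  simpa [add_comm] using h1

lemma IsHeadAlt.neg_arg {Φ : List G → R} (h : IsHeadAlt Φ) (X : G) : ins (-X) Φ = -ins X Φ := by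
  simpa using h.smul (-1) X

lemma IsHeadAlt.sub_arg {Φ : List G → R} (h : IsHeadAlt Φ) (X Y : G) :
    ins (X - Y) Φ = ins X Φ - ins Y Φ := by
  rw [sub_eq_add_neg, h.add, h.neg_arg, sub_eq_add_neg]

/-- Exterior multiplication of a cochain by a linear form. -/
def wedgeC (θ : G → R) : (List G → R) → List G → R
  | _, [] => 0
  | Φ, X :: l => θ X * Φ l - wedgeC θ (fun l => Φ (X :: l)) l

lemma ins_wedgeC (θ : G → R) (Φ : List G → R) (X : G) :
    ins X (wedgeC θ Φ) = θ X • Φ - wedgeC θ (ins X Φ) := rfl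

lemma wedgeC_add (θ : G → R) (Φ Ψ : List G → R) :
    wedgeC θ (Φ + Ψ) = wedgeC θ Φ + wedgeC θ Ψ := by
  funext l
  induction l generalizing Φ Ψ with
  | nil => simp [wedgeC]
  | cons X l ih =>
    have := ih (ins X Φ) (ins X Ψ)
    rw [← ins_add] at this
    change θ X * (Φ l + Ψ l) - wedgeC θ (ins X (Φ + Ψ)) l = _
    rw [this]
    change _ = θ X * Φ l - wedgeC θ (ins X Φ) l + (θ X * Ψ l - wedgeC θ (ins X Ψ) l)
    simp only [Pi.add_apply]
    ring

lemma wedgeC_smul (θ : G → R) (f : R) (Φ : List G → R) :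
    wedgeC θ (f • Φ) = f • wedgeC θ Φ := by
  funext l
  induction l generalizing Φ with
  | nil => simp [wedgeC]
  | cons X l ih =>
    change θ X * (f * Φ l) - wedgeC θ (f • ins X Φ) l = f * (θ X * Φ l - wedgeC θ (ins X Φ) l)
    rw [ih]
    simp only [Pi.smul_apply, smul_eq_mul]
    ring

lemma wedgeC_zero (θ : G → R) : wedgeC θ (0 : List G → R) = 0 := by
  simpa using wedgeC_smul θ 0 (0 : List G → R)

lemma wedgeC_neg (θ : G → R) (Φ : List G → R) : wedgeC θ (-Φ) = -wedgeC θ Φ := by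
  simpa using wedgeC_smul θ (-1) Φ

lemma IsAlt.wedgeC (θ : G →ₗ[R] R) {Φ : List G → R} (h : IsAlt Φ) :
    IsAlt (LieBialg.wedgeC θ Φ) := by
  -- Products `θ ∧ B` alone are not stable under insertion, as `i_X(θ ∧ B) = θ(X) B - θ ∧ i_X B`;
  -- the differences `A - θ ∧ B` are.
  refine IsAlt.of_coind (fun Ψ => ∃ A B, IsAlt A ∧ IsAlt B ∧ Ψ = A - LieBialg.wedgeC θ B) ?_
    (Φ := LieBialg.wedgeC θ Φ) ⟨0, -Φ, ?_, h.neg, by rw [wedgeC_neg]; simp⟩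
  · rintro _ ⟨A, B, hA, hB, rfl⟩
    refine ⟨⟨fun X Y => ?_, fun f X => ?_, fun X => ?_⟩, fun X => ?_⟩
    · simp only [ins_sub, ins_wedgeC, hA.head.add, hB.head.add, wedgeC_add, map_add, add_smul]
      abel
    · simp only [ins_sub, ins_wedgeC, hA.head.smul, hB.head.smul, wedgeC_smul, map_smul, smul_sub,
        smul_eq_mul, mul_smul]
    · simp only [ins_sub, ins_wedgeC, hA.head.alt, hB.head.alt, wedgeC_zero, ins_smul]
      simp
    · exact ⟨LieBialg.ins X A - θ X • B, -LieBialg.ins X B, (hA.ins X).sub (hB.smul _),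
        (hB.ins X).neg, by rw [ins_sub, ins_wedgeC, wedgeC_neg]; abel⟩
  · simpa using h.smul 0

end Cochains

/-! ### Cartan calculus of a Lie–Rinehart algebra. -/

/-- A Lie–Rinehart algebra: a Lie algebra acting by derivations on a commutative ring, compatibly
with module structures. -/
structure LieRinehart (𝕜 R G : Type*) [CommRing 𝕜] [CommRing R] [Algebra 𝕜 R] [AddCommGroup G]
    [Module R G] where
  act : G →ₗ[R] Derivation 𝕜 R R
  bracket : G →+ G →+ G
  bracket_self : ∀ X, bracket X X = 0
  jacobi : ∀ X Y Z, bracket X (bracket Y Z) = bracket (bracket X Y) Z + bracket Y (bracket X Z)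
  act_bracket : ∀ X Y f, act (bracket X Y) f = act X (act Y f) - act Y (act X f)
  leibniz : ∀ X Y (f : R), bracket X (f • Y) = act X f • Y + f • bracket X Y

namespace LieRinehart

variable {𝕜 R G : Type*} [CommRing 𝕜] [CommRing R] [Algebra 𝕜 R] [AddCommGroup G]
    [Module R G] (L : LieRinehart 𝕜 R G)

lemma bracket_skew (X Y : G) : L.bracket X Y = -L.bracket Y X := by
  have := L.bracket_self (X + Y)
  simp only [map_add, AddMonoidHom.add_apply, L.bracket_self, zero_add, add_zero] at this
  rw [eq_neg_iff_add_eq_zero, add_comm]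
  exact this

lemma bracket_smul_left (f : R) (X Y : G) :
    L.bracket (f • X) Y = f • L.bracket X Y - L.act Y f • X := by
  rw [bracket_skew, leibniz, L.bracket_skew X Y, smul_neg]; abel

/-- The Lie derivative of a cochain. -/
def lieD (X : G) : (List G → R) → List G → R
  | Φ, [] => L.act X (Φ [])
  | Φ, Y :: l => lieD X (fun l => Φ (Y :: l)) l - Φ (L.bracket X Y :: l)

/-- The Chevalley–Eilenberg differential of a cochain. -/
def dC : (List G → R) → List G → R
  | _, [] => 0
  | Φ, X :: l => L.lieD X Φ l - dC (fun l => Φ (X :: l)) l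

/-- The relations `i_Y L_X = L_X i_Y - i_[X,Y]` and `i_X d = L_X - d i_X` are the recursive
definitions themselves. Most identities below follow by inserting an argument and using induction on
the list. -/
lemma ins_lieD (X Y : G) (Φ : List G → R) :
    ins Y (L.lieD X Φ) = L.lieD X (ins Y Φ) - ins (L.bracket X Y) Φ := rfl

lemma ins_dC (X : G) (Φ : List G → R) : ins X (L.dC Φ) = L.lieD X Φ - L.dC (ins X Φ) := rfl

/-- The differential of a function, as a linear form. -/
def dFun (f : R) : G →ₗ[R] R where
  toFun X := L.act X f
  map_add' X Y := by simp
  map_smul' g X := by simp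

lemma lieD_add (X : G) (Φ Ψ : List G → R) : L.lieD X (Φ + Ψ) = L.lieD X Φ + L.lieD X Ψ := by
  funext l
  induction l generalizing Φ Ψ with
  | nil => simp [lieD]
  | cons Y l ih =>
    have := ih (ins Y Φ) (ins Y Ψ)
    change ins Y (L.lieD X (Φ + Ψ)) l = ins Y (L.lieD X Φ) l + ins Y (L.lieD X Ψ) l
    simp only [ins_lieD, ins_add, Pi.sub_apply, Pi.add_apply, this]
    ring

lemma lieD_smul (X : G) (f : R) (Φ : List G → R) :
    L.lieD X (f • Φ) = f • L.lieD X Φ + L.act X f • Φ := by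
  funext l
  induction l generalizing Φ with
  | nil => simp [lieD, mul_comm]
  | cons Y l ih =>
    have := ih (ins Y Φ)
    change ins Y (L.lieD X (f • Φ)) l = f • ins Y (L.lieD X Φ) l + L.act X f • ins Y Φ l
    simp only [ins_lieD, ins_smul, Pi.sub_apply, Pi.add_apply, this, Pi.smul_apply, smul_eq_mul]
    ring

lemma lieD_zero (X : G) : L.lieD X 0 = 0 := by
  simpa using L.lieD_add X 0 0

lemma lieD_neg (X : G) (Φ : List G → R) : L.lieD X (-Φ) = -L.lieD X Φ := by
  rw [eq_neg_iff_add_eq_zero, ← lieD_add, neg_add_cancel, lieD_zero]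

lemma lieD_sub (X : G) (Φ Ψ : List G → R) : L.lieD X (Φ - Ψ) = L.lieD X Φ - L.lieD X Ψ := by
  rw [sub_eq_add_neg, lieD_add, lieD_neg, sub_eq_add_neg]

lemma dC_add (Φ Ψ : List G → R) : L.dC (Φ + Ψ) = L.dC Φ + L.dC Ψ := by
  funext l
  induction l generalizing Φ Ψ with
  | nil => simp [dC]
  | cons Y l ih =>
    have := ih (ins Y Φ) (ins Y Ψ)
    change ins Y (L.dC (Φ + Ψ)) l = ins Y (L.dC Φ) l + ins Y (L.dC Ψ) l
    simp only [ins_dC, ins_add, Pi.sub_apply, Pi.add_apply, this, lieD_add]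
    ring

lemma dC_zero : L.dC 0 = 0 := by
  simpa using L.dC_add 0 0

lemma dC_neg (Φ : List G → R) : L.dC (-Φ) = -L.dC Φ := by
  rw [eq_neg_iff_add_eq_zero, ← dC_add, neg_add_cancel, dC_zero]

lemma dC_sub (Φ Ψ : List G → R) : L.dC (Φ - Ψ) = L.dC Φ - L.dC Ψ := by
  rw [sub_eq_add_neg, dC_add, dC_neg, sub_eq_add_neg]

lemma dC_smul (f : R) (Φ : List G → R) :
    L.dC (f • Φ) = f • L.dC Φ + wedgeC (L.dFun f) Φ := by
  funext l
  induction l generalizing Φ with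
  | nil => simp [dC, wedgeC]
  | cons Y l ih =>
    have := ih (ins Y Φ)
    change ins Y (L.dC (f • Φ)) l = f • ins Y (L.dC Φ) l + ins Y (wedgeC (L.dFun f) Φ) l
    simp only [ins_dC, ins_smul, Pi.sub_apply, Pi.add_apply, this, lieD_smul, ins_wedgeC,
      Pi.smul_apply, smul_eq_mul]
    simp only [dFun, LinearMap.coe_mk, AddHom.coe_mk]
    ring

lemma lieD_add_left {Φ : List G → R} (h : IsAlt Φ) (X Y : G) :
    L.lieD (X + Y) Φ = L.lieD X Φ + L.lieD Y Φ := by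
  funext l
  induction l generalizing Φ with
  | nil => simp [lieD]
  | cons Z l ih =>
    have := ih (h.ins Z)
    change ins Z (L.lieD (X + Y) Φ) l = ins Z (L.lieD X Φ) l + ins Z (L.lieD Y Φ) l
    simp only [ins_lieD, Pi.sub_apply, Pi.add_apply, this, map_add, AddMonoidHom.add_apply,
      h.head.add]
    ring

lemma lieD_smul_left {Φ : List G → R} (h : IsAlt Φ) (f : R) (X : G) :
    L.lieD (f • X) Φ = f • L.lieD X Φ + wedgeC (L.dFun f) (ins X Φ) := by
  funext l
  induction l generalizing Φ with
  | nil => simp [lieD, wedgeC]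
  | cons Z l ih =>
    have := ih (h.ins Z)
    change ins Z (L.lieD (f • X) Φ) l = f • ins Z (L.lieD X Φ) l +
      ins Z (wedgeC (L.dFun f) (ins X Φ)) l
    simp only [ins_lieD, Pi.sub_apply, Pi.add_apply, this, Pi.smul_apply, smul_eq_mul, ins_wedgeC,
      bracket_smul_left, h.head.sub_arg, h.head.smul, h.swap Z X, wedgeC_neg, Pi.neg_apply]
    simp only [dFun, LinearMap.coe_mk, AddHom.coe_mk]
    ring

/-- The Jacobi identity and the compatibility of the anchor with brackets enter the calculus here.
-/
lemma lieD_comm {Φ : List G → R} (h : IsAlt Φ) (X Y : G) :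
    L.lieD X (L.lieD Y Φ) - L.lieD Y (L.lieD X Φ) = L.lieD (L.bracket X Y) Φ := by
  funext l
  induction l generalizing Φ with
  | nil => simp [lieD, L.act_bracket]
  | cons Z l ih =>
    have := ih (h.ins Z)
    change ins Z (L.lieD X (L.lieD Y Φ)) l - ins Z (L.lieD Y (L.lieD X Φ)) l =
      ins Z (L.lieD (L.bracket X Y) Φ) l
    have hj : L.bracket (L.bracket X Y) Z =
        L.bracket X (L.bracket Y Z) - L.bracket Y (L.bracket X Z) := by
      rw [L.jacobi X Y Z]; abel
    simp only [ins_lieD, lieD_sub, Pi.sub_apply, ← this, hj, h.head.sub_arg]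
    ring

lemma _root_.LieBialg.IsAlt.lieD {Φ : List G → R} (h : IsAlt Φ) (X : G) : IsAlt (L.lieD X Φ) := by
  refine IsAlt.of_coind (fun Ψ => ∃ A B, IsAlt A ∧ IsAlt B ∧ Ψ = L.lieD X A - B) ?_
    (Φ := L.lieD X Φ) ⟨Φ, 0, h, by simpa using h.smul 0, by simp⟩
  rintro _ ⟨A, B, hA, hB, rfl⟩
  refine ⟨⟨fun Y Z => ?_, fun f Y => ?_, fun Y => ?_⟩, fun Y => ?_⟩
  · simp only [ins_sub, ins_lieD, hA.head.add, hB.head.add, lieD_add, map_add]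
    abel
  · simp only [ins_sub, ins_lieD, hA.head.smul, hB.head.smul, lieD_smul, L.leibniz, hA.head.add,
      smul_sub]
    abel
  · simp only [ins_sub, ins_lieD, hA.head.alt, hB.head.alt, lieD_zero,
      hA.swap Y (L.bracket X Y)]
    abel
  · exact ⟨ins Y A, ins (L.bracket X Y) A + ins Y B, hA.ins Y, (hA.ins _).add (hB.ins Y),
      by rw [ins_sub, ins_lieD]; abel⟩

/-- Neither `L_X` nor `d i_X` is linear over functions in `X`, but both fail by the same term `df ∧
i_X Φ`, which cancels in `i_X d = L_X - d i_X`. The stable class consists of the cochains `A - dB`.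
-/
lemma _root_.LieBialg.IsAlt.dC {Φ : List G → R} (h : IsAlt Φ) : IsAlt (L.dC Φ) := by
  refine IsAlt.of_coind (fun Ψ => ∃ A B, IsAlt A ∧ IsAlt B ∧ Ψ = A - L.dC B) ?_
    (Φ := L.dC Φ) ⟨0, -Φ, by simpa using h.smul 0, h.neg, by rw [dC_neg]; simp⟩
  rintro _ ⟨A, B, hA, hB, rfl⟩
  refine ⟨⟨fun Y Z => ?_, fun f Y => ?_, fun Y => ?_⟩, fun Y => ?_⟩
  · simp only [ins_sub, ins_dC, hA.head.add, hB.head.add, dC_add, L.lieD_add_left hB]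
    abel
  · simp only [ins_sub, ins_dC, hA.head.smul, hB.head.smul, dC_smul, L.lieD_smul_left hB,
      smul_sub]
    abel
  · have h0 : ins (L.bracket Y Y) B = 0 := by
      rw [L.bracket_self]; simpa using hB.head.smul 0 0
    simp only [ins_sub, ins_dC, hA.head.alt, hB.head.alt, dC_zero, ins_lieD, h0]
    abel
  · exact ⟨ins Y A - L.lieD Y B, -ins Y B, (hA.ins Y).sub (hB.lieD L Y), (hB.ins Y).neg,
      by rw [ins_sub, ins_dC, dC_neg]; abel⟩

lemma dC_lieD {Φ : List G → R} (h : IsAlt Φ) (X : G) :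
    L.dC (L.lieD X Φ) = L.lieD X (L.dC Φ) := by
  funext l
  induction l generalizing Φ with
  | nil => simp [dC, lieD]
  | cons Y l ih =>
    have := ih (h.ins Y)
    change ins Y (L.dC (L.lieD X Φ)) l = ins Y (L.lieD X (L.dC Φ)) l
    simp only [ins_dC, ins_lieD, lieD_sub, dC_sub, Pi.sub_apply, ← this, ← L.lieD_comm h X Y]
    ring

/-- Inserting `Y` gives `L_Y dΦ - d L_Y Φ + d d i_Y Φ`: the first two terms cancel by `dC_lieD`, the
last vanishes by induction. -/
lemma dC_dC {Φ : List G → R} (h : IsAlt Φ) : L.dC (L.dC Φ) = 0 := by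
  funext l
  induction l generalizing Φ with
  | nil => simp [dC]
  | cons Y l ih =>
    have := ih (h.ins Y)
    change ins Y (L.dC (L.dC Φ)) l = 0
    simp only [ins_dC, dC_sub, L.dC_lieD h, Pi.sub_apply, this]
    simp

/-! ### The Cartan formula -/

/-- The recursion leaves each bracket in the slot of the argument it replaces; moving it to the
front costs one swap per preceding slot, whence the sign. -/
lemma lieD_eq_sum {Φ : List G → R} (h : IsAlt Φ) (X : G) (l : List G) :
    L.lieD X Φ l = L.act X (Φ l) +
      ∑ j : Fin l.length, (-1 : R) ^ ((j : ℕ) + 1) *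
        Φ (L.bracket X (l.get j) :: l.eraseIdx j) := by
  induction l generalizing Φ with
  | nil => simp [lieD]
  | cons Y l ih =>
    have h1 := ih (h.ins Y)
    change L.lieD X (ins Y Φ) l - Φ (L.bracket X Y :: l) = _
    rw [h1]
    simp only [List.length_cons, Fin.sum_univ_succ]
    have h2 : ∀ j : Fin l.length, ins Y Φ (L.bracket X (l.get j) :: l.eraseIdx j) =
        - Φ (L.bracket X (l.get j) :: Y :: l.eraseIdx j) := fun j =>
      congrFun (h.swap Y (L.bracket X (l.get j))) (l.eraseIdx j)
    simp only [h2]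
    simp [pow_succ]
    ring

/-- Peeling off the first argument `X` splits the Cartan formula: the terms with `i = 0` form `L_X
Φ`, the others form `-d(i_X Φ)` once the bracket is moved past `X`. -/
lemma dC_eq_sum {Φ : List G → R} (h : IsAlt Φ) (l : List G) :
    L.dC Φ l = ∑ i : Fin l.length, (-1 : R) ^ (i : ℕ) * L.act (l.get i) (Φ (l.eraseIdx i)) +
      ∑ i : Fin l.length, ∑ j ∈ Finset.Ioi i, (-1 : R) ^ ((i : ℕ) + (j : ℕ)) *
        Φ (L.bracket (l.get i) (l.get j) :: (l.eraseIdx j).eraseIdx i) := by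
  induction l generalizing Φ with
  | nil => simp [dC]
  | cons X l ih =>
    have h1 := ih (h.ins X)
    change L.lieD X Φ l - L.dC (ins X Φ) l = _
    rw [h1, L.lieD_eq_sum h]
    simp only [List.length_cons, Fin.sum_univ_succ]
    have h2 : ∀ i j : Fin l.length, ins X Φ
          (L.bracket (l.get i) (l.get j) :: (l.eraseIdx j).eraseIdx i) =
        - Φ (L.bracket (l.get i) (l.get j) :: X :: (l.eraseIdx j).eraseIdx i) := fun i j =>
      congrFun (h.swap X (L.bracket (l.get i) (l.get j))) _
    simp only [h2, Fin.Ioi_zero_eq_map, Fin.Ioi_succ, Finset.sum_map]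
    simp [pow_succ, pow_add, Finset.sum_neg_distrib]
    ring

end LieRinehart

end LieBialg

namespace LieBialg

open CliffordAlgebra ExteriorAlgebra

/-! ### Exterior algebra of one fibre: degrees, contractions and evaluation. -/

section Fibre

variable {𝕜 : Type*} [RCLike 𝕜] {W : Type*} [AddCommGroup W] [Module 𝕜 W]

/-- Contraction of an element of the exterior algebra by a linear form. -/
abbrev cl (θ : Module.Dual 𝕜 W) : ExteriorAlgebra 𝕜 W →ₗ[𝕜] ExteriorAlgebra 𝕜 W :=
  CliffordAlgebra.contractLeft (Q := (0 : QuadraticForm 𝕜 W)) θ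

/-- The grade involution. -/
abbrev inv : ExteriorAlgebra 𝕜 W →ₐ[𝕜] ExteriorAlgebra 𝕜 W :=
  CliffordAlgebra.involute (Q := (0 : QuadraticForm 𝕜 W))

lemma cl_ι_mul (θ : Module.Dual 𝕜 W) (w : W) (α : ExteriorAlgebra 𝕜 W) :
    cl θ (ExteriorAlgebra.ι 𝕜 w * α) = θ w • α - ExteriorAlgebra.ι 𝕜 w * cl θ α :=
  contractLeft_ι_mul ..

lemma cl_algebraMap (θ : Module.Dual 𝕜 W) (c : 𝕜) :
    cl θ (algebraMap 𝕜 (ExteriorAlgebra 𝕜 W) c) = 0 := contractLeft_algebraMap ..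

@[elab_as_elim]
lemma ext_induction {C : ExteriorAlgebra 𝕜 W → Prop} (h0 : ∀ c, C (algebraMap 𝕜 _ c))
    (hadd : ∀ a b, C a → C b → C (a + b))
    (hmul : ∀ w a, C a → C (ExteriorAlgebra.ι 𝕜 w * a)) (a : ExteriorAlgebra 𝕜 W) : C a :=
  CliffordAlgebra.left_induction (0 : QuadraticForm 𝕜 W) h0 hadd (fun a w h => hmul w a h) a

lemma mem_zero_iff {α : ExteriorAlgebra 𝕜 W} :
    α ∈ ⋀[𝕜]^0 W ↔ ∃ c, algebraMap 𝕜 _ c = α := by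
  rw [exteriorPower, pow_zero, Submodule.mem_one]

@[elab_as_elim]
lemma degree_induction {C : ℕ → ExteriorAlgebra 𝕜 W → Prop}
    (h0 : ∀ c, C 0 (algebraMap 𝕜 _ c))
    (hadd : ∀ k a b, C k a → C k b → C k (a + b))
    (hmul : ∀ k w a, a ∈ ⋀[𝕜]^k W → C k a → C (k + 1) (ExteriorAlgebra.ι 𝕜 w * a))
    {k : ℕ} {a : ExteriorAlgebra 𝕜 W} (ha : a ∈ ⋀[𝕜]^k W) : C k a := by
  induction k generalizing a with
  | zero => obtain ⟨c, rfl⟩ := mem_zero_iff.1 ha; exact h0 c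
  | succ k ih =>
    rw [exteriorPower, pow_succ'] at ha
    refine Submodule.mul_induction_on ha ?_ fun x y hx hy => hadd _ x y hx hy
    rintro _ ⟨w, rfl⟩ b hb
    exact hmul k w b hb (ih hb)

lemma ι_mul_mem (w : W) {k : ℕ} {α : ExteriorAlgebra 𝕜 W} (h : α ∈ ⋀[𝕜]^k W) :
    ExteriorAlgebra.ι 𝕜 w * α ∈ ⋀[𝕜]^(k + 1) W := by
  rw [exteriorPower, pow_succ']
  exact Submodule.mul_mem_mul ⟨w, rfl⟩ h

lemma ι_mem (w : W) : ExteriorAlgebra.ι 𝕜 w ∈ ⋀[𝕜]^1 W := by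
  rw [exteriorPower, pow_one]; exact ⟨w, rfl⟩

lemma mul_mem_deg {k l : ℕ} {α β : ExteriorAlgebra 𝕜 W} (h : α ∈ ⋀[𝕜]^k W)
    (h' : β ∈ ⋀[𝕜]^l W) : α * β ∈ ⋀[𝕜]^(k + l) W := by
  rw [exteriorPower, pow_add]; exact Submodule.mul_mem_mul h h'

lemma algebraMap_mem_deg (c : 𝕜) : algebraMap 𝕜 (ExteriorAlgebra 𝕜 W) c ∈ ⋀[𝕜]^0 W :=
  mem_zero_iff.2 ⟨c, rfl⟩

/-- Truncated subtraction hides that contraction kills degree zero, and the induction step out of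
degree zero needs exactly that, so both facts are carried together. -/
lemma cl_mem_aux (θ : Module.Dual 𝕜 W) {k : ℕ} {α : ExteriorAlgebra 𝕜 W} (h : α ∈ ⋀[𝕜]^k W) :
    (k = 0 → cl θ α = 0) ∧ cl θ α ∈ ⋀[𝕜]^(k - 1) W := by
  refine degree_induction
    (C := fun k a => (k = 0 → cl θ a = 0) ∧ cl θ a ∈ ⋀[𝕜]^(k - 1) W) ?_ ?_ ?_ h
  · intro c
    rw [cl_algebraMap]
    exact ⟨fun _ => rfl, Submodule.zero_mem _⟩
  · intro k a b ha hb
    rw [map_add]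
    exact ⟨fun hk => by rw [ha.1 hk, hb.1 hk, add_zero], Submodule.add_mem _ ha.2 hb.2⟩
  · intro k w a ha ih
    refine ⟨fun hk => by omega, ?_⟩
    rw [cl_ι_mul]
    refine Submodule.sub_mem _ (Submodule.smul_mem _ _ ha) ?_
    rcases Nat.eq_zero_or_pos k with rfl | hk
    · rw [ih.1 rfl, mul_zero]; exact Submodule.zero_mem _
    · have := ι_mul_mem w ih.2
      rwa [Nat.sub_add_cancel hk] at this

lemma cl_mem (θ : Module.Dual 𝕜 W) {k : ℕ} {α : ExteriorAlgebra 𝕜 W}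
    (h : α ∈ ⋀[𝕜]^(k + 1) W) : cl θ α ∈ ⋀[𝕜]^k W := (cl_mem_aux θ h).2

lemma cl_zero_deg (θ : Module.Dual 𝕜 W) {α : ExteriorAlgebra 𝕜 W}
    (h : α ∈ ⋀[𝕜]^0 W) : cl θ α = 0 := (cl_mem_aux θ h).1 rfl

lemma inv_ι (w : W) : inv (ExteriorAlgebra.ι 𝕜 w) = -ExteriorAlgebra.ι 𝕜 w := involute_ι _

lemma inv_inv (α : ExteriorAlgebra 𝕜 W) : inv (inv α) = α := involute_involute α

lemma inv_of_deg {k : ℕ} {α : ExteriorAlgebra 𝕜 W} (h : α ∈ ⋀[𝕜]^k W) :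
    inv α = (-1 : 𝕜) ^ k • α := by
  refine degree_induction (C := fun k a => inv a = (-1 : 𝕜) ^ k • a) ?_ ?_ ?_ h
  · intro c; simp
  · intro k a b ha hb; rw [map_add, ha, hb, smul_add]
  · intro k w a _ ih
    rw [map_mul, ih, inv_ι, pow_succ, mul_neg_one, neg_smul, mul_smul_comm, neg_mul, smul_neg]

lemma inv_mem_deg {k : ℕ} {α : ExteriorAlgebra 𝕜 W} (h : α ∈ ⋀[𝕜]^k W) :
    inv α ∈ ⋀[𝕜]^k W := by
  rw [inv_of_deg h]; exact Submodule.smul_mem _ _ h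

lemma algebraMapInv_of_deg {k : ℕ} {α : ExteriorAlgebra 𝕜 W} (h : α ∈ ⋀[𝕜]^k W) (hk : k ≠ 0) :
    algebraMapInv α = 0 := by
  refine degree_induction (C := fun k a => k ≠ 0 → algebraMapInv a = 0) ?_ ?_ ?_ h hk
  · intro c h; exact absurd rfl h
  · intro k a b ha hb hk; rw [map_add, ha hk, hb hk, add_zero]
  · intro k w a _ _ _
    rw [map_mul, algebraMapInv, ExteriorAlgebra.lift_ι_apply]
    simp

lemma algebraMapInv_ι_mul (w : W) (α : ExteriorAlgebra 𝕜 W) :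
    algebraMapInv (ExteriorAlgebra.ι 𝕜 w * α) = 0 := by
  rw [map_mul, algebraMapInv, ExteriorAlgebra.lift_ι_apply]; simp

lemma algebraMapInv_algebraMap (c : 𝕜) :
    algebraMapInv (algebraMap 𝕜 (ExteriorAlgebra 𝕜 W) c) = c := algebraMap_leftInverse W c

lemma evalList_cons (θ : Module.Dual 𝕜 W) (l : List (Module.Dual 𝕜 W)) (α : ExteriorAlgebra 𝕜 W) :
    evalList (θ :: l) α = evalList l (cl θ α) := rfl

lemma evalList_nil (α : ExteriorAlgebra 𝕜 W) : evalList [] α = algebraMapInv α := rfl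

lemma evalList_add (l : List (Module.Dual 𝕜 W)) (α β : ExteriorAlgebra 𝕜 W) :
    evalList l (α + β) = evalList l α + evalList l β := by
  induction l generalizing α β with
  | nil => exact map_add _ _ _
  | cons θ l ih => rw [evalList_cons, map_add, ih]; rfl

lemma evalList_smul (l : List (Module.Dual 𝕜 W)) (c : 𝕜) (α : ExteriorAlgebra 𝕜 W) :
    evalList l (c • α) = c * evalList l α := by
  induction l generalizing α with
  | nil => exact map_smul algebraMapInv _ _
  | cons θ l ih => rw [evalList_cons, map_smul, ih]; rfl

lemma evalList_zero (l : List (Module.Dual 𝕜 W)) :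
    evalList l (0 : ExteriorAlgebra 𝕜 W) = 0 := by
  simpa using evalList_smul l 0 (0 : ExteriorAlgebra 𝕜 W)

lemma evalList_of_deg {k : ℕ} {α : ExteriorAlgebra 𝕜 W} (h : α ∈ ⋀[𝕜]^k W)
    (l : List (Module.Dual 𝕜 W)) (hl : l.length ≠ k) : evalList l α = 0 := by
  induction l generalizing k α with
  | nil => exact algebraMapInv_of_deg h (fun h => hl (by simp [h]))
  | cons θ l ih =>
    rw [evalList_cons]
    cases k with
    | zero => rw [cl_zero_deg θ h, evalList_zero]
    | succ k => exact ih (cl_mem θ h) (by simpa using hl)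

/-- The homogeneous component of degree `k`. -/
def comp (k : ℕ) : ExteriorAlgebra 𝕜 W →ₗ[𝕜] ExteriorAlgebra 𝕜 W :=
  GradedAlgebra.proj (fun i : ℕ => ⋀[𝕜]^i W) k

lemma comp_mem (k : ℕ) (α : ExteriorAlgebra 𝕜 W) : comp k α ∈ ⋀[𝕜]^k W := by
  rw [comp, GradedAlgebra.proj_apply]; exact SetLike.coe_mem _

lemma comp_of_deg {k : ℕ} {α : ExteriorAlgebra 𝕜 W} (h : α ∈ ⋀[𝕜]^k W) : comp k α = α := by
  rw [comp, GradedAlgebra.proj_apply]; exact DirectSum.decompose_of_mem_same _ h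

lemma comp_of_deg_ne {k j : ℕ} {α : ExteriorAlgebra 𝕜 W} (h : α ∈ ⋀[𝕜]^k W) (hj : k ≠ j) :
    comp j α = 0 := by
  rw [comp, GradedAlgebra.proj_apply]; exact DirectSum.decompose_of_mem_ne _ h hj

@[elab_as_elim]
lemma homogeneous_induction {C : ExteriorAlgebra 𝕜 W → Prop}
    (hadd : ∀ a b, C a → C b → C (a + b))
    (hhom : ∀ k, ∀ a ∈ ⋀[𝕜]^k W, C a) (a : ExteriorAlgebra 𝕜 W) : C a := by
  induction a using DirectSum.Decomposition.inductionOn (fun i : ℕ => ⋀[𝕜]^i W) with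
  | zero => exact hhom 0 0 (Submodule.zero_mem _)
  | add a b ha hb => exact hadd a b ha hb
  | homogeneous m => exact hhom _ _ m.2

lemma eq_of_comp {α β : ExteriorAlgebra 𝕜 W} (h : ∀ k, comp k α = comp k β) : α = β := by
  apply (DirectSum.decompose (fun i : ℕ => ⋀[𝕜]^i W)).injective
  ext k
  have := h k
  simpa only [comp, GradedAlgebra.proj_apply] using this

lemma evalList_comp (l : List (Module.Dual 𝕜 W)) (α : ExteriorAlgebra 𝕜 W) :
    evalList l (comp l.length α) = evalList l α := by
  induction α using homogeneous_induction with
  | hadd a b ha hb => rw [map_add, evalList_add, evalList_add, ha, hb]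
  | hhom k a h =>
    by_cases hk : k = l.length
    · subst hk; rw [comp_of_deg h]
    · rw [comp_of_deg_ne h hk, evalList_zero, evalList_of_deg h l (Ne.symm hk)]

lemma evalList_comp_ne (l : List (Module.Dual 𝕜 W)) (α : ExteriorAlgebra 𝕜 W) {k : ℕ}
    (hk : l.length ≠ k) : evalList l (comp k α) = 0 :=
  evalList_of_deg (comp_mem k α) l hk

lemma ext_mul_comm_ι (w : W) {k : ℕ} {α : ExteriorAlgebra 𝕜 W} (h : α ∈ ⋀[𝕜]^k W) :
    α * ExteriorAlgebra.ι 𝕜 w = (-1 : 𝕜) ^ k • (ExteriorAlgebra.ι 𝕜 w * α) := by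
  refine degree_induction (C := fun k a => a * ExteriorAlgebra.ι 𝕜 w =
    (-1 : 𝕜) ^ k • (ExteriorAlgebra.ι 𝕜 w * a)) ?_ ?_ ?_ h
  · intro c; simp [Algebra.commutes]
  · intro k a b ha hb; rw [add_mul, ha, hb, mul_add, smul_add]
  · intro k v a _ ih
    rw [mul_assoc, ih, mul_smul_comm, ← mul_assoc, ← mul_assoc,
      eq_neg_of_add_eq_zero_left (ExteriorAlgebra.ι_add_mul_swap v w), neg_mul, smul_neg,
      pow_succ, mul_neg_one, neg_smul]

lemma ext_mul_comm {k l : ℕ} {α β : ExteriorAlgebra 𝕜 W} (h : α ∈ ⋀[𝕜]^k W)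
    (h' : β ∈ ⋀[𝕜]^l W) : β * α = (-1 : 𝕜) ^ (k * l) • (α * β) := by
  refine degree_induction (C := fun k a => β * a = (-1 : 𝕜) ^ (k * l) • (a * β)) ?_ ?_ ?_ h
  · intro c; simp [Algebra.commutes]
  · intro k a b ha hb; rw [add_mul, mul_add, ha, hb, smul_add]
  · intro k v a _ ih
    rw [← mul_assoc, ext_mul_comm_ι v h', smul_mul_assoc, mul_assoc, ih, mul_smul_comm,
      smul_smul, ← mul_assoc, add_mul, one_mul, pow_add, mul_comm]

/-! ### Dual frames -/

/-- The families `e` and `θ` are dual bases. -/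
structure IsDualFrame {ι : Type*} [Fintype ι] [DecidableEq ι] (e : ι → W)
    (θ : ι → Module.Dual 𝕜 W) : Prop where
  sum : ∀ w, ∑ i, θ i w • e i = w
  pair : ∀ i j, θ i (e j) = if i = j then 1 else 0

section Frame

variable {ι : Type*} [Fintype ι] [DecidableEq ι] {e : ι → W} {θ : ι → Module.Dual 𝕜 W}

/-- The operator `∑ e_i ∧ i_{θ_i}` is a derivation that is the identity in degree one, hence counts
the degree. -/
lemma IsDualFrame.euler (h : IsDualFrame e θ) {k : ℕ} {α : ExteriorAlgebra 𝕜 W}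
    (hα : α ∈ ⋀[𝕜]^k W) :
    ∑ i, ExteriorAlgebra.ι 𝕜 (e i) * cl (θ i) α = (k : 𝕜) • α := by
  refine degree_induction (C := fun k a => ∑ i, ExteriorAlgebra.ι 𝕜 (e i) * cl (θ i) a =
    (k : 𝕜) • a) ?_ ?_ ?_ hα
  · intro c; simp
  · intro k a b ha hb; simp only [map_add, mul_add, Finset.sum_add_distrib, ha, hb, smul_add]
  · intro k w a _ ih
    have h1 : ∀ i, ExteriorAlgebra.ι 𝕜 (e i) * cl (θ i) (ExteriorAlgebra.ι 𝕜 w * a) =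
        ExteriorAlgebra.ι 𝕜 (θ i w • e i) * a +
          ExteriorAlgebra.ι 𝕜 w * (ExteriorAlgebra.ι 𝕜 (e i) * cl (θ i) a) := by
      intro i
      rw [cl_ι_mul, mul_sub, mul_smul_comm, map_smul, smul_mul_assoc, ← mul_assoc, ← mul_assoc,
        eq_neg_of_add_eq_zero_left (ExteriorAlgebra.ι_add_mul_swap (e i) w), neg_mul,
        sub_neg_eq_add]
    simp only [h1, Finset.sum_add_distrib, ← Finset.mul_sum, ← Finset.sum_mul, ← map_sum, ih,
      h.sum]
    rw [mul_smul_comm, Nat.cast_succ, add_smul, one_smul, add_comm]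

/-- The Euler identity gives `(k + 1) α = 0`, and the characteristic is zero. -/
lemma IsDualFrame.eq_zero_of_cl (h : IsDualFrame e θ) {k : ℕ} {α : ExteriorAlgebra 𝕜 W}
    (hα : α ∈ ⋀[𝕜]^(k + 1) W) (h0 : ∀ i, cl (θ i) α = 0) : α = 0 := by
  have := h.euler hα
  simp only [h0, mul_zero, Finset.sum_const_zero] at this
  exact (smul_eq_zero.1 this.symm).resolve_left (Nat.cast_ne_zero.2 (Nat.succ_ne_zero k))

lemma cl_comp (η : Module.Dual 𝕜 W) (k : ℕ) (α : ExteriorAlgebra 𝕜 W) :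
    cl η (comp (k + 1) α) = comp k (cl η α) := by
  induction α using homogeneous_induction with
  | hadd a b ha hb => simp only [map_add, ha, hb]
  | hhom j a h =>
    cases j with
    | zero => rw [comp_of_deg_ne h (by omega), cl_zero_deg η h, map_zero, map_zero]
    | succ j =>
      by_cases hj : j = k
      · subst hj; rw [comp_of_deg h, comp_of_deg (cl_mem η h)]
      · rw [comp_of_deg_ne h (by omega), comp_of_deg_ne (cl_mem η h) hj, map_zero]

lemma IsDualFrame.eq_algebraMap_of_cl (h : IsDualFrame e θ) {α : ExteriorAlgebra 𝕜 W}
    (h0 : ∀ i, cl (θ i) α = 0) : α = algebraMap 𝕜 _ (algebraMapInv α) := by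
  have h1 : ∀ k, comp (k + 1) α = 0 := fun k =>
    h.eq_zero_of_cl (comp_mem _ _) fun i => by rw [cl_comp, h0, map_zero]
  have h2 : α = comp 0 α := eq_of_comp fun k => by
    cases k with
    | zero => rw [comp_of_deg (comp_mem 0 α)]
    | succ k => rw [h1, comp_of_deg_ne (comp_mem 0 α) (by omega)]
  obtain ⟨c, hc⟩ := mem_zero_iff.1 (comp_mem 0 α)
  rw [h2, ← hc, algebraMapInv_algebraMap]

/-- Lists of length `k` see only the component of degree `k`, so the components can be tested
separately, peeling off one contraction at a time. -/
lemma IsDualFrame.eq_zero_of_evalList (h : IsDualFrame e θ) {α : ExteriorAlgebra 𝕜 W}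
    (h0 : ∀ l : List ι, evalList (l.map θ) α = 0) : α = 0 := by
  have key : ∀ k : ℕ, ∀ β ∈ ⋀[𝕜]^k W,
      (∀ l : List ι, l.length = k → evalList (l.map θ) β = 0) → β = 0 := by
    intro k
    induction k with
    | zero =>
      intro β hβ hl
      obtain ⟨c, rfl⟩ := mem_zero_iff.1 hβ
      have := hl [] rfl
      rw [List.map_nil, evalList_nil, algebraMapInv_algebraMap] at this
      rw [this, map_zero]
    | succ k ih =>
      intro β hβ hl
      refine h.eq_zero_of_cl hβ fun i => ih _ (cl_mem _ hβ) fun l hlk => ?_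
      exact hl (i :: l) (by simp [hlk])
  refine eq_of_comp fun k => ?_
  rw [map_zero]
  refine key k _ (comp_mem k α) fun l hl => ?_
  have := evalList_comp (l.map θ) α
  rw [List.length_map, hl] at this
  rw [this, h0]

lemma IsDualFrame.eq_zero_of_lt (h : IsDualFrame e θ) {k : ℕ} {α : ExteriorAlgebra 𝕜 W}
    (hα : α ∈ ⋀[𝕜]^k W) (hk : Fintype.card ι < k) : α = 0 := by
  have b : Submodule.span 𝕜 (Set.range e) = ⊤ := by
    rw [Submodule.eq_top_iff']
    intro w
    rw [← h.sum w]
    exact Submodule.sum_mem _ fun i _ => Submodule.smul_mem _ _ (Submodule.subset_span ⟨i, rfl⟩)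
  have hf : Module.Finite 𝕜 W := ⟨⟨(Set.finite_range e).toFinset, by simpa using b⟩⟩
  have hr : Module.finrank 𝕜 W ≤ Fintype.card ι := by
    rw [← finrank_top, ← b]
    exact finrank_range_le_card e
  have h1 : Module.finrank 𝕜 (⋀[𝕜]^k W) = 0 := by
    rw [exteriorPower.finrank_eq, Nat.choose_eq_zero_of_lt (by omega)]
  have h2 := Module.finrank_zero_iff.1 h1
  exact congrArg Subtype.val (Subsingleton.elim (⟨α, hα⟩ : ⋀[𝕜]^k W) 0)

end Frame

lemma evalList_ι_mul {E : Type*} [AddCommGroup E] [Module 𝕜 E]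
    (pair : E → Module.Dual 𝕜 W) (w : W) (α : ExteriorAlgebra 𝕜 W) (l : List E) :
    evalList (l.map pair) (ExteriorAlgebra.ι 𝕜 w * α) =
      wedgeC (fun v => pair v w) (fun l => evalList (l.map pair) α) l := by
  induction l generalizing α with
  | nil => exact algebraMapInv_ι_mul _ _
  | cons v l ih =>
    rw [List.map_cons, evalList_cons, cl_ι_mul, sub_eq_add_neg, ← neg_one_smul 𝕜,
      evalList_add, evalList_smul, evalList_smul, ih, neg_one_mul, ← sub_eq_add_neg]
    rfl

/-- Alternating cochains on a space with a dual frame come from elements of the exterior algebra. -/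
lemma exists_evalList_of_isAlt {E ι : Type*} [AddCommGroup E] [Module 𝕜 E] [Fintype ι]
    [DecidableEq ι] {e : ι → E} {θ : ι → Module.Dual 𝕜 E} (h : IsDualFrame e θ)
    {φ : List E → 𝕜} (hφ : IsAlt φ) :
    ∃ α : ExteriorAlgebra 𝕜 (Module.Dual 𝕜 E), ∀ l, evalList (l.map (Module.Dual.eval 𝕜 E)) α = φ l := by
  -- Induction on the set `S` of frame directions on which `φ` may depend. For a new index `j`,
  -- write `φ = θ_j ∧ i_{e_j}φ + (φ - θ_j ∧ i_{e_j}φ)`; both `i_{e_j}φ` and the remainder are killed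
  -- by `e_j` and by every direction outside `S`. With `S` empty, only the value on the empty list
  -- is left.
  have key : ∀ S : Finset ι, ∀ φ : List E → 𝕜, IsAlt φ → (∀ j ∉ S, ins (e j) φ = 0) →
      ∃ α : ExteriorAlgebra 𝕜 (Module.Dual 𝕜 E), ∀ l, evalList (l.map (Module.Dual.eval 𝕜 E)) α = φ l := by
    intro S
    induction S using Finset.induction_on with
    | empty =>
      intro φ hφ h0
      have hv : ∀ v, ins v φ = 0 := by
        intro v
        let f : E →ₗ[𝕜] (List E → 𝕜) :=
          { toFun := fun v => ins v φ
            map_add' := hφ.head.add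
            map_smul' := hφ.head.smul }
        change f v = 0
        rw [← h.sum v, map_sum]
        exact Finset.sum_eq_zero fun i _ => by rw [map_smul]; simp [f, h0 i]
      refine ⟨algebraMap 𝕜 _ (φ []), fun l => ?_⟩
      cases l with
      | nil => exact algebraMapInv_algebraMap _
      | cons v l =>
        rw [List.map_cons, evalList_cons, cl_algebraMap, evalList_zero]
        exact (congrFun (hv v) l).symm
    | insert j S hj ih =>
      intro φ hφ h0
      have hw : IsAlt (wedgeC (θ j) (ins (e j) φ)) := (hφ.ins (e j)).wedgeC (θ j)
      obtain ⟨α, hα⟩ := ih (ins (e j) φ) (hφ.ins _) (by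
        intro i hi
        by_cases hij : i = j
        · rw [hij, hφ.head.alt]
        · rw [hφ.swap, h0 i (by simp [hij, hi]), ins_zero, neg_zero])
      obtain ⟨β, hβ⟩ := ih (φ - wedgeC (θ j) (ins (e j) φ)) (hφ.sub hw) (by
        intro i hi
        by_cases hij : i = j
        · rw [hij, ins_sub, ins_wedgeC, hφ.head.alt, wedgeC_zero, h.pair]
          simp
        · rw [ins_sub, ins_wedgeC, hφ.swap, h0 i (by simp [hij, hi]), ins_zero, neg_zero,
            wedgeC_zero, h.pair, if_neg (Ne.symm hij)]
          simp)
      refine ⟨ExteriorAlgebra.ι 𝕜 (θ j) * α + β, fun l => ?_⟩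
      have hα' : (fun l => evalList (l.map (Module.Dual.eval 𝕜 E)) α) = ins (e j) φ := funext hα
      rw [evalList_add, evalList_ι_mul, hβ, hα']
      simp
  exact key Finset.univ φ hφ (by simp)

lemma isAlt_evalList {E : Type*} [AddCommGroup E] [Module 𝕜 E]
    (pair : E →ₗ[𝕜] Module.Dual 𝕜 W) (α : ExteriorAlgebra 𝕜 W) :
    IsAlt fun l : List E => evalList (l.map pair) α := by
  refine IsAlt.of_coind (fun Φ => ∃ α, Φ = fun l : List E => evalList (l.map pair) α) ?_
    ⟨α, rfl⟩
  rintro _ ⟨α, rfl⟩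
  have hi : ∀ X : E, ins X (fun l : List E => evalList (l.map pair) α) =
      fun l : List E => evalList (l.map pair) (cl (pair X) α) := fun X => rfl
  refine ⟨⟨fun X Y => ?_, fun f X => ?_, fun X => ?_⟩, fun X => ⟨_, hi X⟩⟩
  · funext l; simp only [hi, map_add, LinearMap.add_apply, evalList_add, Pi.add_apply]
  · funext l; simp only [hi, map_smul, LinearMap.smul_apply, evalList_smul, Pi.smul_apply,
      smul_eq_mul]
  · funext l
    change evalList (l.map pair) (cl (pair X) (cl (pair X) α)) = 0
    rw [contractLeft_contractLeft, evalList_zero]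

lemma evalList_inv (l : List (Module.Dual 𝕜 W)) (α : ExteriorAlgebra 𝕜 W) :
    evalList l (inv α) = (-1 : 𝕜) ^ l.length * evalList l α := by
  induction α using homogeneous_induction with
  | hadd a b ha hb => rw [map_add, evalList_add, evalList_add, ha, hb, mul_add]
  | hhom k a h =>
    rw [inv_of_deg h, evalList_smul]
    by_cases hk : l.length = k
    · rw [hk]
    · rw [evalList_of_deg h l hk, mul_zero, mul_zero]

end Fibre

end LieBialg

namespace LieBialg

open CliffordAlgebra ExteriorAlgebra

/-! ### Contraction of forms by multivectors. -/

section Contract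

variable {𝕜 : Type*} [RCLike 𝕜] {E : Type*} [AddCommGroup E] [Module 𝕜 E]

/-- Contraction by a multivector, as an operator on forms. -/
def ic (u : ExteriorAlgebra 𝕜 E) : Module.End 𝕜 (ExteriorAlgebra 𝕜 (Module.Dual 𝕜 E)) :=
  (contract u).unop

lemma ic_mul (u v : ExteriorAlgebra 𝕜 E) (α : ExteriorAlgebra 𝕜 (Module.Dual 𝕜 E)) :
    ic (u * v) α = ic v (ic u α) := by
  simp [ic, Module.End.mul_apply]

lemma ic_add (u v : ExteriorAlgebra 𝕜 E) (α : ExteriorAlgebra 𝕜 (Module.Dual 𝕜 E)) :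
    ic (u + v) α = ic u α + ic v α := by simp [ic]

lemma ic_smul (c : 𝕜) (u : ExteriorAlgebra 𝕜 E) (α : ExteriorAlgebra 𝕜 (Module.Dual 𝕜 E)) :
    ic (c • u) α = c • ic u α := by simp [ic]

lemma ic_neg (u : ExteriorAlgebra 𝕜 E) (α : ExteriorAlgebra 𝕜 (Module.Dual 𝕜 E)) :
    ic (-u) α = -ic u α := by simp [ic]

lemma ic_ι (X : E) (α : ExteriorAlgebra 𝕜 (Module.Dual 𝕜 E)) :
    ic (ExteriorAlgebra.ι 𝕜 X) α = cl (Module.Dual.eval 𝕜 E X) α := by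
  simp [ic, contract, ExteriorAlgebra.lift_ι_apply]

lemma ic_algebraMap (c : 𝕜) (α : ExteriorAlgebra 𝕜 (Module.Dual 𝕜 E)) :
    ic (algebraMap 𝕜 (ExteriorAlgebra 𝕜 E) c) α = c • α := by
  rw [ic, AlgHom.commutes]
  rfl

lemma sharp_eq (Ω : ExteriorAlgebra 𝕜 (Module.Dual 𝕜 E)) (u : ExteriorAlgebra 𝕜 E) :
    sharp Ω u = ic u Ω := rfl

/-- Right contraction of a multivector by a linear form. -/
def cr (η : Module.Dual 𝕜 E) (u : ExteriorAlgebra 𝕜 E) : ExteriorAlgebra 𝕜 E :=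
  -cl η (inv u)

lemma cr_ι_mul (η : Module.Dual 𝕜 E) (X : E) (u : ExteriorAlgebra 𝕜 E) :
    cr η (ExteriorAlgebra.ι 𝕜 X * u) = η X • inv u + ExteriorAlgebra.ι 𝕜 X * cr η u := by
  rw [cr, cr, map_mul, inv_ι, neg_mul, map_neg, cl_ι_mul]
  simp only [mul_neg]
  abel

/-- Obtained by iterating `η ∧ i_X α = η(X) α - i_X(η ∧ α)`. Applied to a form of top degree, the
last term drops, so under `Ω♯` exterior multiplication by `η` becomes right contraction by `η`. -/
lemma ι_mul_ic (η : Module.Dual 𝕜 E) (u : ExteriorAlgebra 𝕜 E)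
    (α : ExteriorAlgebra 𝕜 (Module.Dual 𝕜 E)) :
    ExteriorAlgebra.ι 𝕜 η * ic u α = ic (cr η u) α + ic (inv u) (ExteriorAlgebra.ι 𝕜 η * α) := by
  induction u using ext_induction generalizing α with
  | h0 c =>
    rw [ic_algebraMap, cr, AlgHom.commutes, ic_algebraMap, cl_algebraMap, neg_zero]
    simp [ic]
  | hadd a b ha hb =>
    have : cr η (a + b) = cr η a + cr η b := by simp [cr, add_comm]
    rw [ic_add, mul_add, ha, hb, this, map_add, ic_add, ic_add]
    abel
  | hmul X a ih =>
    rw [ic_mul, ih, ic_ι, cr_ι_mul, ic_add, ic_smul, ic_mul, ic_ι, map_mul inv, inv_ι, ic_mul, ic_neg,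
      ic_ι, cl_ι_mul, Module.Dual.eval_apply, neg_sub, map_sub, map_smul]
    abel

lemma ic_inv_inv (u : ExteriorAlgebra 𝕜 E) (α : ExteriorAlgebra 𝕜 (Module.Dual 𝕜 E)) :
    ic (inv u) (inv α) = inv (ic u α) := by
  have hcl : ∀ (φ : Module.Dual 𝕜 (Module.Dual 𝕜 E)) (α : ExteriorAlgebra 𝕜 (Module.Dual 𝕜 E)),
      -cl φ (inv α) = inv (cl φ α) := by
    intro φ α
    induction α using homogeneous_induction with
    | hadd a b ha hb => simp only [map_add, neg_add, ha, hb]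
    | hhom k a h =>
      cases k with
      | zero => rw [cl_zero_deg φ h, cl_zero_deg φ (inv_mem_deg h)]; simp
      | succ k =>
        rw [inv_of_deg h, inv_of_deg (cl_mem φ h), map_smul, pow_succ, mul_neg_one, neg_smul,
          neg_neg]
  induction u using ext_induction generalizing α with
  | h0 c => rw [AlgHom.commutes, ic_algebraMap, ic_algebraMap, map_smul]
  | hadd a b ha hb => rw [map_add, ic_add, ic_add, map_add, ha, hb]
  | hmul X a ih => rw [map_mul, ic_mul, ic_mul, ← ih, inv_ι, ic_neg, ic_ι, ic_ι, hcl]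

lemma ic_deg {k j : ℕ} {u : ExteriorAlgebra 𝕜 E} (hu : u ∈ ⋀[𝕜]^k E)
    {α : ExteriorAlgebra 𝕜 (Module.Dual 𝕜 E)} (hα : α ∈ ⋀[𝕜]^(k + j) (Module.Dual 𝕜 E)) :
    ic u α ∈ ⋀[𝕜]^j (Module.Dual 𝕜 E) := by
  refine degree_induction (C := fun k u => ∀ α ∈ ⋀[𝕜]^(k + j) (Module.Dual 𝕜 E),
    ic u α ∈ ⋀[𝕜]^j (Module.Dual 𝕜 E)) ?_ ?_ ?_ hu α hα
  · intro c α h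
    rw [ic_algebraMap]; rw [zero_add] at h; exact Submodule.smul_mem _ _ h
  · intro k a b ha hb α h
    rw [ic_add]; exact Submodule.add_mem _ (ha α h) (hb α h)
  · intro k X a _ ih α h
    rw [ic_mul, ic_ι]
    refine ih _ (cl_mem _ ?_)
    rwa [show k + j + 1 = k + 1 + j by ring]

end Contract

/-! ### Bijectivity and degree of `Ω♯` in one fibre. -/

section Sharp

variable {𝕜 : Type*} [RCLike 𝕜] {E : Type*} [AddCommGroup E] [Module 𝕜 E]
  {ι : Type*} [Fintype ι] [DecidableEq ι] {e : ι → E} {θ : ι → Module.Dual 𝕜 E}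

lemma IsDualFrame.dual (h : IsDualFrame e θ) :
    IsDualFrame θ (fun i => Module.Dual.eval 𝕜 E (e i)) where
  sum η := by
    ext v
    conv_rhs => rw [← h.sum v]
    simp [mul_comm]
  pair i j := by simp [h.pair, eq_comm]

/-- A nonzero subspace of the exterior algebra that is stable under contractions contains `1`. -/
lemma IsDualFrame.one_mem (h : IsDualFrame e θ) (K : Submodule 𝕜 (ExteriorAlgebra 𝕜 E))
    (hK : ∀ i, ∀ u ∈ K, cl (θ i) u ∈ K) {u : ExteriorAlgebra 𝕜 E} (hu : u ∈ K) (hne : u ≠ 0) :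
    1 ∈ K := by
  by_contra h1
  have hs : ∀ c : 𝕜, algebraMap 𝕜 _ c ∈ K → c = 0 := by
    intro c hc
    by_contra hc0
    apply h1
    have := K.smul_mem c⁻¹ hc
    rwa [Algebra.algebraMap_eq_smul_one, smul_smul, inv_mul_cancel₀ hc0, one_smul] at this
  -- Induction on a bound for the degrees occurring in `w`. Contractions lower the bound, so they
  -- all vanish on `w`; then `w` is a scalar, hence zero by `hs`.
  have key : ∀ N : ℕ, ∀ w ∈ K, (∀ k, N ≤ k → comp k w = 0) → w = 0 := by
    intro N
    induction N with
    | zero =>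
      intro w _ hw
      exact eq_of_comp fun k => by rw [hw k (Nat.zero_le k), map_zero]
    | succ N ih =>
      intro w hwK hw
      have h2 : ∀ i, cl (θ i) w = 0 := fun i => ih _ (hK i w hwK) fun k hk => by
        rw [← cl_comp, hw _ (by omega), map_zero]
      have h3 := h.eq_algebraMap_of_cl h2
      rw [h3] at hwK ⊢
      rw [hs _ hwK, map_zero]
  exact hne (key (Fintype.card ι + 1) u hu fun k hk => h.eq_zero_of_lt (comp_mem k u) hk)

variable {Ω : ExteriorAlgebra 𝕜 (Module.Dual 𝕜 E)}

lemma IsDualFrame.ι_mul_top (h : IsDualFrame e θ)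
    (hΩ : Ω ∈ ⋀[𝕜]^(Fintype.card ι) (Module.Dual 𝕜 E)) (η : Module.Dual 𝕜 E) :
    ExteriorAlgebra.ι 𝕜 η * Ω = 0 :=
  h.dual.eq_zero_of_lt (ι_mul_mem η hΩ) (Nat.lt_succ_self _)

lemma IsDualFrame.ι_mul_sharp (h : IsDualFrame e θ)
    (hΩ : Ω ∈ ⋀[𝕜]^(Fintype.card ι) (Module.Dual 𝕜 E)) (η : Module.Dual 𝕜 E)
    (u : ExteriorAlgebra 𝕜 E) :
    ExteriorAlgebra.ι 𝕜 η * ic u Ω = ic (cr η u) Ω := by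
  rw [ι_mul_ic, h.ι_mul_top hΩ, map_zero, add_zero]

lemma ic_inv_top {n : ℕ} (hΩ : Ω ∈ ⋀[𝕜]^n (Module.Dual 𝕜 E)) (u : ExteriorAlgebra 𝕜 E) :
    ic (inv u) Ω = (-1 : 𝕜) ^ n • inv (ic u Ω) := by
  rw [← ic_inv_inv, inv_of_deg hΩ, map_smul, smul_smul, ← mul_pow]
  simp

/-- By `ι_mul_sharp` the kernel is stable under contraction by covectors. If it were nonzero it
would contain `1`, forcing `Ω = 0`. -/
lemma IsDualFrame.sharp_injective (h : IsDualFrame e θ)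
    (hΩ : Ω ∈ ⋀[𝕜]^(Fintype.card ι) (Module.Dual 𝕜 E)) (h0 : Ω ≠ 0) :
    Function.Injective (sharp Ω) := by
  let K : Submodule 𝕜 (ExteriorAlgebra 𝕜 E) :=
    { carrier := {u | ic u Ω = 0}
      add_mem' := fun {a b} ha hb => by
        rw [Set.mem_ofPred_eq] at *; rw [ic_add, ha, hb, add_zero]
      zero_mem' := by simp [ic]
      smul_mem' := fun c u hu => by
        rw [Set.mem_ofPred_eq] at *; rw [ic_smul, hu, smul_zero] }
  have hinv : ∀ u ∈ K, inv u ∈ K := fun u hu => by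
    change ic (inv u) Ω = 0
    rw [ic_inv_top hΩ, show ic u Ω = 0 from hu, map_zero, smul_zero]
  have hcl : ∀ i, ∀ u ∈ K, cl (θ i) u ∈ K := fun i u hu => by
    have h1 : cr (θ i) (inv u) ∈ K := by
      change ic _ Ω = 0
      rw [← h.ι_mul_sharp hΩ, show ic (inv u) Ω = 0 from hinv u hu, mul_zero]
    rw [cr, inv_inv] at h1
    exact K.neg_mem_iff.1 h1
  intro u v huv
  by_contra hne
  have : u - v ∈ K := by
    change ic (u - v) Ω = 0
    rw [sub_eq_add_neg, ic_add, ic_neg, ← sub_eq_add_neg]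
    exact sub_eq_zero.2 huv
  have h1 : (1 : ExteriorAlgebra 𝕜 E) ∈ K := h.one_mem K hcl this (sub_ne_zero.2 hne)
  apply h0
  have h2 : ic (1 : ExteriorAlgebra 𝕜 E) Ω = 0 := h1
  simpa [ic] using h2

/-- The image contains `Ω` and is stable under contraction by vectors, so it contains `1`; it is
also stable under exterior multiplication by covectors, so it is everything. -/
lemma IsDualFrame.sharp_surjective (h : IsDualFrame e θ)
    (hΩ : Ω ∈ ⋀[𝕜]^(Fintype.card ι) (Module.Dual 𝕜 E)) (h0 : Ω ≠ 0) :
    Function.Surjective (sharp Ω) := by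
  let K : Submodule 𝕜 (ExteriorAlgebra 𝕜 (Module.Dual 𝕜 E)) :=
    { carrier := Set.range fun u => ic u Ω
      add_mem' := by
        rintro _ _ ⟨u, rfl⟩ ⟨v, rfl⟩
        exact ⟨u + v, ic_add u v Ω⟩
      zero_mem' := ⟨0, by simp [ic]⟩
      smul_mem' := by
        rintro c _ ⟨u, rfl⟩
        exact ⟨c • u, ic_smul c u Ω⟩ }
  have h1 : 1 ∈ K := by
    refine h.dual.one_mem K ?_ ⟨1, rfl⟩ (by simpa [ic] using h0)
    rintro i _ ⟨u, rfl⟩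
    exact ⟨u * ExteriorAlgebra.ι 𝕜 (e i), by simp only [ic_mul, ic_ι]⟩
  intro α
  change α ∈ K
  induction α using ext_induction with
  | h0 c => rw [Algebra.algebraMap_eq_smul_one]; exact K.smul_mem c h1
  | hadd a b ha hb => exact K.add_mem ha hb
  | hmul η a ha =>
    obtain ⟨u, rfl⟩ := ha
    exact ⟨cr η u, (h.ι_mul_sharp hΩ η u).symm⟩

/-- `Ω♯` intertwines the projections to degrees `i` and `j` with `i + j` the rank; injectivity then
forces all other components of `w` to vanish. -/
lemma IsDualFrame.deg_of_sharp (h : IsDualFrame e θ)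
    (hΩ : Ω ∈ ⋀[𝕜]^(Fintype.card ι) (Module.Dual 𝕜 E)) (h0 : Ω ≠ 0) {k j : ℕ}
    (hkj : k + j = Fintype.card ι) {w : ExteriorAlgebra 𝕜 E}
    (hw : ic w Ω ∈ ⋀[𝕜]^j (Module.Dual 𝕜 E)) : w ∈ ⋀[𝕜]^k E := by
  have key : ∀ i j, i + j = Fintype.card ι → ∀ w : ExteriorAlgebra 𝕜 E,
      comp j (ic w Ω) = ic (comp i w) Ω := by
    intro i j hij w
    induction w using homogeneous_induction with
    | hadd a b ha hb => simp only [map_add, ic_add, ha, hb]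
    | hhom k a ha =>
      by_cases hk : Fintype.card ι < k
      · rw [h.eq_zero_of_lt ha hk]; simp [ic]
      · have := ic_deg ha (j := Fintype.card ι - k)
          (α := Ω) (by rwa [Nat.add_sub_cancel' (by omega)])
        by_cases hki : k = i
        · subst hki
          rw [comp_of_deg ha, comp_of_deg]
          rwa [show Fintype.card ι - k = j by omega] at this
        · rw [comp_of_deg_ne ha hki, comp_of_deg_ne this (by omega)]
          simp [ic]
  have h1 : w = comp k w := eq_of_comp fun i => by
    by_cases hi : k = i
    · subst hi; rw [comp_of_deg (comp_mem k w)]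
    · rw [comp_of_deg_ne (comp_mem k w) hi]
      by_cases hi' : Fintype.card ι < i
      · exact h.eq_zero_of_lt (comp_mem i w) hi'
      · apply h.sharp_injective hΩ h0
        rw [sharp_eq, sharp_eq, ← key i (Fintype.card ι - i) (by omega),
          comp_of_deg_ne hw (by omega)]
        simp [ic]
  rw [h1]
  exact comp_mem k w

end Sharp

end LieBialg

namespace LieBialg

open Filter Topology

/-! ### Smooth functions, derivatives along the anchor, and bump functions. -/

section SmoothFunctions

variable {𝕜 : Type*} [RCLike 𝕜] {m : ℕ} {M : Type*} [TopologicalSpace M]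
  [ChartedSpace (EuclideanSpace ℝ (Fin m)) M]

lemma mem_smoothFun_iff {f : M → 𝕜} :
    f ∈ smoothFun 𝕜 m M ↔ ∀ x, ContMDiffAt (𝓡 m) 𝓘(ℝ, 𝕜) ∞ f x := Iff.rfl

/-- A function that agrees near every point with a smooth function is smooth. -/
lemma smoothFun_of_local {f : M → 𝕜} (h : ∀ x, ∃ g ∈ smoothFun 𝕜 m M, f =ᶠ[𝓝 x] g) :
    f ∈ smoothFun 𝕜 m M := by
  rw [mem_smoothFun_iff]
  intro x
  obtain ⟨g, hg, hfg⟩ := h x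
  exact (hg x).congr_of_eventuallyEq hfg

lemma mdifferentiableAt_of_mem {f : M → 𝕜} (hf : f ∈ smoothFun 𝕜 m M) (x : M) :
    MDifferentiableAt (𝓡 m) 𝓘(ℝ, 𝕜) f x :=
  (mem_smoothFun_iff.1 hf x).mdifferentiableAt (by simp)

/-- The differential of a function at a point, with values in `𝕜`. -/
def mdf (f : M → 𝕜) (x : M) : TangentSpace (𝓡 m) x →L[ℝ] 𝕜 := mfderiv (𝓡 m) 𝓘(ℝ, 𝕜) f x

lemma vecDeriv_eq {x : M} (v : 𝕜 ⊗[ℝ] TangentSpace (𝓡 m) x) (f : M → 𝕜) :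
    vecDeriv v f = LinearMap.liftBaseChange 𝕜 (mdf f x).toLinearMap v := rfl

lemma vecDeriv_congr {x : M} (v : 𝕜 ⊗[ℝ] TangentSpace (𝓡 m) x) {f g : M → 𝕜}
    (h : f =ᶠ[𝓝 x] g) : vecDeriv v f = vecDeriv v g := by
  have h1 : mdf (m := m) f x = mdf g x := h.mfderiv_eq
  rw [vecDeriv_eq, vecDeriv_eq, h1]

lemma vecDeriv_smul {x : M} (c : 𝕜) (v : 𝕜 ⊗[ℝ] TangentSpace (𝓡 m) x) (f : M → 𝕜) :
    vecDeriv (c • v) f = c * vecDeriv v f := by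
  simp [vecDeriv]

lemma vecDeriv_add {x : M} (v w : 𝕜 ⊗[ℝ] TangentSpace (𝓡 m) x) (f : M → 𝕜) :
    vecDeriv (v + w) f = vecDeriv v f + vecDeriv w f := by
  simp [vecDeriv]

lemma vecDeriv_fun_add {x : M} (v : 𝕜 ⊗[ℝ] TangentSpace (𝓡 m) x) {f g : M → 𝕜}
    (hf : f ∈ smoothFun 𝕜 m M) (hg : g ∈ smoothFun 𝕜 m M) :
    vecDeriv v (f + g) = vecDeriv v f + vecDeriv v g := by
  have h1 : mdf (f + g) x = mdf f x + mdf g x :=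
    mfderiv_add (mdifferentiableAt_of_mem hf x) (mdifferentiableAt_of_mem hg x)
  simp only [vecDeriv_eq, h1]
  induction v using TensorProduct.induction_on with
  | zero => simp
  | tmul c t => simp
  | add a b ha hb => simp only [map_add, ha, hb]; ring

lemma vecDeriv_fun_mul {x : M} (v : 𝕜 ⊗[ℝ] TangentSpace (𝓡 m) x) {f g : M → 𝕜}
    (hf : f ∈ smoothFun 𝕜 m M) (hg : g ∈ smoothFun 𝕜 m M) :
    vecDeriv v (f * g) = f x * vecDeriv v g + g x * vecDeriv v f := by
  have h1 : mdf (f * g) x = f x • mdf g x + g x • mdf f x :=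
    ((mdifferentiableAt_of_mem hf x).hasMFDerivAt.mul
      (mdifferentiableAt_of_mem hg x).hasMFDerivAt).mfderiv
  simp only [vecDeriv_eq, h1]
  induction v using TensorProduct.induction_on with
  | zero => simp
  | tmul c t => simp
  | add a b ha hb => simp only [map_add, ha, hb]; ring

lemma vecDeriv_const {x : M} (v : 𝕜 ⊗[ℝ] TangentSpace (𝓡 m) x) (c : 𝕜) :
    vecDeriv v (fun _ : M => c) = 0 := by
  have h1 : mdf (m := m) (fun _ : M => c) x = 0 := mfderiv_const
  simp only [vecDeriv_eq, h1]
  induction v using TensorProduct.induction_on with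
  | zero => simp
  | tmul c t => simp
  | add a b ha hb => simp only [map_add, ha, hb]; ring

variable [T2Space M] [IsManifold (𝓡 m) ∞ M]

/-- A smooth function that is `1` near `x₀` and has support in a given neighbourhood. -/
lemma exists_bump_tsupport (𝕜 : Type*) [RCLike 𝕜] (x₀ : M) {U : Set M} (hU : U ∈ 𝓝 x₀) :
    ∃ χ ∈ smoothFun 𝕜 m M, χ =ᶠ[𝓝 x₀] 1 ∧ ∀ x ∉ U, χ =ᶠ[𝓝 x] 0 := by
  obtain ⟨f, -, hf⟩ := (SmoothBumpFunction.nhds_basis_tsupport (I := 𝓡 m) x₀).mem_iff.1 hU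
  refine ⟨fun x => ((f x : ℝ) : 𝕜), ?_, ?_, ?_⟩
  · rw [mem_smoothFun_iff]
    intro x
    exact ((RCLike.ofRealCLM (K := 𝕜)).contDiff.contMDiff).contMDiffAt.comp x f.contMDiffAt
  · filter_upwards [f.eventuallyEq_one] with x hx
    simp [hx]
  · intro x hx
    filter_upwards [notMem_tsupport_iff_eventuallyEq.1 (fun h => hx (hf h))] with y hy
    simp [hy]

end SmoothFunctions

/-! ### Local frames, and the Lie–Rinehart algebra of sections. -/

section Sections

variable {𝕜 : Type*} [RCLike 𝕜] {m : ℕ} {M : Type*} [TopologicalSpace M]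
  [ChartedSpace (EuclideanSpace ℝ (Fin m)) M]
  {V : M → Type*} [∀ x, AddCommGroup (V x)] [∀ x, Module 𝕜 (V x)]
  {Γ : Submodule (smoothFun 𝕜 m M) (∀ x, V x)}

instance : Module (smoothFun 𝕜 m M) Γ := Submodule.module Γ

instance : SMul (smoothFun 𝕜 m M) Γ := Module.toDistribMulAction.toSMul

/-- Near every point there are global smooth sections of the bundle and of its dual that form dual
frames. -/
def HasFrames (Γ : Submodule (smoothFun 𝕜 m M) (∀ x, V x)) (n : ℕ) : Prop :=
  ∀ x₀ : M, ∃ (e : Fin n → Γ) (θ : Fin n → dualSections Γ),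
    ∀ᶠ x in 𝓝 x₀, IsDualFrame (fun i => (e i).1 x) (fun i => (θ i).1 x)

lemma vecDeriv_fun_smul {x : M} (v : 𝕜 ⊗[ℝ] TangentSpace (𝓡 m) x) (c : 𝕜) {f : M → 𝕜}
    (hf : f ∈ smoothFun 𝕜 m M) : vecDeriv v (c • f) = c * vecDeriv v f := by
  have h := vecDeriv_fun_mul v ((smoothFun 𝕜 m M).algebraMap_mem c) hf
  have h2 : vecDeriv v (algebraMap 𝕜 (M → 𝕜) c) = 0 := vecDeriv_const v c
  rw [Algebra.smul_def, h, h2, mul_zero, add_zero]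
  rfl

/-- The derivation `f ↦ ρ(X) f`. -/
def LieAlgebroid.deriv (L : LieAlgebroid Γ) (X : Γ) :
    Derivation 𝕜 (smoothFun 𝕜 m M) (smoothFun 𝕜 m M) :=
  Derivation.mk'
    { toFun := fun f => ⟨L.act X f.1, L.anchor_smooth X f.1 f.2⟩
      map_add' := fun f g => Subtype.ext <| funext fun _ => vecDeriv_fun_add _ f.2 g.2
      map_smul' := fun c f => Subtype.ext <| funext fun _ => vecDeriv_fun_smul _ c f.2 }
    (fun f g => Subtype.ext <| funext fun _ => vecDeriv_fun_mul _ f.2 g.2)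

/-- The anchor, as a linear map into derivations. -/
def LieAlgebroid.derivLin (L : LieAlgebroid Γ) :
    Γ →ₗ[smoothFun 𝕜 m M] Derivation 𝕜 (smoothFun 𝕜 m M) (smoothFun 𝕜 m M) where
  toFun := L.deriv
  map_add' X Y := by
    refine Derivation.ext fun f => Subtype.ext <| funext fun x => ?_
    have h : vecDeriv (L.anchor x (X.1 x + Y.1 x)) f.1 =
        vecDeriv (L.anchor x (X.1 x)) f.1 + vecDeriv (L.anchor x (Y.1 x)) f.1 := by
      rw [map_add, vecDeriv_add]
    exact h
  map_smul' g X := by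
    refine Derivation.ext fun f => Subtype.ext <| funext fun x => ?_
    have h : vecDeriv (L.anchor x (g.1 x • X.1 x)) f.1 =
        g.1 x * vecDeriv (L.anchor x (X.1 x)) f.1 := by
      rw [map_smul, vecDeriv_smul]
    exact h

/-- The bracket, as a biadditive map. -/
def LieAlgebroid.bracketAdd (L : LieAlgebroid Γ) : Γ →+ Γ →+ Γ where
  toFun X := (L.bracket X).toAddMonoidHom
  map_zero' := by rw [map_zero]; rfl
  map_add' X Y := by rw [map_add]; rfl

/-- The Lie–Rinehart algebra of sections of a Lie algebroid. -/
def LieAlgebroid.toLieRinehart (L : LieAlgebroid Γ) : LieRinehart 𝕜 (smoothFun 𝕜 m M) Γ where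
  act := L.derivLin
  bracket := L.bracketAdd
  bracket_self := L.bracket_self
  jacobi := L.jacobi
  act_bracket X Y f := Subtype.ext <| funext fun x => L.anchor_bracket X Y f.1 f.2 x
  leibniz X Y f := Subtype.ext <| funext fun x => L.leibniz X Y f x

lemma LieAlgebroid.act_congr (L : LieAlgebroid Γ) (X : Γ) {f g : M → 𝕜} {x : M}
    (h : f =ᶠ[𝓝 x] g) : L.act X f x = L.act X g x := vecDeriv_congr _ h

end Sections

/-! ### Frames of a smooth vector bundle. -/

section Bundle

variable {𝕜 : Type*} [RCLike 𝕜] {m : ℕ}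
    {M : Type*} [TopologicalSpace M] [T2Space M]
    [ChartedSpace (EuclideanSpace ℝ (Fin m)) M] [IsManifold (𝓡 m) ∞ M]
    {F : Type*} [NormedAddCommGroup F] [NormedSpace ℝ F] [NormedSpace 𝕜 F] [IsScalarTower ℝ 𝕜 F]
    [FiniteDimensional 𝕜 F]
    (A : M → Type*) [TopologicalSpace (Bundle.TotalSpace F A)]
    [∀ x, AddCommGroup (A x)] [∀ x, Module ℝ (A x)] [∀ x, Module 𝕜 (A x)]
    [∀ x, TopologicalSpace (A x)] [FiberBundle F A]
    [VectorBundle ℝ F A] [VectorBundle 𝕜 F A]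
    [ContMDiffVectorBundle ∞ F A (𝓡 m)]

/-- A basis of the model fibre and its coordinates, carried over by a local trivialization and cut
off by a bump function `χ`, are globally smooth; near `x₀`, where `χ = 1`, they are dual frames. -/
lemma hasFrames_sections : HasFrames (sections 𝕜 m F A) (Module.finrank 𝕜 F) := by
  intro x₀
  set t := trivializationAt F A x₀ with ht
  have htx : x₀ ∈ t.baseSet := FiberBundle.mem_baseSet_trivializationAt' x₀
  have hU : t.baseSet ∈ 𝓝 x₀ := t.open_baseSet.mem_nhds htx
  obtain ⟨χ, hχ, hχ1, hχ0⟩ := exists_bump_tsupport (m := m) 𝕜 x₀ hU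
  let b := Module.finBasis 𝕜 F
  have he : ∀ i, (fun x => χ x • t.symmₗ 𝕜 x (b i)) ∈ sections 𝕜 m F A := by
    intro i x
    by_cases hx : x ∈ t.baseSet
    · refine (t.contMDiffAt_section_iff (IB := 𝓡 m) (n := ∞) hx).2 ?_
      have h : ContMDiffAt (𝓡 m) 𝓘(ℝ, F) ∞ (fun x => χ x • b i) x :=
        ((contDiff_smul (𝕜 := ℝ) (𝕜' := 𝕜) (F := F)).contMDiff.contMDiffAt).comp x
          ((hχ x).prodMk_space contMDiffAt_const)
      refine h.congr_of_eventuallyEq ?_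
      filter_upwards [t.open_baseSet.mem_nhds hx] with y hy
      have h1 := congrFun (t.coe_linearMapAt_of_mem (R := 𝕜) hy) (χ y • t.symmₗ 𝕜 y (b i))
      rw [map_smul, t.linearMapAt_symmₗ hy] at h1
      exact h1.symm
    · refine (Bundle.contMDiff_zeroSection ℝ A x).congr_of_eventuallyEq ?_
      filter_upwards [hχ0 x hx] with y hy
      simp [hy, Bundle.zeroSection]
  have hθ : ∀ i, (fun x => χ x • (b.coord i ∘ₗ t.linearMapAt 𝕜 x)) ∈
      dualSections (sections 𝕜 m F A) := by
    intro i X hX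
    rw [mem_smoothFun_iff]
    intro x
    by_cases hx : x ∈ t.baseSet
    · have h1 := (t.contMDiffAt_section_iff (IB := 𝓡 m) (n := ∞) hx).1 (hX x)
      have h2 : ContMDiffAt (𝓡 m) 𝓘(ℝ, 𝕜) ∞ (fun x => b.coord i (t ⟨x, X x⟩).2) x :=
        (((b.coord i).toContinuousLinearMap.restrictScalars ℝ).contDiff.contMDiff).contMDiffAt.comp
          x h1
      have h : ContMDiffAt (𝓡 m) 𝓘(ℝ, 𝕜) ∞ (fun x => χ x * b.coord i (t ⟨x, X x⟩).2) x :=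
        ((contDiff_mul (𝕜 := ℝ) (𝔸 := 𝕜)).contMDiff.contMDiffAt).comp x
          ((hχ x).prodMk_space h2)
      refine h.congr_of_eventuallyEq ?_
      filter_upwards [t.open_baseSet.mem_nhds hx] with y hy
      simp [t.coe_linearMapAt_of_mem hy]
    · refine (contMDiffAt_const (c := (0 : 𝕜))).congr_of_eventuallyEq ?_
      filter_upwards [hχ0 x hx] with y hy
      simp [hy]
  refine ⟨fun i => ⟨_, he i⟩, fun i => ⟨_, hθ i⟩, ?_⟩
  filter_upwards [hU, hχ1] with x hx h1
  constructor
  · intro v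
    have h2 := b.sum_repr (t.linearMapAt 𝕜 x v)
    have h3 := congrArg (t.symmₗ 𝕜 x) h2
    rw [t.symmₗ_linearMapAt hx, map_sum] at h3
    simpa [h1] using h3
  · intro i j
    simp [h1, t.linearMapAt_symmₗ hx, Finsupp.single_apply, eq_comm]

end Bundle

end LieBialg

namespace LieBialg

open Filter Topology

/-! ### Forms as alternating cochains on sections, and the existence and locality of `d`. -/

section Forms

variable {𝕜 : Type*} [RCLike 𝕜] {m : ℕ} {M : Type*} [TopologicalSpace M]
  [ChartedSpace (EuclideanSpace ℝ (Fin m)) M]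
  {V : M → Type*} [∀ x, AddCommGroup (V x)] [∀ x, Module 𝕜 (V x)]
  {Γ : Submodule (smoothFun 𝕜 m M) (∀ x, V x)} {n : ℕ}

/-- The pairing of a bundle with its dual. -/
abbrev evPair (𝕜 : Type*) [RCLike 𝕜] {M : Type*} (V : M → Type*) [∀ x, AddCommGroup (V x)]
    [∀ x, Module 𝕜 (V x)] (x : M) : V x →ₗ[𝕜] Module.Dual 𝕜 (Module.Dual 𝕜 (V x)) :=
  Module.Dual.eval 𝕜 (V x)

/-- The form `α` has the functions `Φ(X₁, …, X_k)` as its values on sections. -/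
def Rep (α : ∀ x, ExteriorAlgebra 𝕜 (Module.Dual 𝕜 (V x))) (Φ : List Γ → smoothFun 𝕜 m M) :
    Prop := ∀ Xs, evalOn (evPair 𝕜 V) α Xs = (Φ Xs).1

lemma IsForm.exists_rep {α : ∀ x, ExteriorAlgebra 𝕜 (Module.Dual 𝕜 (V x))} (h : IsForm Γ α) :
    ∃ Φ : List Γ → smoothFun 𝕜 m M, Rep α Φ := ⟨fun Xs => ⟨_, h Xs⟩, fun _ => rfl⟩

lemma Rep.isForm {α : ∀ x, ExteriorAlgebra 𝕜 (Module.Dual 𝕜 (V x))}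
    {Φ : List Γ → smoothFun 𝕜 m M} (h : Rep α Φ) : IsForm Γ α := fun Xs => by
  have h1 : evalOn (evPair 𝕜 V) α Xs ∈ smoothFun 𝕜 m M := by
    rw [h Xs]
    exact (Φ Xs).2
  exact h1

lemma Rep.apply {α : ∀ x, ExteriorAlgebra 𝕜 (Module.Dual 𝕜 (V x))}
    {Φ : List Γ → smoothFun 𝕜 m M} (h : Rep α Φ) (Xs : List Γ) (x : M) :
    evalList ((Xs.map fun X => X.1 x).map (Module.Dual.eval 𝕜 (V x))) (α x) = (Φ Xs).1 x := by
  rw [← h Xs, List.map_map]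
  rfl

lemma rep_iff {α : ∀ x, ExteriorAlgebra 𝕜 (Module.Dual 𝕜 (V x))}
    {Φ : List Γ → smoothFun 𝕜 m M} : Rep α Φ ↔ ∀ (Xs : List Γ) (x : M),
    evalList ((Xs.map fun X => X.1 x).map (Module.Dual.eval 𝕜 (V x))) (α x) = (Φ Xs).1 x := by
  refine ⟨Rep.apply, fun h Xs => funext fun x => ?_⟩
  rw [← h Xs, List.map_map]
  rfl

lemma isAlt_of_pointwise {Φ : List Γ → smoothFun 𝕜 m M}
    (h : ∀ x, ∃ φ : List (V x) → 𝕜, IsAlt φ ∧ ∀ Xs, (Φ Xs).1 x = φ (Xs.map fun X => X.1 x)) :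
    IsAlt Φ := by
  choose φ hφ h using h
  have key : ∀ p l x, (insList p Φ l).1 x =
      insList (p.map fun X => X.1 x) (φ x) (l.map fun X => X.1 x) := fun p l x => by
    simp only [insList, h, List.map_append]
  refine fun p => ⟨fun X Y => ?_, fun f X => ?_, fun X => ?_⟩
  · funext l
    refine Subtype.ext (funext fun x => ?_)
    have h1 := congrFun (((hφ x) (p.map fun X => X.1 x)).add (X.1 x) (Y.1 x))
      (l.map fun X => X.1 x)
    refine (key p (_ :: l) x).trans (h1.trans ?_)
    exact (congrArg₂ (· + ·) (key p (X :: l) x) (key p (Y :: l) x)).symm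
  · funext l
    refine Subtype.ext (funext fun x => ?_)
    have h1 := congrFun (((hφ x) (p.map fun X => X.1 x)).smul (f.1 x) (X.1 x))
      (l.map fun X => X.1 x)
    refine (key p (_ :: l) x).trans (h1.trans ?_)
    exact (congrArg (f.1 x * ·) (key p (X :: l) x)).symm
  · funext l
    refine Subtype.ext (funext fun x => ?_)
    have h1 := congrFun (((hφ x) (p.map fun X => X.1 x)).alt (X.1 x))
      (l.map fun X => X.1 x)
    exact (key p (X :: X :: l) x).trans h1

lemma Rep.isAlt {α : ∀ x, ExteriorAlgebra 𝕜 (Module.Dual 𝕜 (V x))}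
    {Φ : List Γ → smoothFun 𝕜 m M} (h : Rep α Φ) : IsAlt Φ :=
  isAlt_of_pointwise fun x => ⟨_, isAlt_evalList (Module.Dual.eval 𝕜 (V x)) (α x),
    fun Xs => (h.apply Xs x).symm⟩

section Frames

variable (hΓ : HasFrames Γ n)
include hΓ

/-- Vectors extend to sections linearly over the constants, by keeping their frame coefficients at
`x` fixed. -/
lemma HasFrames.exists_extension (x : M) : ∃ σ : V x → Γ, (∀ v, (σ v).1 x = v) ∧
    (∀ v w, σ (v + w) = σ v + σ w) ∧
    ∀ (c : 𝕜) v, σ (c • v) = algebraMap 𝕜 (smoothFun 𝕜 m M) c • σ v := by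
  obtain ⟨e, θ, h⟩ := hΓ x
  have hx := h.self_of_nhds
  refine ⟨fun v => ∑ i, algebraMap 𝕜 (smoothFun 𝕜 m M) ((θ i).1 x v) • e i, fun v => ?_,
    fun v w => ?_, fun c v => ?_⟩
  · have h1 := hx.sum v
    conv_rhs => rw [← h1]
    simp only [AddSubmonoidClass.coe_finsetSum, Finset.sum_apply]
    rfl
  · simp only [map_add, add_smul, Finset.sum_add_distrib]
  · simp only [map_smul, Finset.smul_sum, smul_smul, smul_eq_mul, map_mul]

lemma HasFrames.eq_of_evalOn {x : M} {α β : ∀ x, ExteriorAlgebra 𝕜 (Module.Dual 𝕜 (V x))}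
    (h : ∀ Xs : List Γ, evalOn (evPair 𝕜 V) α Xs x = evalOn (evPair 𝕜 V) β Xs x) :
    α x = β x := by
  obtain ⟨e, θ, hx⟩ := hΓ x
  rw [← sub_eq_zero]
  refine hx.self_of_nhds.dual.eq_zero_of_evalList fun l => ?_
  have h1 := h (l.map e)
  simp only [evalOn, List.map_map] at h1
  rw [sub_eq_add_neg, ← neg_one_smul 𝕜, evalList_add, evalList_smul]
  rw [neg_one_mul, ← sub_eq_add_neg, sub_eq_zero]
  exact h1

lemma Rep.unique {α β : ∀ x, ExteriorAlgebra 𝕜 (Module.Dual 𝕜 (V x))}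
    {Φ : List Γ → smoothFun 𝕜 m M} (h : Rep α Φ) (h' : Rep β Φ) : α = β :=
  funext fun _ => hΓ.eq_of_evalOn fun Xs => by rw [h Xs, h' Xs]

variable [T2Space M] [IsManifold (𝓡 m) ∞ M]

/-- Tensoriality: `χ X = ∑ χ θ_i(X) e_i` holds on all of `M`, and at `x` the left factor is `1`
while every coefficient on the right vanishes. -/
lemma IsAlt.apply_eq_zero {Φ : List Γ → smoothFun 𝕜 m M} (h : IsAlt Φ) {X : Γ} {x : M}
    (hX : X.1 x = 0) (l : List Γ) : (Φ (X :: l)).1 x = 0 := by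
  obtain ⟨e, θ, hx⟩ := hΓ x
  obtain ⟨χ, hχ, h1, h0⟩ := exists_bump_tsupport (m := m) 𝕜 x hx
  let g : Fin n → smoothFun 𝕜 m M := fun i => ⟨χ, hχ⟩ * ⟨_, (θ i).2 X.1 X.2⟩
  have hs : (⟨χ, hχ⟩ : smoothFun 𝕜 m M) • X = ∑ i, g i • e i := by
    refine Subtype.ext (funext fun y => ?_)
    simp only [AddSubmonoidClass.coe_finsetSum, Finset.sum_apply]
    change χ y • X.1 y = ∑ i, (χ y * (θ i).1 y (X.1 y)) • (e i).1 y
    by_cases hy : IsDualFrame (fun i => (e i).1 y) (fun i => (θ i).1 y)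
    · simp only [mul_smul, ← Finset.smul_sum]
      rw [hy.sum]
    · rw [(h0 y hy).self_of_nhds]
      simp
  let f : Γ →ₗ[smoothFun 𝕜 m M] (List Γ → smoothFun 𝕜 m M) :=
    { toFun := fun X => LieBialg.ins X Φ
      map_add' := h.head.add
      map_smul' := h.head.smul }
  have h2 : f ((⟨χ, hχ⟩ : smoothFun 𝕜 m M) • X) = f (∑ i, g i • e i) := by rw [hs]
  rw [map_smul, map_sum] at h2
  have h3 := congrArg (fun F => (F l).1 x) h2
  simp only [map_smul, Finset.sum_apply, Pi.smul_apply, AddSubmonoidClass.coe_finsetSum] at h3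
  have h4 : χ x * (Φ (X :: l)).1 x = ∑ i, (χ x * (θ i).1 x (X.1 x)) * (Φ (e i :: l)).1 x := h3
  rw [h1.self_of_nhds, hX] at h4
  simpa using h4

lemma IsAlt.exists_pointwise {Φ : List Γ → smoothFun 𝕜 m M} (h : IsAlt Φ) (x : M) :
    ∃ φ : List (V x) → 𝕜, IsAlt φ ∧ ∀ Xs, (Φ Xs).1 x = φ (Xs.map fun X => X.1 x) := by
  obtain ⟨σ, hσ, hadd, hsmul⟩ := hΓ.exists_extension x
  refine ⟨fun vs => (Φ (vs.map σ)).1 x, ?_, fun Xs => ?_⟩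
  · have key : ∀ p l, insList p (fun vs => (Φ (vs.map σ)).1 x) l =
        (insList (p.map σ) Φ (l.map σ)).1 x := fun p l => by
      simp only [insList, List.map_append]
    refine fun p => ⟨fun v w => ?_, fun c v => ?_, fun v => ?_⟩
    · funext l
      have h1 := congrFun ((h (p.map σ)).add (σ v) (σ w)) (l.map σ)
      rw [← hadd] at h1
      exact (key p _).trans (congrArg (fun F => F.1 x) h1 |>.trans
        (congrArg₂ (· + ·) (key p (v :: l)) (key p (w :: l))).symm)
    · funext l
      have h1 := congrFun ((h (p.map σ)).smul (algebraMap 𝕜 _ c) (σ v)) (l.map σ)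
      rw [← hsmul] at h1
      exact (key p _).trans (congrArg (fun F => F.1 x) h1 |>.trans
        (congrArg (c * ·) (key p (v :: l))).symm)
    · funext l
      have h1 := congrFun ((h (p.map σ)).alt (σ v)) (l.map σ)
      exact (key p (v :: v :: l)).trans (congrArg (fun F => F.1 x) h1)
  -- The arguments are replaced one by one by the extensions of their values at `x`; the difference
  -- of two sections with the same value contributes nothing at `x`.
  · induction Xs generalizing Φ with
    | nil => rfl
    | cons X l ih =>
      have h1 := IsAlt.apply_eq_zero hΓ h (X := X - σ (X.1 x)) (x := x)
        (by change X.1 x - (σ (X.1 x)).1 x = 0; rw [hσ, sub_self]) l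
      have h2 := congrFun (h.head.sub_arg X (σ (X.1 x))) l
      have h3 : (Φ ((X - σ (X.1 x)) :: l)).1 x = (Φ (X :: l)).1 x - (Φ (σ (X.1 x) :: l)).1 x :=
        congrArg (fun F => F.1 x) h2
      rw [h1] at h3
      rw [sub_eq_zero.1 h3.symm]
      exact ih (h.ins _)

/-- At each point the cochain depends only on the values of its arguments, and finite-dimensional
linear algebra supplies the form there; smoothness is automatic because the values are the given
smooth functions. -/
lemma IsAlt.exists_rep {Φ : List Γ → smoothFun 𝕜 m M} (h : IsAlt Φ) :
    ∃ α : ∀ x, ExteriorAlgebra 𝕜 (Module.Dual 𝕜 (V x)), Rep α Φ := by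
  have key : ∀ x, ∃ α : ExteriorAlgebra 𝕜 (Module.Dual 𝕜 (V x)), ∀ Xs : List Γ,
      evalList ((Xs.map fun X => X.1 x).map (Module.Dual.eval 𝕜 (V x))) α = (Φ Xs).1 x := by
    intro x
    obtain ⟨φ, hφ, hφ'⟩ := IsAlt.exists_pointwise hΓ h x
    obtain ⟨e, θ, hx⟩ := hΓ x
    obtain ⟨α, hα⟩ := exists_evalList_of_isAlt hx.self_of_nhds hφ
    exact ⟨α, fun Xs => by rw [hα, hφ']⟩
  choose α hα using key
  exact ⟨α, rep_iff.2 fun Xs x => hα x Xs⟩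

end Frames

lemma cartan_eq (L : LieAlgebroid Γ) {α : ∀ x, ExteriorAlgebra 𝕜 (Module.Dual 𝕜 (V x))}
    {Φ : List Γ → smoothFun 𝕜 m M} (h : Rep α Φ) (Xs : List Γ) :
    cartan L (evPair 𝕜 V) α Xs = (L.toLieRinehart.dC Φ Xs).1 := by
  rw [L.toLieRinehart.dC_eq_sum h.isAlt]
  have h1 : ∀ (j : ℕ) (f : smoothFun 𝕜 m M), ((-1) ^ j * f).1 = (-1 : 𝕜) ^ j • f.1 := by
    intro j f
    funext x
    change ((-1 : smoothFun 𝕜 m M) ^ j).1 x * f.1 x = _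
    simp
  simp only [cartan]
  rw [AddMemClass.coe_add, AddSubmonoidClass.coe_finsetSum, AddSubmonoidClass.coe_finsetSum]
  congr 1
  · refine Finset.sum_congr rfl fun i _ => ?_
    rw [h1, h]
    rfl
  · refine Finset.sum_congr rfl fun i _ => ?_
    rw [AddSubmonoidClass.coe_finsetSum]
    refine Finset.sum_congr rfl fun j _ => ?_
    rw [h1, h]
    rfl

section Differential

variable [T2Space M] [IsManifold (𝓡 m) ∞ M] (hΓ : HasFrames Γ n) (L : LieAlgebroid Γ)
include hΓ

lemma exists_isDifferential : ∃ D, IsDifferential L (evPair 𝕜 V) D := by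
  have key : ∀ α : ∀ x, ExteriorAlgebra 𝕜 (Module.Dual 𝕜 (V x)), ∃ β, IsForm Γ α →
      ∀ Xs : List Γ, evalOn (evPair 𝕜 V) β Xs = cartan L (evPair 𝕜 V) α Xs := by
    intro α
    by_cases hα : IsForm Γ α
    · obtain ⟨Φ, hΦ⟩ := hα.exists_rep
      obtain ⟨β, hβ⟩ := IsAlt.exists_rep hΓ (hΦ.isAlt.dC L.toLieRinehart)
      exact ⟨β, fun _ Xs => by rw [hβ Xs, cartan_eq L hΦ]⟩
    · exact ⟨0, fun h => absurd h hα⟩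
  choose D hD using key
  exact ⟨D, hD⟩

lemma isDifferential_dA : IsDifferential L (evPair 𝕜 V) (dA L) := by
  have h := exists_isDifferential hΓ L
  have h1 : dA L = h.choose := by
    rw [dA, differential, dif_pos h]
  rw [h1]
  exact h.choose_spec

lemma Rep.dA {α : ∀ x, ExteriorAlgebra 𝕜 (Module.Dual 𝕜 (V x))}
    {Φ : List Γ → smoothFun 𝕜 m M} (h : Rep α Φ) : Rep (dA L α) (L.toLieRinehart.dC Φ) :=
  fun Xs => by rw [isDifferential_dA hΓ L α h.isForm Xs, cartan_eq L h]

/-- Every term of the Cartan formula at `x` depends only on germs at `x` of values of the form. -/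
lemma dA_congr {α β : ∀ x, ExteriorAlgebra 𝕜 (Module.Dual 𝕜 (V x))} (hα : IsForm Γ α)
    (hβ : IsForm Γ β) {x : M} (h : ∀ᶠ y in 𝓝 x, α y = β y) : dA L α x = dA L β x := by
  have h1 : ∀ Xs : List Γ, evalOn (evPair 𝕜 V) α Xs =ᶠ[𝓝 x] evalOn (evPair 𝕜 V) β Xs := by
    intro Xs
    filter_upwards [h] with y hy
    simp only [evalOn, hy]
  refine hΓ.eq_of_evalOn fun Xs => ?_
  rw [isDifferential_dA hΓ L α hα Xs, isDifferential_dA hΓ L β hβ Xs]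
  simp only [cartan, Pi.add_apply, Finset.sum_apply, Pi.smul_apply]
  congr 1
  · exact Finset.sum_congr rfl fun i _ => by rw [L.act_congr _ (h1 _)]
  · exact Finset.sum_congr rfl fun i _ => Finset.sum_congr rfl fun j _ => by
      rw [(h1 _).self_of_nhds]

end Differential

end Forms

end LieBialg

namespace LieBialg

open Filter Topology

/-! ### Closure properties of smoothness tested by evaluation. -/

section SmoothVia

variable {𝕜 : Type*} [RCLike 𝕜] {m : ℕ} {M : Type*} [TopologicalSpace M]
  [ChartedSpace (EuclideanSpace ℝ (Fin m)) M]
  {V W : M → Type*} [∀ x, AddCommGroup (V x)] [∀ x, Module 𝕜 (V x)]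
  [∀ x, AddCommGroup (W x)] [∀ x, Module 𝕜 (W x)]
  {Γ : Submodule (smoothFun 𝕜 m M) (∀ x, V x)}
  {pair : ∀ x, V x →ₗ[𝕜] Module.Dual 𝕜 (W x)} {α β : ∀ x, ExteriorAlgebra 𝕜 (W x)}

lemma evalOn_cons (X : Γ) (l : List Γ) (α : ∀ x, ExteriorAlgebra 𝕜 (W x)) :
    evalOn pair α (X :: l) = evalOn pair (fun x => cl (pair x (X.1 x)) (α x)) l := rfl

lemma evalOn_congr {x : M} (h : α x = β x) (l : List Γ) : evalOn pair α l x = evalOn pair β l x := by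
  simp only [evalOn, h]

lemma IsSmoothVia.add (hα : IsSmoothVia Γ pair α) (hβ : IsSmoothVia Γ pair β) :
    IsSmoothVia Γ pair (α + β) := fun l => by
  have : evalOn pair (α + β) l = evalOn pair α l + evalOn pair β l :=
    funext fun x => evalList_add _ _ _
  rw [this]
  exact add_mem (hα l) (hβ l)

lemma IsSmoothVia.fsmul {f : M → 𝕜} (hf : f ∈ smoothFun 𝕜 m M) (hα : IsSmoothVia Γ pair α) :
    IsSmoothVia Γ pair (fun x => f x • α x) := fun l => by
  have : evalOn pair (fun x => f x • α x) l = f * evalOn pair α l :=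
    funext fun x => evalList_smul _ _ _
  rw [this]
  exact mul_mem hf (hα l)

lemma IsSmoothVia.smul (c : 𝕜) (hα : IsSmoothVia Γ pair α) : IsSmoothVia Γ pair (c • α) :=
  hα.fsmul ((smoothFun 𝕜 m M).algebraMap_mem c)

lemma isSmoothVia_zero : IsSmoothVia Γ pair (0 : ∀ x, ExteriorAlgebra 𝕜 (W x)) := fun l => by
  have : evalOn pair (0 : ∀ x, ExteriorAlgebra 𝕜 (W x)) l = 0 :=
    funext fun x => evalList_zero _
  rw [this]
  exact zero_mem _

lemma isSmoothVia_ofFun {f : M → 𝕜} (hf : f ∈ smoothFun 𝕜 m M) :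
    IsSmoothVia Γ pair (ofFun f) := fun l => by
  cases l with
  | nil =>
    have : evalOn pair (ofFun f) ([] : List Γ) = f := funext fun x => algebraMapInv_algebraMap _
    rw [this]
    exact hf
  | cons X l =>
    have : evalOn pair (ofFun f) (X :: l) = 0 := funext fun x => by
      rw [evalOn_cons]
      simp only [ofFun, cl_algebraMap]
      exact evalList_zero _
    rw [this]
    exact zero_mem _

lemma IsSmoothVia.cl (hα : IsSmoothVia Γ pair α) (X : Γ) :
    IsSmoothVia Γ pair (fun x => cl (pair x (X.1 x)) (α x)) := fun l => hα (X :: l)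

lemma IsSmoothVia.inv (hα : IsSmoothVia Γ pair α) :
    IsSmoothVia Γ pair (fun x => inv (α x)) := fun l => by
  have : evalOn pair (fun x => LieBialg.inv (α x)) l = (-1 : 𝕜) ^ l.length • evalOn pair α l :=
    funext fun x => by
      simp only [evalOn, evalList_inv, List.length_map, Pi.smul_apply, smul_eq_mul]
  rw [this]
  exact Subalgebra.smul_mem _ (hα l) _

lemma IsSmoothVia.comp (hα : IsSmoothVia Γ pair α) (k : ℕ) :
    IsSmoothVia Γ pair (fun x => comp k (α x)) := fun l => by
  by_cases hl : l.length = k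
  · have : evalOn pair (fun x => LieBialg.comp k (α x)) l = evalOn pair α l := funext fun x => by
      have := evalList_comp (l.map fun X => pair x (X.1 x)) (α x)
      rw [List.length_map, hl] at this
      exact this
    rw [this]
    exact hα l
  · have : evalOn pair (fun x => LieBialg.comp k (α x)) l = 0 := funext fun x =>
      evalList_comp_ne _ _ (by simpa using hl)
    rw [this]
    exact zero_mem _

lemma IsSmoothVia.ι_mul (hα : IsSmoothVia Γ pair α) {w : ∀ x, W x}
    (hw : ∀ X : Γ, (fun x => pair x (X.1 x) (w x)) ∈ smoothFun 𝕜 m M) :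
    IsSmoothVia Γ pair (fun x => ExteriorAlgebra.ι 𝕜 (w x) * α x) := fun l => by
  induction l generalizing α with
  | nil =>
    have : evalOn pair (fun x => ExteriorAlgebra.ι 𝕜 (w x) * α x) ([] : List Γ) = 0 :=
      funext fun x => algebraMapInv_ι_mul _ _
    rw [this]
    exact zero_mem _
  | cons X l ih =>
    have : evalOn pair (fun x => ExteriorAlgebra.ι 𝕜 (w x) * α x) (X :: l) =
        (fun x => pair x (X.1 x) (w x)) * evalOn pair α l - evalOn pair
          (fun x => ExteriorAlgebra.ι 𝕜 (w x) * LieBialg.cl (pair x (X.1 x)) (α x)) l := by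
      funext x
      rw [evalOn_cons]
      simp only [cl_ι_mul, evalOn, Pi.sub_apply, Pi.mul_apply]
      rw [sub_eq_add_neg, ← neg_one_smul 𝕜, evalList_add, evalList_smul, evalList_smul]
      ring
    rw [this]
    exact sub_mem (mul_mem (hw X) (hα l)) (ih (hα.cl X))

lemma isSmoothVia_of_local
    (h : ∀ x, ∃ β, IsSmoothVia Γ pair β ∧ ∀ᶠ y in 𝓝 x, α y = β y) : IsSmoothVia Γ pair α :=
  fun l => smoothFun_of_local fun x => by
    obtain ⟨β, hβ, hx⟩ := h x
    exact ⟨_, hβ l, hx.mono fun y hy => evalOn_congr hy l⟩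

end SmoothVia

/-! ### Multivectors as local sums of products of functions and sections. -/

section Multivectors

variable {𝕜 : Type*} [RCLike 𝕜] {m : ℕ} {M : Type*} [TopologicalSpace M]
  [ChartedSpace (EuclideanSpace ℝ (Fin m)) M]
  {V : M → Type*} [∀ x, AddCommGroup (V x)] [∀ x, Module 𝕜 (V x)]
  {Γ : Submodule (smoothFun 𝕜 m M) (∀ x, V x)} {n : ℕ}

lemma IsMultivector.ofSec_mul {u : ∀ x, ExteriorAlgebra 𝕜 (V x)} (hu : IsMultivector Γ u) (X : Γ) :
    IsMultivector Γ (ofSec X.1 * u) :=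
  IsSmoothVia.ι_mul hu (w := X.1) fun θ => θ.2 X.1 X.2

/-- Finite sums of products of functions and sections. -/
inductive Gen (Γ : Submodule (smoothFun 𝕜 m M) (∀ x, V x)) :
    ℕ → (∀ x, ExteriorAlgebra 𝕜 (V x)) → Prop
  | func (f : M → 𝕜) (hf : f ∈ smoothFun 𝕜 m M) : Gen Γ 0 (ofFun f)
  | mul (k : ℕ) (X : Γ) (u : ∀ x, ExteriorAlgebra 𝕜 (V x)) (hu : Gen Γ k u) :
      Gen Γ (k + 1) (ofSec X.1 * u)
  | add (k : ℕ) (u v : ∀ x, ExteriorAlgebra 𝕜 (V x)) (hu : Gen Γ k u) (hv : Gen Γ k v) :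
      Gen Γ k (u + v)

lemma Gen.isMultivector {k : ℕ} {u : ∀ x, ExteriorAlgebra 𝕜 (V x)} (h : Gen Γ k u) :
    IsMultivector Γ u := by
  induction h with
  | func f hf => exact isSmoothVia_ofFun hf
  | mul k X u _ ih => exact ih.ofSec_mul X
  | add k u v _ _ ih ih' => exact ih.add ih'

lemma hasDeg_ofFun (f : M → 𝕜) : HasDeg 0 (ofFun f : ∀ x, ExteriorAlgebra 𝕜 (V x)) :=
  fun x => algebraMap_mem_deg (f x)

lemma hasDeg_ofSec (X : ∀ x, V x) : HasDeg (𝕜 := 𝕜) 1 (ofSec X) := fun x => ι_mem (X x)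

lemma HasDeg.mul {k l : ℕ} {u v : ∀ x, ExteriorAlgebra 𝕜 (V x)} (hu : HasDeg k u)
    (hv : HasDeg l v) : HasDeg (k + l) (u * v) := fun x => mul_mem_deg (hu x) (hv x)

lemma HasDeg.add {k : ℕ} {u v : ∀ x, ExteriorAlgebra 𝕜 (V x)} (hu : HasDeg k u)
    (hv : HasDeg k v) : HasDeg k (u + v) := fun x => Submodule.add_mem _ (hu x) (hv x)

lemma Gen.hasDeg {k : ℕ} {u : ∀ x, ExteriorAlgebra 𝕜 (V x)} (h : Gen Γ k u) : HasDeg k u := by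
  induction h with
  | func f hf => exact hasDeg_ofFun f
  | mul k X u _ ih => exact fun x => ι_mul_mem _ (ih x)
  | add k u v _ _ ih ih' => exact ih.add ih'

lemma Gen.zero (k : ℕ) : Gen Γ k 0 := by
  induction k with
  | zero =>
    have : (0 : ∀ x, ExteriorAlgebra 𝕜 (V x)) = ofFun 0 := by funext x; simp [ofFun]
    rw [this]
    exact .func 0 (zero_mem _)
  | succ k ih => simpa using Gen.mul k 0 0 ih

/-- As in `exists_evalList_of_isAlt`, but on germs: induction on the set of frame covectors whose
contraction with `u` need not vanish near `x₀`, splitting off `e_j ∧ i_{θ_j}u` for each new index.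
The frames are global sections, so the approximants are global as well. -/
lemma exists_gen (hΓ : HasFrames Γ n) {k : ℕ} {u : ∀ x, ExteriorAlgebra 𝕜 (V x)}
    (hu : IsMultivector Γ u) (hk : HasDeg k u) (x₀ : M) :
    ∃ v, Gen Γ k v ∧ ∀ᶠ x in 𝓝 x₀, u x = v x := by
  obtain ⟨e, θ, hx⟩ := hΓ x₀
  have key : ∀ S : Finset (Fin n), ∀ (k : ℕ) (u : ∀ x, ExteriorAlgebra 𝕜 (V x)),
      IsMultivector Γ u → HasDeg k u → (∀ j ∉ S, ∀ᶠ x in 𝓝 x₀, cl ((θ j).1 x) (u x) = 0) →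
      ∃ v, Gen Γ k v ∧ ∀ᶠ x in 𝓝 x₀, u x = v x := by
    intro S
    induction S using Finset.induction_on with
    | empty =>
      intro k u hu hk h0
      cases k with
      | zero =>
        refine ⟨_, .func _ (hu []), Eventually.of_forall fun x => ?_⟩
        obtain ⟨c, hc⟩ := mem_zero_iff.1 (hk x)
        change u x = algebraMap 𝕜 _ (ExteriorAlgebra.algebraMapInv (u x))
        rw [← hc, algebraMapInv_algebraMap]
      | succ k =>
        refine ⟨0, Gen.zero _, ?_⟩
        filter_upwards [hx, (eventually_all (ι := Fin n)).2 fun j => h0 j (by simp)] with x hx hx'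
        exact hx.eq_zero_of_cl (hk x) hx'
    | insert j S hj ih =>
      intro k u hu hk h0
      cases k with
      | zero =>
        refine ih 0 u hu hk fun i _ => Eventually.of_forall fun x => cl_zero_deg _ (hk x)
      | succ k =>
        set u₁ : ∀ x, ExteriorAlgebra 𝕜 (V x) := fun x => cl ((θ j).1 x) (u x) with hu₁
        have hm₁ : IsMultivector Γ u₁ := IsSmoothVia.cl hu (θ j)
        have hd₁ : HasDeg k u₁ := fun x => cl_mem _ (hk x)
        obtain ⟨v₁, hv₁, hv₁'⟩ := ih k u₁ hm₁ hd₁ (by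
          intro i hi
          by_cases hij : i = j
          · subst hij
            exact Eventually.of_forall fun x => CliffordAlgebra.contractLeft_contractLeft _ _
          · filter_upwards [h0 i (by simp [hij, hi])] with x hx
            rw [hu₁]
            simp only [cl]
            rw [CliffordAlgebra.contractLeft_comm, hx, map_zero, neg_zero])
        obtain ⟨v₂, hv₂, hv₂'⟩ := ih (k + 1) (u + (-1 : 𝕜) • (ofSec (e j).1 * u₁))
          (hu.add ((hm₁.ofSec_mul (e j)).smul (-1)))
          (HasDeg.add hk fun x => Submodule.smul_mem _ _ (ι_mul_mem _ (hd₁ x))) (by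
            intro i hi
            have hc : ∀ x, cl ((θ i).1 x) ((u + (-1 : 𝕜) • (ofSec (e j).1 * u₁) :
                  ∀ x, ExteriorAlgebra 𝕜 (V x)) x) = cl ((θ i).1 x) (u x) - ((θ i).1 x ((e j).1 x) • u₁ x -
                  ExteriorAlgebra.ι 𝕜 ((e j).1 x) * cl ((θ i).1 x) (u₁ x)) := by
              intro x
              change cl _ (u x + (-1 : 𝕜) • (ExteriorAlgebra.ι 𝕜 ((e j).1 x) * u₁ x)) = _
              rw [map_add, map_smul, cl_ι_mul, neg_one_smul, ← sub_eq_add_neg]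
            by_cases hij : i = j
            · subst hij
              filter_upwards [hx] with x hx
              have h2 : cl ((θ i).1 x) (u₁ x) = 0 :=
                CliffordAlgebra.contractLeft_contractLeft _ _
              have h3 : (θ i).1 x ((e i).1 x) = 1 := by simpa using hx.pair i i
              rw [hc, h2, h3, mul_zero, sub_zero, one_smul]
              exact sub_self _
            · filter_upwards [hx, h0 i (by simp [hij, hi])] with x hx hx'
              have h2 : cl ((θ i).1 x) (u₁ x) = 0 := by
                rw [hu₁]
                simp only [cl]
                rw [CliffordAlgebra.contractLeft_comm, hx', map_zero, neg_zero]
              have h3 : (θ i).1 x ((e j).1 x) = 0 := by simpa [hij] using hx.pair i j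
              rw [hc, h2, h3, mul_zero, sub_zero, zero_smul, hx', sub_zero])
        refine ⟨v₂ + ofSec (e j).1 * v₁, hv₂.add _ _ _ (hv₁.mul _ _ _), ?_⟩
        filter_upwards [hv₁', hv₂'] with x h1 h2
        change u x = v₂ x + ExteriorAlgebra.ι 𝕜 ((e j).1 x) * v₁ x
        rw [← h1, ← h2]
        change u x = u x + (-1 : 𝕜) • (ExteriorAlgebra.ι 𝕜 ((e j).1 x) * u₁ x) + _
        rw [neg_one_smul, neg_add_cancel_right]
  exact key Finset.univ k u hu hk (by simp)

/-- The component of degree `k` of a section. -/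
def compSec (k : ℕ) (u : ∀ x, ExteriorAlgebra 𝕜 (V x)) : ∀ x, ExteriorAlgebra 𝕜 (V x) :=
  fun x => comp k (u x)

lemma hasDeg_compSec (k : ℕ) (u : ∀ x, ExteriorAlgebra 𝕜 (V x)) : HasDeg k (compSec k u) :=
  fun x => comp_mem k (u x)

lemma IsMultivector.compSec {u : ∀ x, ExteriorAlgebra 𝕜 (V x)} (hu : IsMultivector Γ u) (k : ℕ) :
    IsMultivector Γ (compSec k u) := IsSmoothVia.comp hu k

lemma sum_compSec (hΓ : HasFrames Γ n) (u : ∀ x, ExteriorAlgebra 𝕜 (V x)) :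
    ∑ k ∈ Finset.range (n + 1), compSec k u = u := by
  funext x
  obtain ⟨e, θ, hx⟩ := hΓ x
  rw [Finset.sum_apply]
  refine eq_of_comp fun j => ?_
  rw [map_sum]
  change ∑ k ∈ _, comp j (comp k (u x)) = _
  by_cases hj : j ∈ Finset.range (n + 1)
  · rw [Finset.sum_eq_single_of_mem j hj fun k _ hk => comp_of_deg_ne (comp_mem k _) hk]
    exact comp_of_deg (comp_mem j _)
  · rw [Finset.sum_eq_zero fun k hk =>
      comp_of_deg_ne (comp_mem k (u x)) (fun h : k = j => hj (h ▸ hk))]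
    refine (hx.self_of_nhds.eq_zero_of_lt (comp_mem j (u x)) ?_).symm
    simp at hj ⊢
    omega

/-- A property of multivectors that is additive, local, and holds for generators holds for all. -/
lemma mv_induction (hΓ : HasFrames Γ n) {P : (∀ x, ExteriorAlgebra 𝕜 (V x)) → Prop}
    (hadd : ∀ u v, IsMultivector Γ u → IsMultivector Γ v → P u → P v → P (u + v))
    (hloc : ∀ u, IsMultivector Γ u → (∀ x, ∃ k v, Gen Γ k v ∧ P v ∧ ∀ᶠ y in 𝓝 x, u y = v y) → P u)
    (hgen : ∀ k u, Gen Γ k u → P u) {u : ∀ x, ExteriorAlgebra 𝕜 (V x)} (hu : IsMultivector Γ u) :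
    P u := by
  have hc : ∀ k, P (compSec k u) := fun k => hloc _ (hu.compSec k) fun x => by
    obtain ⟨v, hv, hx⟩ := exists_gen hΓ (hu.compSec k) (hasDeg_compSec k u) x
    exact ⟨k, v, hv, hgen k v hv, hx⟩
  rw [← sum_compSec hΓ u]
  refine (Finset.sum_induction (fun k => compSec k u) (fun u => IsMultivector Γ u ∧ P u)
    (fun u v hu hv => ⟨hu.1.add hv.1, hadd u v hu.1 hv.1 hu.2 hv.2⟩)
    ⟨isSmoothVia_zero, hgen 0 0 (Gen.zero 0)⟩ fun k _ => ⟨hu.compSec k, hc k⟩).2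

lemma ofFun_mul (f : M → 𝕜) (u : ∀ x, ExteriorAlgebra 𝕜 (V x)) :
    ofFun f * u = fun x => f x • u x := by
  funext x
  exact (Algebra.smul_def (f x) (u x)).symm

/-- Evaluation on covectors does not split along products, so the claim is reduced to generators,
where the left factor is a function or a section at a time. -/
lemma IsMultivector.mul (hΓ : HasFrames Γ n) {u v : ∀ x, ExteriorAlgebra 𝕜 (V x)}
    (hu : IsMultivector Γ u) (hv : IsMultivector Γ v) : IsMultivector Γ (u * v) := by
  refine mv_induction hΓ (P := fun u => IsMultivector Γ (u * v)) ?_ ?_ ?_ hu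
  · intro u w _ _ h1 h2
    rw [add_mul]
    exact h1.add h2
  · intro u _ h
    refine isSmoothVia_of_local fun x => ?_
    obtain ⟨k, w, _, hw, hx⟩ := h x
    refine ⟨_, hw, ?_⟩
    filter_upwards [hx] with y hy
    rw [Pi.mul_apply, Pi.mul_apply, hy]
  · intro k u h
    induction h with
    | func f hf => rw [ofFun_mul]; exact IsSmoothVia.fsmul hf hv
    | mul k X u _ ih => rw [mul_assoc]; exact ih.ofSec_mul X
    | add k u w _ _ ih ih' => rw [add_mul]; exact ih.add ih'

lemma IsMultivector.ic_isForm (hΓ : HasFrames Γ n) {u : ∀ x, ExteriorAlgebra 𝕜 (V x)}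
    (hu : IsMultivector Γ u) {α : ∀ x, ExteriorAlgebra 𝕜 (Module.Dual 𝕜 (V x))}
    (hα : IsForm Γ α) : IsForm Γ (fun x => ic (u x) (α x)) := by
  refine mv_induction hΓ (P := fun u => ∀ α, IsForm Γ α → IsForm Γ (fun x => ic (u x) (α x)))
    ?_ ?_ ?_ hu α hα
  · intro u w _ _ h1 h2 α hα
    simp only [Pi.add_apply, ic_add]
    exact (h1 α hα).add (h2 α hα)
  · intro u _ h α hα
    refine isSmoothVia_of_local fun x => ?_
    obtain ⟨k, w, _, hw, hx⟩ := h x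
    refine ⟨_, hw α hα, ?_⟩
    filter_upwards [hx] with y hy
    rw [hy]
  · intro k u h
    induction h with
    | func f hf =>
      intro α hα
      simp only [ofFun, ic_algebraMap]
      exact IsSmoothVia.fsmul hf hα
    | mul k X u _ ih =>
      intro α hα
      simp only [Pi.mul_apply, ofSec, ic_mul, ic_ι]
      exact ih _ (IsSmoothVia.cl hα X)
    | add k u w _ _ ih ih' =>
      intro α hα
      simp only [Pi.add_apply, ic_add]
      exact (ih α hα).add (ih' α hα)

lemma IsForm.ι_mul {α : ∀ x, ExteriorAlgebra 𝕜 (Module.Dual 𝕜 (V x))} (hα : IsForm Γ α)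
    (θ : dualSections Γ) : IsForm Γ (fun x => ExteriorAlgebra.ι 𝕜 (θ.1 x) * α x) :=
  IsSmoothVia.ι_mul hα fun X => θ.2 X.1 X.2

lemma isMultivector_cr {u : ∀ x, ExteriorAlgebra 𝕜 (V x)} (hu : IsMultivector Γ u)
    (θ : dualSections Γ) : IsMultivector Γ (fun x => cr (θ.1 x) (u x)) := by
  have h : (fun x => cr (θ.1 x) (u x)) = (-1 : 𝕜) • fun x => cl (θ.1 x) (inv (u x)) := by
    funext x
    simp [cr]
  rw [h]
  exact (IsSmoothVia.cl (IsSmoothVia.inv hu) θ).smul (-1)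

end Multivectors

/-! ### `Ω♯` reflects smoothness. -/

section Sharp

variable {𝕜 : Type*} [RCLike 𝕜] {m : ℕ} {M : Type*} [TopologicalSpace M]
  [ChartedSpace (EuclideanSpace ℝ (Fin m)) M]
  {V : M → Type*} [∀ x, AddCommGroup (V x)] [∀ x, Module 𝕜 (V x)]
  {Γ : Submodule (smoothFun 𝕜 m M) (∀ x, V x)} {n : ℕ}
  {Ω : ∀ x, ExteriorAlgebra 𝕜 (Module.Dual 𝕜 (V x))}

/-- The degree-zero part of `w` is a quotient of values of `i_w Ω` and `Ω`. Higher evaluations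
reduce to it, since contracting `w` by a covector amounts, up to sign and grade involution, to
exterior multiplication of `i_w Ω`. -/
lemma isMultivector_of_sharp (hΓ : HasFrames Γ n) (hΩ : IsForm Γ Ω) (hn : HasDeg n Ω)
    (h0 : ∀ x, Ω x ≠ 0) {w : ∀ x, ExteriorAlgebra 𝕜 (V x)}
    (hw : IsForm Γ (fun x => ic (w x) (Ω x))) : IsMultivector Γ w := by
  intro l
  change evalOn (fun _ => LinearMap.id) w l ∈ _
  induction l generalizing w with
  | nil =>
    rw [mem_smoothFun_iff]
    intro x
    obtain ⟨l, hl⟩ : ∃ l : List Γ, evalOn (evPair 𝕜 V) Ω l x ≠ 0 := by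
      by_contra hcon
      push Not at hcon
      apply h0 x
      refine hΓ.eq_of_evalOn (α := Ω) (β := 0) fun l => ?_
      rw [hcon l]
      exact (evalList_zero _).symm
    have hlen : l.length = n := by
      by_contra hne
      exact hl (evalList_of_deg (hn x) _ (by simpa using hne))
    -- On a list of length `n` only the component of degree `n` counts, and components of `w` of
    -- positive degree lower the degree of `Ω` below `n`.
    have hval : ∀ y, evalOn (evPair 𝕜 V) (fun x => ic (w x) (Ω x)) l y =
        ExteriorAlgebra.algebraMapInv (w y) * evalOn (evPair 𝕜 V) Ω l y := by
      intro y
      obtain ⟨e, θ, hy⟩ := hΓ y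
      have hcard : Fintype.card (Fin n) = n := Fintype.card_fin n
      have key : ∀ u : ExteriorAlgebra 𝕜 (V y),
          evalList (l.map fun X => evPair 𝕜 V y (X.1 y)) (ic u (Ω y)) =
            ExteriorAlgebra.algebraMapInv u *
              evalList (l.map fun X => evPair 𝕜 V y (X.1 y)) (Ω y) := by
        intro u
        induction u using homogeneous_induction with
        | hadd a b ha hb => rw [ic_add, evalList_add, map_add, add_mul, ha, hb]
        | hhom k a ha =>
          cases k with
          | zero =>
            obtain ⟨c, rfl⟩ := mem_zero_iff.1 ha
            rw [ic_algebraMap, evalList_smul, algebraMapInv_algebraMap]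
          | succ k =>
            rw [algebraMapInv_of_deg ha (by omega), zero_mul]
            by_cases hk : n < k + 1
            · rw [hy.self_of_nhds.eq_zero_of_lt ha (by simpa using hk)]
              have : ic (0 : ExteriorAlgebra 𝕜 (V y)) (Ω y) = 0 := by simp [ic]
              rw [this, evalList_zero]
            · refine evalList_of_deg (ic_deg ha (j := n - (k + 1)) ?_) _ ?_
              · rw [Nat.add_sub_cancel' (by omega)]; exact hn y
              · simp only [List.length_map]; omega
      exact key (w y)
    have h1 := mem_smoothFun_iff.1 (hw l) x
    have h2 := mem_smoothFun_iff.1 (hΩ l) x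
    have h3 : ContMDiffAt (𝓡 m) 𝓘(ℝ, 𝕜) ∞ (fun y => (evalOn (evPair 𝕜 V) Ω l y)⁻¹) x :=
      ((contDiffAt_inv (𝕜' := 𝕜) ℝ hl).contMDiffAt).comp x h2
    have h4 : ContMDiffAt (𝓡 m) 𝓘(ℝ, 𝕜) ∞ (fun y =>
        evalOn (evPair 𝕜 V) (fun x => ic (w x) (Ω x)) l y *
          (evalOn (evPair 𝕜 V) Ω l y)⁻¹) x :=
      ((contDiff_mul (𝕜 := ℝ) (𝔸 := 𝕜)).contMDiff.contMDiffAt).comp x (h1.prodMk_space h3)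
    refine h4.congr_of_eventuallyEq ?_
    filter_upwards [h2.continuousAt.eventually_ne hl] with y hy
    rw [hval, mul_assoc, mul_inv_cancel₀ hy, mul_one]
    rfl
  | cons θ l ih =>
    rw [evalOn_cons]
    refine ih ?_
    -- Left contraction of `w` is minus right contraction of its involute, and `i_{inv w} Ω = (-1)^n
    -- inv(i_w Ω)`; together they produce the factor `-(-1)^n`.
    have h1 : (fun x => ic (cl ((LinearMap.id : _ →ₗ[𝕜] Module.Dual 𝕜 (V x)) (θ.1 x)) (w x)) (Ω x)) =
        (-(-1 : 𝕜) ^ n) • fun x =>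
          ExteriorAlgebra.ι 𝕜 (θ.1 x) * inv (ic (w x) (Ω x)) := by
      funext x
      obtain ⟨e, θ', hx⟩ := hΓ x
      have h2 := hx.self_of_nhds.ι_mul_sharp (Ω := Ω x) (by simpa using hn x) (θ.1 x) (inv (w x))
      rw [cr, inv_inv, ic_neg, ic_inv_top (hn x), mul_smul_comm] at h2
      rw [Pi.smul_apply, neg_smul, h2, neg_neg]
      rfl
    rw [h1]
    exact (IsForm.ι_mul (IsSmoothVia.inv hw) θ).smul _

end Sharp

end LieBialg

namespace LieBialg

open Filter Topology

/-! ### Operators on forms: contractions, `d`, Lie derivatives and their commutators. -/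

namespace LieRinehart

variable {𝕜 R G : Type*} [CommRing 𝕜] [CommRing R] [Algebra 𝕜 R] [AddCommGroup G]
    [Module R G] (L : LieRinehart 𝕜 R G)

/-- The condition on lengths is an arbitrary predicate because inserting an argument shifts it by
one. -/
lemma lieD_eq_zero_of_length (X : G) {p : ℕ → Prop} {Φ : List G → R}
    (h : ∀ l, p l.length → Φ l = 0) (l : List G) (hl : p l.length) : L.lieD X Φ l = 0 := by
  induction l generalizing Φ p with
  | nil => simp only [lieD]; rw [h [] hl, map_zero]
  | cons Y l ih =>
    have h1 : L.lieD X (ins Y Φ) l = 0 :=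
      ih (p := fun k => p (k + 1)) (fun l hl => h (Y :: l) hl) hl
    change L.lieD X (ins Y Φ) l - Φ (L.bracket X Y :: l) = 0
    rw [h1, h (L.bracket X Y :: l) hl, sub_zero]

lemma dC_eq_zero_of_length {p : ℕ → Prop} {Φ : List G → R}
    (h : ∀ l, p l.length → Φ l = 0) (X : G) (l : List G) (hl : p l.length) :
    L.dC Φ (X :: l) = 0 := by
  induction l generalizing Φ p X with
  | nil =>
    change L.lieD X Φ [] - 0 = 0
    rw [L.lieD_eq_zero_of_length X h [] hl, sub_zero]
  | cons Y l ih =>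
    have h1 : L.dC (ins X Φ) (Y :: l) = 0 :=
      ih (p := fun k => p (k + 1)) (fun l hl => h (X :: l) hl) Y hl
    change L.lieD X Φ (Y :: l) - L.dC (ins X Φ) (Y :: l) = 0
    rw [h1, L.lieD_eq_zero_of_length X h _ hl, sub_zero]

end LieRinehart

section Operators

variable {𝕜 : Type*} [RCLike 𝕜] {m : ℕ} {M : Type*} [TopologicalSpace M]
  [ChartedSpace (EuclideanSpace ℝ (Fin m)) M]
  {V : M → Type*} [∀ x, AddCommGroup (V x)] [∀ x, Module 𝕜 (V x)]
  {Γ : Submodule (smoothFun 𝕜 m M) (∀ x, V x)} {n : ℕ}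

lemma Rep.add {α β : ∀ x, ExteriorAlgebra 𝕜 (Module.Dual 𝕜 (V x))}
    {Φ Ψ : List Γ → smoothFun 𝕜 m M} (h : Rep α Φ) (h' : Rep β Ψ) : Rep (α + β) (Φ + Ψ) :=
  rep_iff.2 fun Xs x => by
    have h1 := h.apply Xs x
    have h2 := h'.apply Xs x
    rw [Pi.add_apply, evalList_add, h1, h2]
    rfl

lemma Rep.fsmul {α : ∀ x, ExteriorAlgebra 𝕜 (Module.Dual 𝕜 (V x))}
    {Φ : List Γ → smoothFun 𝕜 m M} (h : Rep α Φ) (f : smoothFun 𝕜 m M) :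
    Rep (fun x => f.1 x • α x) (f • Φ) :=
  rep_iff.2 fun Xs x => by
    rw [evalList_smul, h.apply Xs x]
    rfl

lemma Rep.smul {α : ∀ x, ExteriorAlgebra 𝕜 (Module.Dual 𝕜 (V x))}
    {Φ : List Γ → smoothFun 𝕜 m M} (h : Rep α Φ) (c : 𝕜) :
    Rep (c • α) (algebraMap 𝕜 (smoothFun 𝕜 m M) c • Φ) := h.fsmul (algebraMap 𝕜 _ c)

lemma Rep.sub {α β : ∀ x, ExteriorAlgebra 𝕜 (Module.Dual 𝕜 (V x))}
    {Φ Ψ : List Γ → smoothFun 𝕜 m M} (h : Rep α Φ) (h' : Rep β Ψ) : Rep (α - β) (Φ - Ψ) := by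
  have h1 := h.add (h'.smul (-1))
  have h2 : algebraMap 𝕜 (smoothFun 𝕜 m M) (-1) • Ψ = -Ψ := by
    rw [map_neg, map_one]
    exact neg_one_smul (smoothFun 𝕜 m M) Ψ
  rwa [h2, neg_one_smul, ← sub_eq_add_neg, ← sub_eq_add_neg] at h1

lemma Rep.zero : Rep (0 : ∀ x, ExteriorAlgebra 𝕜 (Module.Dual 𝕜 (V x)))
    (0 : List Γ → smoothFun 𝕜 m M) :=
  rep_iff.2 fun _ _ => evalList_zero _

lemma Rep.ins {α : ∀ x, ExteriorAlgebra 𝕜 (Module.Dual 𝕜 (V x))}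
    {Φ : List Γ → smoothFun 𝕜 m M} (h : Rep α Φ) (X : Γ) :
    Rep (fun x => ic (ExteriorAlgebra.ι 𝕜 (X.1 x)) (α x)) (LieBialg.ins X Φ) :=
  rep_iff.2 fun Xs x => by
    rw [ic_ι]
    exact h.apply (X :: Xs) x

lemma Rep.wedge {α : ∀ x, ExteriorAlgebra 𝕜 (Module.Dual 𝕜 (V x))}
    {Φ : List Γ → smoothFun 𝕜 m M} (h : Rep α Φ) {η : ∀ x, Module.Dual 𝕜 (V x)}
    (θ : Γ → smoothFun 𝕜 m M) (hθ : ∀ X x, (θ X).1 x = η x (X.1 x)) :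
    Rep (fun x => ExteriorAlgebra.ι 𝕜 (η x) * α x) (wedgeC θ Φ) := by
  refine rep_iff.2 fun Xs x => ?_
  rw [evalList_ι_mul]
  have h1 := fun Xs => h.apply Xs x
  generalize α x = a at h1
  clear h
  induction Xs generalizing Φ a with
  | nil => rfl
  | cons X l ih =>
    have h2 := ih (Φ := LieBialg.ins X Φ) (a := cl (Module.Dual.eval 𝕜 (V x) (X.1 x)) a)
      fun Xs => h1 (X :: Xs)
    change η x (X.1 x) * evalList (List.map _ (List.map _ l)) a - _ =
      (θ X).1 x * (Φ l).1 x - (wedgeC θ (LieBialg.ins X Φ) l).1 x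
    rw [← h2, hθ, h1]
    rfl

/-- The differential of a function, as a section of the dual bundle. -/
def dFunSec (L : LieAlgebroid Γ) (f : smoothFun 𝕜 m M) : dualSections Γ :=
  ⟨fun x =>
    { toFun := fun v => vecDeriv (L.anchor x v) f.1
      map_add' := fun v w => by rw [map_add, vecDeriv_add]
      map_smul' := fun c v => by rw [map_smul, vecDeriv_smul]; rfl },
    fun X hX => L.anchor_smooth ⟨X, hX⟩ f.1 f.2⟩

/-- The space `Γ(⋀A*)`. -/
def formSub (Γ : Submodule (smoothFun 𝕜 m M) (∀ x, V x)) :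
    Submodule 𝕜 (∀ x, ExteriorAlgebra 𝕜 (Module.Dual 𝕜 (V x))) where
  carrier := {α | IsForm Γ α}
  add_mem' := IsSmoothVia.add
  zero_mem' := isSmoothVia_zero
  smul_mem' := fun c _ h => IsSmoothVia.smul c h

/-- The algebra `Γ(⋀A)`. -/
def mvSub (hΓ : HasFrames Γ n) : Subalgebra 𝕜 (∀ x, ExteriorAlgebra 𝕜 (V x)) where
  carrier := {u | IsMultivector Γ u}
  add_mem' := IsSmoothVia.add
  mul_mem' := IsMultivector.mul hΓ
  algebraMap_mem' := fun c => isSmoothVia_ofFun ((smoothFun 𝕜 m M).algebraMap_mem c)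

variable {hΓ : HasFrames Γ n}

instance : AddCommGroup (formSub Γ) := inferInstance
instance : AddCommMonoid (formSub Γ) := AddCommGroup.toAddCommMonoid
instance : Module 𝕜 (formSub Γ) := inferInstance
instance : SMul 𝕜 (formSub Γ) := inferInstance
instance : Ring (Module.End 𝕜 (formSub Γ)) := Module.End.instRing
instance : Algebra 𝕜 (Module.End 𝕜 (formSub Γ)) := Module.End.instAlgebra 𝕜 𝕜 (formSub Γ)
instance : AddCommGroup (Module.End 𝕜 (formSub Γ)) := LinearMap.addCommGroup
instance : AddCommMonoid (Module.End 𝕜 (formSub Γ)) := LinearMap.addCommMonoid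
instance : Module 𝕜 (Module.End 𝕜 (formSub Γ)) := LinearMap.module
instance : Ring (mvSub hΓ) := inferInstance
instance : Algebra 𝕜 (mvSub hΓ) := inferInstance
instance : AddCommGroup (mvSub hΓ) := Ring.toAddCommGroup
instance : AddCommMonoid (mvSub hΓ) := AddCommGroup.toAddCommMonoid
instance : Module 𝕜 (mvSub hΓ) := Algebra.toModule
instance : SMul 𝕜 (mvSub hΓ) := inferInstance

/-- A function, as an element of `Γ(⋀A)`. -/
def mvFun (hΓ : HasFrames Γ n) (f : smoothFun 𝕜 m M) : mvSub hΓ :=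
  ⟨ofFun f.1, isSmoothVia_ofFun f.2⟩

lemma isMultivector_ofSec (X : Γ) : IsMultivector Γ (ofSec X.1) := by
  have h := IsMultivector.ofSec_mul (Γ := Γ) (u := ofFun 1) (isSmoothVia_ofFun (one_mem _)) X
  have h1 : (ofFun (1 : M → 𝕜) : ∀ x, ExteriorAlgebra 𝕜 (V x)) = 1 := by
    funext x; simp [ofFun]
  rwa [h1, mul_one] at h

/-- A section, as an element of `Γ(⋀A)`. -/
def mvSec (hΓ : HasFrames Γ n) (X : Γ) : mvSub hΓ := ⟨ofSec X.1, isMultivector_ofSec X⟩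

/-- The grade involution on `Γ(⋀A)`. -/
def mvInv (u : mvSub hΓ) : mvSub hΓ := ⟨fun x => inv (u.1 x), IsSmoothVia.inv u.2⟩

lemma mvInv_of_deg {k : ℕ} {u : mvSub hΓ} (h : HasDeg k u.1) : mvInv u = (-1 : 𝕜) ^ k • u :=
  Subtype.ext <| funext fun x => inv_of_deg (h x)

/-- Contraction by a multivector, as an operator on forms. -/
def iOp (u : mvSub hΓ) : Module.End 𝕜 (formSub Γ) where
  toFun α := ⟨fun x => ic (u.1 x) (α.1 x), u.2.ic_isForm hΓ α.2⟩
  map_add' _ _ := Subtype.ext <| funext fun x => (ic (u.1 x)).map_add _ _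
  map_smul' c α := Subtype.ext <| funext fun x => (ic (u.1 x)).map_smul c (α.1 x)

lemma iOp_add (u v : mvSub hΓ) : iOp (u + v) = iOp u + iOp v :=
  LinearMap.ext fun _ => Subtype.ext <| funext fun _ => ic_add _ _ _

lemma iOp_smul (c : 𝕜) (u : mvSub hΓ) : iOp (c • u) = c • iOp u :=
  LinearMap.ext fun _ => Subtype.ext <| funext fun _ => ic_smul _ _ _

lemma iOp_zero : iOp (0 : mvSub hΓ) = 0 := by
  rw [← zero_smul 𝕜 (0 : mvSub hΓ), iOp_smul, zero_smul]

lemma iOp_sub (u v : mvSub hΓ) : iOp (u - v) = iOp u - iOp v := by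
  rw [sub_eq_add_neg, ← neg_one_smul 𝕜 v, iOp_add, iOp_smul, neg_one_smul, ← sub_eq_add_neg]

lemma iOp_apply (u : mvSub hΓ) (α : formSub Γ) (x : M) :
    (iOp u α).1 x = ic (u.1 x) (α.1 x) := rfl

lemma iOp_mul (u v : mvSub hΓ) : iOp (u * v) = iOp v * iOp u :=
  LinearMap.ext fun _ => Subtype.ext <| funext fun _ => ic_mul _ _ _

lemma mv_mul_comm {k l : ℕ} {u v : mvSub hΓ} (hu : HasDeg k u.1) (hv : HasDeg l v.1) :
    v * u = (-1 : 𝕜) ^ (k * l) • (u * v) :=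
  Subtype.ext <| funext fun x => ext_mul_comm (hu x) (hv x)

variable [T2Space M] [IsManifold (𝓡 m) ∞ M] (hΓ) (L : LieAlgebroid Γ)

/-- The differential of a Lie algebroid, as an operator on forms. -/
def dOp : Module.End 𝕜 (formSub Γ) where
  toFun α := ⟨dA L α.1, by
    obtain ⟨Φ, hΦ⟩ := IsForm.exists_rep α.2
    exact (hΦ.dA hΓ L).isForm⟩
  map_add' α β := Subtype.ext <| by
    obtain ⟨Φ, hΦ⟩ := IsForm.exists_rep α.2
    obtain ⟨Ψ, hΨ⟩ := IsForm.exists_rep β.2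
    have h := ((hΦ.add hΨ).dA hΓ L)
    rw [LieRinehart.dC_add] at h
    exact h.unique hΓ ((hΦ.dA hΓ L).add (hΨ.dA hΓ L))
  map_smul' c α := Subtype.ext <| by
    obtain ⟨Φ, hΦ⟩ := IsForm.exists_rep α.2
    have h := ((hΦ.smul c).dA hΓ L)
    -- The Leibniz rule for `d` is over functions; for a constant the extra term vanishes because
    -- derivations kill constants.
    have h0 : wedgeC (L.toLieRinehart.dFun (algebraMap 𝕜 (smoothFun 𝕜 m M) c)) Φ = 0 := by
      have : ⇑(L.toLieRinehart.dFun (algebraMap 𝕜 (smoothFun 𝕜 m M) c)) = 0 := by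
        funext X
        exact (L.toLieRinehart.act X).map_algebraMap c
      rw [this]
      funext l
      clear h hΦ
      induction l generalizing Φ with
      | nil => rfl
      | cons X l ih =>
        change 0 * _ - wedgeC 0 (ins X Φ) l = 0
        rw [ih]; simp
    rw [LieRinehart.dC_smul, h0, add_zero] at h
    exact h.unique hΓ ((hΦ.dA hΓ L).smul c)

lemma dOp_mul_dOp : dOp hΓ L * dOp hΓ L = 0 := LinearMap.ext fun α => Subtype.ext <| by
  obtain ⟨Φ, hΦ⟩ := IsForm.exists_rep α.2
  have h := (hΦ.dA hΓ L).dA hΓ L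
  rw [LieRinehart.dC_dC _ hΦ.isAlt] at h
  exact h.unique hΓ Rep.zero

/-- Exterior multiplication by the differential of a function. -/
def eOp (f : smoothFun 𝕜 m M) : Module.End 𝕜 (formSub Γ) where
  toFun α := ⟨fun x => ExteriorAlgebra.ι 𝕜 ((dFunSec L f).1 x) * α.1 x,
    IsForm.ι_mul α.2 (dFunSec L f)⟩
  map_add' _ _ := Subtype.ext <| funext fun _ => mul_add _ _ _
  map_smul' c α := Subtype.ext <| funext fun x => mul_smul_comm c _ (α.1 x)

lemma dOp_mul_fun (f : smoothFun 𝕜 m M) :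
    dOp hΓ L * iOp (mvFun hΓ f) = iOp (mvFun hΓ f) * dOp hΓ L + eOp L f :=
  LinearMap.ext fun α => Subtype.ext <| by
    obtain ⟨Φ, hΦ⟩ := IsForm.exists_rep α.2
    have h := ((hΦ.fsmul f).dA hΓ L)
    rw [LieRinehart.dC_smul] at h
    have h1 := h.unique hΓ (((hΦ.dA hΓ L).fsmul f).add
      (hΦ.wedge (η := (dFunSec L f).1) (L.toLieRinehart.dFun f) fun X x => rfl))
    have h2 : (iOp (mvFun hΓ f) α).1 = fun x => f.1 x • α.1 x := funext fun x => by
      rw [iOp_apply]; exact ic_algebraMap _ _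
    change dA L (iOp (mvFun hΓ f) α).1 = _
    rw [h2, h1]
    funext x
    change _ = ic (algebraMap 𝕜 _ (f.1 x)) (dA L α.1 x) + _
    rw [ic_algebraMap]
    rfl

/-- Right contraction of a multivector by the differential of a function. -/
def mvCr (f : smoothFun 𝕜 m M) (u : mvSub hΓ) : mvSub hΓ :=
  ⟨fun x => cr ((dFunSec L f).1 x) (u.1 x), isMultivector_cr u.2 (dFunSec L f)⟩

lemma eOp_mul_iOp (f : smoothFun 𝕜 m M) (u : mvSub hΓ) :
    eOp L f * iOp u = iOp (mvCr hΓ L f u) + iOp (mvInv u) * eOp L f :=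
  LinearMap.ext fun _ => Subtype.ext <| funext fun _ => ι_mul_ic _ _ _

/-- The Lie derivative along a section. -/
def lieOp (X : Γ) : Module.End 𝕜 (formSub Γ) :=
  iOp (mvSec hΓ X) * dOp hΓ L + dOp hΓ L * iOp (mvSec hΓ X)

/-- Links `i_X d + d i_X` to the recursively defined Lie derivative: the term `d i_X` cancels
against the one in `i_X d = L_X - d i_X`. -/
lemma rep_lieOp (X : Γ) {α : formSub Γ} {Φ : List Γ → smoothFun 𝕜 m M} (hΦ : Rep α.1 Φ) :
    Rep (lieOp hΓ L X α).1 (L.toLieRinehart.lieD X Φ) := by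
  have h := ((hΦ.dA hΓ L).ins X).add ((hΦ.ins X).dA hΓ L)
  rw [LieRinehart.ins_dC, sub_add_cancel] at h
  exact h

lemma lieOp_comm_sec (X Y : Γ) : lieOp hΓ L X * iOp (mvSec hΓ Y) - iOp (mvSec hΓ Y) *
    lieOp hΓ L X = iOp (mvSec hΓ (L.bracket X Y)) := LinearMap.ext fun α => Subtype.ext <| by
  obtain ⟨Φ, hΦ⟩ := IsForm.exists_rep α.2
  have h1 := rep_lieOp hΓ L X (α := iOp (mvSec hΓ Y) α) (hΦ.ins Y)
  have h2 := (rep_lieOp hΓ L X hΦ).ins Y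
  rw [LieRinehart.ins_lieD] at h2
  have h3 := h1.sub h2
  rw [sub_sub_cancel] at h3
  exact h3.unique hΓ (hΦ.ins (L.bracket X Y))

lemma lieOp_comm_fun (X : Γ) (f : smoothFun 𝕜 m M) : lieOp hΓ L X * iOp (mvFun hΓ f) -
    iOp (mvFun hΓ f) * lieOp hΓ L X = iOp (mvFun hΓ (L.toLieRinehart.act X f)) :=
  LinearMap.ext fun α => Subtype.ext <| by
  obtain ⟨Φ, hΦ⟩ := IsForm.exists_rep α.2
  have key : ∀ (f : smoothFun 𝕜 m M) (α : formSub Γ),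
      (iOp (mvFun hΓ f) α).1 = fun x => f.1 x • α.1 x := fun f α => funext fun x => by
    rw [iOp_apply]; exact ic_algebraMap _ _
  have h0 := hΦ.fsmul f
  rw [← key] at h0
  have h1 := rep_lieOp hΓ L X h0
  have h2 := (rep_lieOp hΓ L X hΦ).fsmul f
  rw [← key] at h2
  rw [LieRinehart.lieD_smul] at h1
  have h3 := h1.sub h2
  rw [add_sub_cancel_left] at h3
  have h4 := hΦ.fsmul (L.toLieRinehart.act X f)
  rw [← key] at h4
  exact h3.unique hΓ h4

-- The Cartan formula on a list of length `j + 1` uses only values on lists of length `j`, so `dα`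
-- is invisible to lists of length other than `k + 1`.
include hΓ in
lemma dA_hasDeg {k : ℕ} {α : ∀ x, ExteriorAlgebra 𝕜 (Module.Dual 𝕜 (V x))} (hα : IsForm Γ α)
    (hk : HasDeg k α) : HasDeg (k + 1) (dA L α) := by
  obtain ⟨Φ, hΦ⟩ := IsForm.exists_rep hα
  have h1 : ∀ l : List Γ, l.length ≠ k → Φ l = 0 := fun l hl =>
    Subtype.ext <| funext fun x => by
      rw [← hΦ.apply l x]
      exact evalList_of_deg (hk x) _ (by simpa using hl)
  have h2 : ∀ l : List Γ, l.length ≠ k + 1 → L.toLieRinehart.dC Φ l = 0 := fun l hl => by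
    cases l with
    | nil => rfl
    | cons X l =>
      exact L.toLieRinehart.dC_eq_zero_of_length (p := fun j => j ≠ k) h1 X l (by simpa using hl)
  intro x
  have h3 : dA L α x = comp (k + 1) (dA L α x) := by
    refine hΓ.eq_of_evalOn (α := dA L α) (β := fun x => comp (k + 1) (dA L α x)) fun l => ?_
    by_cases hl : l.length = k + 1
    · have := evalList_comp (l.map fun X => evPair 𝕜 V x (X.1 x)) (dA L α x)
      rw [List.length_map, hl] at this
      exact this.symm
    · rw [hΦ.dA hΓ L l, h2 l hl]
      exact (evalList_comp_ne _ _ (by simpa using hl)).symm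
  rw [h3]
  exact comp_mem _ _

end Operators

end LieBialg

namespace LieBialg

open Filter Topology

/-! ### Algebra of the derived bracket. -/

section DerivedBracket

variable {𝕜 E : Type*} [Field 𝕜] [Ring E] [Algebra 𝕜 E]

/-- The derived bracket `-[[v, D], u]` of operators `u` and `v` of degrees `k` and `l`, for an
operator `D` of odd degree. -/
def derBr (D : E) (k l : ℕ) (u v : E) : E :=
  -((v * D - (-1 : 𝕜) ^ l • (D * v)) * u -
    (-1 : 𝕜) ^ ((l + 1) * k) • (u * (v * D - (-1 : 𝕜) ^ l • (D * v))))

variable (D : E) (k l r : ℕ) (u v w : E)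

lemma derBr_add_left : derBr (𝕜 := 𝕜) D k l (u + w) v = derBr (𝕜 := 𝕜) D k l u v +
    derBr (𝕜 := 𝕜) D k l w v := by
  simp only [derBr, mul_add, add_mul, smul_add, mul_sub, sub_mul, smul_sub]
  abel

/-- With `P = [v, D]` fixed, `u ↦ -[P, u]` is a graded derivation of composition, for any `P`
whatever. The factors appear reversed because `i_{u ∧ w} = i_w i_u`. -/
lemma derBr_mul_left : derBr (𝕜 := 𝕜) D (k + r) l (w * u) v =
    derBr (𝕜 := 𝕜) D r l w v * u + (-1 : 𝕜) ^ ((l + 1) * r) • (w * derBr (𝕜 := 𝕜) D k l u v) := by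
  simp only [derBr]
  generalize v * D - (-1 : 𝕜) ^ l • (D * v) = P
  rw [mul_add, pow_add]
  generalize (-1 : 𝕜) ^ ((l + 1) * k) = a
  generalize (-1 : 𝕜) ^ ((l + 1) * r) = b
  simp only [neg_mul, mul_neg, sub_mul, mul_sub, smul_mul_assoc, mul_smul_comm, mul_assoc,
    smul_neg, smul_sub]
  module

variable {u v w}

/-- The model is `u` multiplication by a function `f`, with `e` exterior multiplication by `df` and
`c` right contraction of `v` by `df`. -/
lemma derBr_fun {e c : E} (huv : u * v = v * u) (he : D * u = u * D + e)
    (hc : e * v = c + (-1 : 𝕜) ^ l • (v * e)) :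
    derBr (𝕜 := 𝕜) D 0 l u v = (-1 : 𝕜) ^ l • c := by
  have h1 : v * D * u = u * v * D + v * e := by rw [mul_assoc, he, mul_add, huv, mul_assoc]
  have h2 : D * v * u = u * (D * v) + c + (-1 : 𝕜) ^ l • (v * e) := by
    rw [mul_assoc, ← huv, ← mul_assoc, he, add_mul, hc, mul_assoc, add_assoc]
  simp only [derBr, mul_zero, pow_zero, one_smul, sub_mul, mul_sub, smul_mul_assoc,
    mul_smul_comm]
  rw [h1, h2, ← mul_assoc u v D]
  rcases neg_one_pow_eq_or 𝕜 l with h | h <;> simp only [h] <;> module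

/-- Graded Jacobi with `[u, v] = 0` turns `-[[v, D], u]` into `[[u, D], v]`; for `u = i_X` the inner
bracket is the Lie derivative. -/
lemma derBr_one (huv : u * v = (-1 : 𝕜) ^ l • (v * u)) :
    derBr (𝕜 := 𝕜) D 1 l u v = (u * D + D * u) * v - v * (u * D + D * u) := by
  have h1 : u * (v * D) = (-1 : 𝕜) ^ l • (v * (u * D)) := by
    rw [← mul_assoc, huv, smul_mul_assoc, mul_assoc]
  simp only [derBr, mul_one, pow_succ, sub_mul, mul_sub, smul_mul_assoc, mul_add, add_mul,
    mul_smul_comm, mul_assoc]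
  rw [h1, huv]
  simp only [mul_smul_comm]
  rcases neg_one_pow_eq_or 𝕜 l with h | h <;> simp only [h] <;> module

/-- Again graded Jacobi, the term containing `[u, v]` being zero; `D² = 0` plays no role. -/
lemma derBr_skew (huv : u * v = (-1 : 𝕜) ^ (k * l) • (v * u)) :
    derBr (𝕜 := 𝕜) D k l u v =
      -((-1 : 𝕜) ^ ((k + 1) * (l + 1)) • derBr (𝕜 := 𝕜) D l k v u) := by
  have h1 : u * (v * D) = (-1 : 𝕜) ^ (k * l) • (v * (u * D)) := by
    rw [← mul_assoc, huv, smul_mul_assoc, mul_assoc]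
  have hs : (-1 : 𝕜) ^ ((l + 1) * k) = (-1) ^ (k * l) * (-1) ^ k := by rw [← pow_add]; ring_nf
  have ht : (-1 : 𝕜) ^ ((k + 1) * l) = (-1) ^ (k * l) * (-1) ^ l := by rw [← pow_add]; ring_nf
  have hr : (-1 : 𝕜) ^ ((k + 1) * (l + 1)) = -((-1) ^ (k * l) * (-1) ^ l * (-1) ^ k) := by
    rw [← pow_add, ← pow_add, show (k + 1) * (l + 1) = k * l + l + k + 1 by ring, pow_succ]
    ring
  simp only [derBr, hs, ht, hr, sub_mul, mul_sub, smul_mul_assoc, mul_smul_comm, mul_assoc]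
  rw [h1, huv]
  simp only [mul_smul_comm]
  rcases neg_one_pow_eq_or 𝕜 l with h | h <;> rcases neg_one_pow_eq_or 𝕜 k with h' | h' <;>
    rcases neg_one_pow_eq_or 𝕜 (k * l) with h'' | h'' <;> simp only [h, h', h''] <;> module

variable {N : Type*} [AddCommGroup N] [Module 𝕜 N]

lemma derBr_apply_of_apply_eq_zero (k l : ℕ) (D u v : Module.End 𝕜 N) {a : N} (h : D a = 0) :
    derBr (𝕜 := 𝕜) D k l u v a = (-1 : 𝕜) ^ l • D (v (u a)) - v (D (u a)) -
      (-1 : 𝕜) ^ ((l + 1) * k) • (-1 : 𝕜) ^ l • u (D (v a)) := by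
  simp only [derBr, LinearMap.neg_apply, LinearMap.sub_apply, Module.End.mul_apply,
    LinearMap.smul_apply, h, map_zero, zero_sub, map_smul, map_neg]
  module

lemma sign_smul_sub (k l : ℕ) (a b c : N) : (-1 : 𝕜) ^ l • a - b - c =
    (-1 : 𝕜) ^ k • ((-1 : 𝕜) ^ (k + l) • a - (-1 : 𝕜) ^ k • b) - c := by
  rw [pow_add]
  rcases neg_one_pow_eq_or 𝕜 l with h | h <;> rcases neg_one_pow_eq_or 𝕜 k with h' | h' <;>
    simp only [h, h'] <;> module

end DerivedBracket

end LieBialg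

namespace LieBialg

open Filter Topology

/-! ### The operator `∂` and the bracket it generates. -/

section Del

variable {𝕜 : Type*} [RCLike 𝕜] {m : ℕ} {M : Type*} [TopologicalSpace M]
  [ChartedSpace (EuclideanSpace ℝ (Fin m)) M]
  {V : M → Type*} [∀ x, AddCommGroup (V x)] [∀ x, Module 𝕜 (V x)]
  {Γ : Submodule (smoothFun 𝕜 m M) (∀ x, V x)} {n : ℕ}
  {Ω : ∀ x, ExteriorAlgebra 𝕜 (Module.Dual 𝕜 (V x))}

/-- `Ω` is a smooth nowhere vanishing form of degree `n`. -/
structure IsVolumeForm (Γ : Submodule (smoothFun 𝕜 m M) (∀ x, V x)) (n : ℕ)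
    (Ω : ∀ x, ExteriorAlgebra 𝕜 (Module.Dual 𝕜 (V x))) : Prop where
  form : IsForm Γ Ω
  deg : HasDeg n Ω
  ne_zero : ∀ x, Ω x ≠ 0

/-- A volume form, as an element of `Γ(⋀A*)`. -/
def IsVolumeForm.toForm (hΩ : IsVolumeForm Γ n Ω) : formSub Γ := ⟨Ω, hΩ.form⟩

variable {hΓ : HasFrames Γ n}

lemma mvInv_add (u v : mvSub hΓ) : mvInv (u + v) = mvInv u + mvInv v :=
  Subtype.ext <| funext fun _ => map_add _ _ _

lemma mvInv_smul (c : 𝕜) (u : mvSub hΓ) : mvInv (c • u) = c • mvInv u :=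
  Subtype.ext <| funext fun x => inv.toLinearMap.map_smul c (u.1 x)

lemma mv_induction_hom {P : mvSub hΓ → Prop} (hadd : ∀ u v, P u → P v → P (u + v))
    (hhom : ∀ k u, HasDeg k u.1 → P u) (u : mvSub hΓ) : P u := by
  have h : u = ∑ k ∈ Finset.range (n + 1), (⟨compSec k u.1, u.2.compSec k⟩ : mvSub hΓ) := by
    apply Subtype.ext
    rw [AddSubmonoidClass.coe_finsetSum]
    exact (sum_compSec hΓ u.1).symm
  rw [h]
  exact Finset.sum_induction _ P hadd (hhom 0 0 fun x => Submodule.zero_mem _)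
    fun k _ => hhom k _ (hasDeg_compSec k u.1)

variable (hΩ : IsVolumeForm Γ n Ω)

lemma HasFrames.eq_zero_of_hasDeg (hΓ : HasFrames Γ n) {k : ℕ} (hk : n < k)
    {u : ∀ x, ExteriorAlgebra 𝕜 (V x)} (hu : HasDeg k u) : u = 0 := funext fun x => by
  obtain ⟨e, θ, h⟩ := hΓ x
  exact h.self_of_nhds.eq_zero_of_lt (hu x) (by simpa using hk)

lemma HasFrames.form_eq_zero_of_hasDeg (hΓ : HasFrames Γ n) {k : ℕ} (hk : n < k)
    {α : ∀ x, ExteriorAlgebra 𝕜 (Module.Dual 𝕜 (V x))} (hα : HasDeg k α) : α = 0 :=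
  funext fun x => by
  obtain ⟨e, θ, h⟩ := hΓ x
  exact h.self_of_nhds.dual.eq_zero_of_lt (hα x) (by simpa using hk)

include hΩ

lemma IsVolumeForm.sharp_bijective (hΓ : HasFrames Γ n) (x : M) :
    Function.Bijective (sharp (Ω x)) := by
  obtain ⟨e, θ, h⟩ := hΓ x
  have h1 : Ω x ∈ ⋀[𝕜]^(Fintype.card (Fin n)) (Module.Dual 𝕜 (V x)) := by simpa using hΩ.deg x
  exact ⟨h.self_of_nhds.sharp_injective h1 (hΩ.ne_zero x),
    h.self_of_nhds.sharp_surjective h1 (hΩ.ne_zero x)⟩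

lemma IsVolumeForm.hasDeg_of_sharp (hΓ : HasFrames Γ n) {k j : ℕ} (hkj : k + j = n)
    {w : ∀ x, ExteriorAlgebra 𝕜 (V x)} (hw : HasDeg j fun x => ic (w x) (Ω x)) : HasDeg k w := by
  intro x
  obtain ⟨e, θ, h⟩ := hΓ x
  exact h.self_of_nhds.deg_of_sharp (by simpa using hΩ.deg x) (hΩ.ne_zero x) (by simpa using hkj)
    (hw x)

lemma IsVolumeForm.ic_del (hΓ : HasFrames Γ n) (L : LieAlgebroid Γ)
    (u : ∀ x, ExteriorAlgebra 𝕜 (V x)) (x : M) :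
    ic (del L Ω u x) (Ω x) = dA L (fun y => ic (inv (u y)) (Ω y)) x :=
  Function.invFun_eq ((hΩ.sharp_bijective hΓ x).2 _)

lemma iOp_injective {u v : mvSub hΓ} (h : iOp u hΩ.toForm = iOp v hΩ.toForm) : u = v :=
  Subtype.ext <| funext fun x => (hΩ.sharp_bijective hΓ x).1
    (congrFun (congrArg Subtype.val h) x)

variable [T2Space M] [IsManifold (𝓡 m) ∞ M] (L : LieAlgebroid Γ)

/-- The operator `∂` on `Γ(⋀A)`. -/
def delOp (u : mvSub hΓ) : mvSub hΓ :=
  ⟨del L Ω u.1, isMultivector_of_sharp hΓ hΩ.form hΩ.deg hΩ.ne_zero (by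
    rw [funext (hΩ.ic_del hΓ L u.1)]
    exact (dOp hΓ L (iOp (mvInv u) hΩ.toForm)).2)⟩

lemma iOp_delOp (u : mvSub hΓ) :
    iOp (delOp hΩ L u) hΩ.toForm = dOp hΓ L (iOp (mvInv u) hΩ.toForm) :=
  Subtype.ext <| funext fun x => hΩ.ic_del hΓ L u.1 x

lemma delOp_add (u v : mvSub hΓ) : delOp hΩ L (u + v) = delOp hΩ L u + delOp hΩ L v :=
  iOp_injective hΩ <| by
    rw [iOp_delOp, mvInv_add, iOp_add, iOp_add, LinearMap.add_apply, LinearMap.add_apply,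
      map_add, iOp_delOp, iOp_delOp]

lemma delOp_smul (c : 𝕜) (u : mvSub hΓ) : delOp hΩ L (c • u) = c • delOp hΩ L u :=
  iOp_injective hΩ <| by
    rw [iOp_delOp, mvInv_smul, iOp_smul, iOp_smul, LinearMap.smul_apply, LinearMap.smul_apply,
      iOp_delOp]
    exact (dOp hΓ L).map_smul c _

lemma delOp_zero : delOp hΩ L (0 : mvSub hΓ) = 0 := by
  have h := delOp_smul hΩ L (0 : 𝕜) (0 : mvSub hΓ)
  rwa [zero_smul, zero_smul] at h

lemma iOp_delOp_of_deg {k : ℕ} {u : mvSub hΓ} (hu : HasDeg k u.1) :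
    iOp (delOp hΩ L u) hΩ.toForm = (-1 : 𝕜) ^ k • dOp hΓ L (iOp u hΩ.toForm) := by
  rw [iOp_delOp, mvInv_of_deg hu, iOp_smul]
  exact (dOp hΓ L).map_smul _ _

lemma dOp_volume (hΓ : HasFrames Γ n) : dOp hΓ L hΩ.toForm = 0 :=
  Subtype.ext <| hΓ.form_eq_zero_of_hasDeg (Nat.lt_succ_self n) (dA_hasDeg hΓ L hΩ.form hΩ.deg)

/-- Above the rank `u` vanishes. Otherwise `i_u Ω` has degree `n - (k + 1)`, `d` raises it by one,
and `Ω♯` reflects the degree; the case split keeps the subtraction honest. -/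
lemma delOp_deg {k : ℕ} {u : mvSub hΓ} (hu : HasDeg (k + 1) u.1) :
    HasDeg k (delOp hΩ L u).1 := by
  by_cases hk : n < k + 1
  · have : u = 0 := Subtype.ext (hΓ.eq_zero_of_hasDeg hk hu)
    rw [this, delOp_zero]
    exact fun x => Submodule.zero_mem _
  · have h1 : HasDeg (n - (k + 1)) (iOp u hΩ.toForm).1 := fun x =>
      ic_deg (hu x) (by rw [Nat.add_sub_cancel' (by omega)]; exact hΩ.deg x)
    have h2 : HasDeg (n - (k + 1) + 1) (iOp (delOp hΩ L u) hΩ.toForm).1 := by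
      rw [iOp_delOp_of_deg hΩ L hu]
      exact fun x => Submodule.smul_mem _ _ (dA_hasDeg hΓ L (iOp u hΩ.toForm).2 h1 x)
    exact hΩ.hasDeg_of_sharp hΓ (by omega) h2

lemma delOp_deg_zero {u : mvSub hΓ} (hu : HasDeg 0 u.1) : delOp hΩ L u = 0 := by
  apply iOp_injective hΩ
  have h1 : HasDeg n (iOp u hΩ.toForm).1 := fun x =>
    ic_deg (hu x) (by rw [zero_add]; exact hΩ.deg x)
  have h2 : dOp hΓ L (iOp u hΩ.toForm) = 0 := Subtype.ext <|
    hΓ.form_eq_zero_of_hasDeg (Nat.lt_succ_self n) (dA_hasDeg hΓ L (iOp u hΩ.toForm).2 h1)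
  rw [iOp_delOp_of_deg hΩ L hu, h2, smul_zero, iOp_zero, LinearMap.zero_apply]

lemma delOp_delOp (u : mvSub hΓ) : delOp hΩ L (delOp hΩ L u) = 0 := by
  induction u using mv_induction_hom with
  | hadd u v hu hv => rw [delOp_add, delOp_add, hu, hv, add_zero]
  | hhom k u hu =>
    cases k with
    | zero => rw [delOp_deg_zero hΩ L hu, delOp_zero]
    | succ k =>
      apply iOp_injective hΩ
      rw [iOp_delOp_of_deg hΩ L (delOp_deg hΩ L hu), iOp_delOp_of_deg hΩ L hu, map_smul,
        ← Module.End.mul_apply, dOp_mul_dOp, LinearMap.zero_apply, smul_zero, smul_zero, iOp_zero,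
        LinearMap.zero_apply]

/-- The bracket generated by the operator `∂`. -/
def delBr (u v : mvSub hΓ) : mvSub hΓ :=
  delOp hΩ L (mvInv u * v) - delOp hΩ L (mvInv u) * v - u * delOp hΩ L v

/-- The grade involution in the definition carries the sign `(-1)^k`, which keeps the bracket
bilinear on inhomogeneous multivectors. -/
lemma delBr_of_deg {k : ℕ} {u : mvSub hΓ} (hu : HasDeg k u.1) (v : mvSub hΓ) :
    delBr hΩ L u v = (-1 : 𝕜) ^ k • (delOp hΩ L (u * v) - delOp hΩ L u * v) - u * delOp hΩ L v := by
  rw [delBr, mvInv_of_deg hu, smul_mul_assoc, delOp_smul, delOp_smul, smul_mul_assoc, smul_sub]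

lemma delBr_add_left (u v w : mvSub hΓ) :
    delBr hΩ L (u + v) w = delBr hΩ L u w + delBr hΩ L v w := by
  simp only [delBr, mvInv_add, add_mul, delOp_add]
  abel

lemma delBr_add_right (u v w : mvSub hΓ) :
    delBr hΩ L u (v + w) = delBr hΩ L u v + delBr hΩ L u w := by
  simp only [delBr, mul_add, delOp_add]
  abel

lemma delBr_smul_left (c : 𝕜) (u v : mvSub hΓ) : delBr hΩ L (c • u) v = c • delBr hΩ L u v := by
  simp only [delBr, mvInv_smul, smul_mul_assoc, delOp_smul, smul_sub]

lemma delBr_smul_right (c : 𝕜) (u v : mvSub hΓ) : delBr hΩ L u (c • v) = c • delBr hΩ L u v := by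
  simp only [delBr, mul_smul_comm, delOp_smul, smul_sub]

/-- The exponent `l + 1` has the parity of the true degree `l - 1` of `∂v`; for `l = 0` both sides
vanish. -/
lemma mul_delOp {k l : ℕ} {u v : mvSub hΓ} (hu : HasDeg k u.1) (hv : HasDeg l v.1) :
    u * delOp hΩ L v = (-1 : 𝕜) ^ ((l + 1) * k) • (delOp hΩ L v * u) := by
  cases l with
  | zero => rw [delOp_deg_zero hΩ L hv, mul_zero, zero_mul, smul_zero]
  | succ l =>
    rw [mv_mul_comm (delOp_deg hΩ L hv) hu]
    congr 1
    rw [show (l + 1 + 1) * k = l * k + 2 * k by ring, pow_add, pow_mul (-1 : 𝕜) 2]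
    simp

lemma iOp_delOp_mul {k l : ℕ} {u v : mvSub hΓ} (hu : HasDeg k u.1) (hv : HasDeg l v.1) :
    iOp (delOp hΩ L (u * v)) hΩ.toForm =
      (-1 : 𝕜) ^ (k + l) • dOp hΓ L (iOp v (iOp u hΩ.toForm)) := by
  have huv : HasDeg (k + l) (u * v).1 := hu.mul hv
  rw [iOp_delOp_of_deg hΩ L huv, iOp_mul, Module.End.mul_apply]

lemma iOp_delOp_mul' {k : ℕ} {u : mvSub hΓ} (hu : HasDeg k u.1) (v : mvSub hΓ) :
    iOp (delOp hΩ L u * v) hΩ.toForm =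
      (-1 : 𝕜) ^ k • iOp v (dOp hΓ L (iOp u hΩ.toForm)) := by
  rw [iOp_mul, Module.End.mul_apply, iOp_delOp_of_deg hΩ L hu]
  exact (iOp v).map_smul _ _

-- As `dΩ = 0`, three terms of the derived bracket survive on `Ω`: `d i_v i_u Ω`, `i_v d i_u Ω` and
-- `i_u d i_v Ω`. By the definition of `∂` they are, up to sign, the images under `Ω♯` of `∂(u ∧
-- v)`, `∂u ∧ v` and `∂v ∧ u`.
set_option maxHeartbeats 1000000 in
lemma derBr_volume {k l : ℕ} {u v : mvSub hΓ} (hu : HasDeg k u.1) (hv : HasDeg l v.1) :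
    derBr (𝕜 := 𝕜) (dOp hΓ L) k l (iOp u) (iOp v) hΩ.toForm = iOp (delBr hΩ L u v) hΩ.toForm := by
  refine (derBr_apply_of_apply_eq_zero _ _ _ _ _ (dOp_volume hΩ L hΓ)).trans ?_
  rw [delBr_of_deg hΩ L hu, mul_delOp hΩ L hu hv, iOp_sub, iOp_smul, iOp_smul, iOp_sub]
  refine (sign_smul_sub k l _ _ _).trans ?_
  rw [← iOp_delOp_mul hΩ L hu hv, ← iOp_delOp_mul' hΩ L hu, ← iOp_delOp_mul' hΩ L hv]
  rfl

end Del

end LieBialg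

namespace LieBialg

open Filter Topology

/-! ### The derived bracket is contraction by the bracket generated by `∂`. -/

section DelBracket

variable {𝕜 : Type*} [RCLike 𝕜] {m : ℕ} {M : Type*} [TopologicalSpace M]
  [ChartedSpace (EuclideanSpace ℝ (Fin m)) M]
  {V : M → Type*} [∀ x, AddCommGroup (V x)] [∀ x, Module 𝕜 (V x)]
  {Γ : Submodule (smoothFun 𝕜 m M) (∀ x, V x)} {n : ℕ}
  {Ω : ∀ x, ExteriorAlgebra 𝕜 (Module.Dual 𝕜 (V x))}
  {hΓ : HasFrames Γ n}

/-- The operators `P` and `Q` have the same effect on germs at `x`. -/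
def GermEq (x : M) (P Q : Module.End 𝕜 (formSub Γ)) : Prop :=
  ∀ α β : formSub Γ, (∀ᶠ y in 𝓝 x, α.1 y = β.1 y) → ∀ᶠ y in 𝓝 x, (P α).1 y = (Q β).1 y

variable {x : M} {P Q P' Q' : Module.End 𝕜 (formSub Γ)}

lemma GermEq.mul (h : GermEq x P Q) (h' : GermEq x P' Q') : GermEq x (P * P') (Q * Q') :=
  fun α β hαβ => h _ _ (h' α β hαβ)

lemma GermEq.sub (h : GermEq x P Q) (h' : GermEq x P' Q') : GermEq x (P - P') (Q - Q') :=
  fun α β hαβ => by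
    filter_upwards [h α β hαβ, h' α β hαβ] with y h1 h2
    exact congrArg₂ (· - ·) h1 h2

lemma GermEq.neg (h : GermEq x P Q) : GermEq x (-P) (-Q) := fun α β hαβ => by
  filter_upwards [h α β hαβ] with y h1
  exact congrArg (- ·) h1

lemma GermEq.smul (h : GermEq x P Q) (c : 𝕜) : GermEq x (c • P) (c • Q) := fun α β hαβ => by
  filter_upwards [h α β hαβ] with y h1
  exact congrArg (c • ·) h1

lemma germEq_iOp {u v : mvSub hΓ} (h : ∀ᶠ y in 𝓝 x, u.1 y = v.1 y) : GermEq x (iOp u) (iOp v) :=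
  fun α β hαβ => by
    filter_upwards [h, hαβ] with y h1 h2
    rw [iOp_apply, iOp_apply, h1, h2]

variable [T2Space M] [IsManifold (𝓡 m) ∞ M] (L : LieAlgebroid Γ)

lemma germEq_dOp (hΓ : HasFrames Γ n) (x : M) : GermEq x (dOp hΓ L) (dOp hΓ L) :=
  fun α β hαβ => by
    filter_upwards [hαβ.eventually_nhds] with y hy
    exact dA_congr hΓ L α.2 β.2 hy

lemma germEq_derBr {k l : ℕ} {u v u' v' : mvSub hΓ} (hu : ∀ᶠ y in 𝓝 x, u.1 y = u'.1 y)
    (hv : ∀ᶠ y in 𝓝 x, v.1 y = v'.1 y) :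
    GermEq x (derBr (𝕜 := 𝕜) (dOp hΓ L) k l (iOp u) (iOp v))
      (derBr (𝕜 := 𝕜) (dOp hΓ L) k l (iOp u') (iOp v')) := by
  have h1 := germEq_iOp hu
  have h2 := germEq_iOp hv
  have h3 := (h2.mul (germEq_dOp L hΓ x)).sub (((germEq_dOp L hΓ x).mul h2).smul ((-1 : 𝕜) ^ l))
  exact ((h3.mul h1).sub ((h1.mul h3).smul ((-1 : 𝕜) ^ ((l + 1) * k)))).neg

lemma derBr_fun_left {l : ℕ} (f : smoothFun 𝕜 m M) {v : mvSub hΓ} (hv : HasDeg l v.1) :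
    derBr (𝕜 := 𝕜) (dOp hΓ L) 0 l (iOp (mvFun hΓ f)) (iOp v) =
      iOp ((-1 : 𝕜) ^ l • mvCr hΓ L f v) := by
  rw [iOp_smul]
  refine derBr_fun _ _ ?_ (dOp_mul_fun hΓ L f) ?_
  · rw [← iOp_mul, ← iOp_mul, mv_mul_comm (k := 0) (l := l) (hasDeg_ofFun f.1) hv, zero_mul,
      pow_zero, one_smul]
  · rw [eOp_mul_iOp, mvInv_of_deg hv, iOp_smul, smul_mul_assoc]

lemma derBr_sec_left {l : ℕ} (X : Γ) {v : mvSub hΓ} (hv : HasDeg l v.1) :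
    derBr (𝕜 := 𝕜) (dOp hΓ L) 1 l (iOp (mvSec hΓ X)) (iOp v) =
      lieOp hΓ L X * iOp v - iOp v * lieOp hΓ L X := by
  refine derBr_one _ _ ?_
  rw [← iOp_mul, ← iOp_mul, mv_mul_comm (k := 1) (l := l) (hasDeg_ofSec X.1) hv, one_mul, iOp_smul]

/-- A generated section, as an element of `Γ(⋀A)`. -/
def Gen.toMv (hΓ : HasFrames Γ n) {k : ℕ} {u : ∀ x, ExteriorAlgebra 𝕜 (V x)} (hu : Gen Γ k u) :
    mvSub hΓ := ⟨u, hu.isMultivector⟩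

/-- The commutator with `L_X` is a derivation of composition and sends contractions by functions and
sections to contractions. -/
lemma exists_lieOp_comm (X : Γ) {l : ℕ} {v : ∀ x, ExteriorAlgebra 𝕜 (V x)} (hv : Gen Γ l v) :
    ∃ w : mvSub hΓ, lieOp hΓ L X * iOp (hv.toMv hΓ) -
      iOp (hv.toMv hΓ) * lieOp hΓ L X = iOp w := by
  induction hv with
  | func f hf => exact ⟨_, lieOp_comm_fun hΓ L X ⟨f, hf⟩⟩
  | mul k Y u hu ih =>
    obtain ⟨w, hw⟩ := ih
    refine ⟨mvSec hΓ Y * w + mvSec hΓ (L.bracket X Y) * (hu.toMv hΓ), ?_⟩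
    have h1 : iOp ((hu.mul k Y u).toMv hΓ) =
        iOp (hu.toMv hΓ) * iOp (mvSec hΓ Y) := iOp_mul (mvSec hΓ Y) (hu.toMv hΓ)
    rw [iOp_add, iOp_mul, iOp_mul, ← hw, ← lieOp_comm_sec, h1]
    noncomm_ring
  | add k u v hu hv ih ih' =>
    obtain ⟨w, hw⟩ := ih
    obtain ⟨w', hw'⟩ := ih'
    refine ⟨w + w', ?_⟩
    have h1 : iOp ((hu.add k u v hv).toMv hΓ) =
        iOp (hu.toMv hΓ) + iOp (hv.toMv hΓ) :=
      iOp_add (hu.toMv hΓ) (hv.toMv hΓ)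
    rw [iOp_add, ← hw, ← hw', h1]
    noncomm_ring

/-- Induction on the left entry by the Leibniz rule; a section as left entry gives a commutator with
its Lie derivative, a function gives a right contraction. -/
lemma exists_derBr {k l : ℕ} {u v : ∀ x, ExteriorAlgebra 𝕜 (V x)} (hu : Gen Γ k u)
    (hv : Gen Γ l v) : ∃ w : mvSub hΓ, derBr (𝕜 := 𝕜) (dOp hΓ L) k l (iOp (hu.toMv hΓ))
      (iOp (hv.toMv hΓ)) = iOp w := by
  induction hu with
  | func f hf => exact ⟨_, derBr_fun_left L ⟨f, hf⟩ (v := (hv.toMv hΓ)) hv.hasDeg⟩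
  | mul k X u hu ih =>
    obtain ⟨w, hw⟩ := ih
    obtain ⟨w', hw'⟩ := exists_lieOp_comm (hΓ := hΓ) L X hv
    rw [← derBr_sec_left L X (v := (hv.toMv hΓ)) hv.hasDeg] at hw'
    refine ⟨mvSec hΓ X * w + (-1 : 𝕜) ^ ((l + 1) * k) • (w' * (hu.toMv hΓ)), ?_⟩
    have h1 : iOp ((hu.mul k X u).toMv hΓ) =
        iOp (hu.toMv hΓ) * iOp (mvSec hΓ X) := iOp_mul (mvSec hΓ X) (hu.toMv hΓ)
    rw [iOp_add, iOp_smul, iOp_mul, iOp_mul, ← hw, ← hw', h1, add_comm k 1]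
    exact derBr_mul_left _ _ _ _ _ _ _
  | add k u u' hu hu' ih ih' =>
    obtain ⟨w, hw⟩ := ih
    obtain ⟨w', hw'⟩ := ih'
    refine ⟨w + w', ?_⟩
    have h1 : iOp ((hu.add k u u' hu').toMv hΓ) =
        iOp (hu.toMv hΓ) + iOp (hu'.toMv hΓ) :=
      iOp_add (hu.toMv hΓ) (hu'.toMv hΓ)
    rw [iOp_add, ← hw, ← hw', h1]
    exact derBr_add_left _ _ _ _ _ _

variable (hΩ : IsVolumeForm Γ n Ω)

/-- The bracket generated by `∂` is the derived bracket. -/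
lemma derBr_eq_iOp {k l : ℕ} {u v : mvSub hΓ} (hu : HasDeg k u.1) (hv : HasDeg l v.1) :
    derBr (𝕜 := 𝕜) (dOp hΓ L) k l (iOp u) (iOp v) = iOp (delBr hΩ L u v) := by
  refine LinearMap.ext fun α => Subtype.ext <| funext fun x => ?_
  obtain ⟨u', hu', hux⟩ := exists_gen hΓ u.2 hu x
  obtain ⟨v', hv', hvx⟩ := exists_gen hΓ v.2 hv x
  obtain ⟨w, hw⟩ := exists_derBr (hΓ := hΓ) L hu' hv'
  -- All operators involved are local, so at `x` the derived bracket acts on every form as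
  -- contraction by the same `w`. Testing on `Ω` then identifies `w` at `x`, by injectivity of `Ω♯`.
  have key : ∀ α, (derBr (𝕜 := 𝕜) (dOp hΓ L) k l (iOp u) (iOp v) α).1 x = (iOp w α).1 x := by
    intro α
    rw [← hw]
    exact (germEq_derBr L (u' := (hu'.toMv hΓ)) (v' := (hv'.toMv hΓ)) hux hvx
      α α (Eventually.of_forall fun _ => rfl)).self_of_nhds
  have h1 := key hΩ.toForm
  rw [derBr_volume hΩ L hu hv] at h1
  have h2 : (delBr hΩ L u v).1 x = w.1 x := (hΩ.sharp_bijective hΓ x).1 h1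
  rw [key, iOp_apply, iOp_apply, h2]

/-- Allows identities for the bracket to be read off from identities between operators on forms. -/
lemma delBr_eq_of_derBr {k l : ℕ} {u v w : mvSub hΓ} (hu : HasDeg k u.1) (hv : HasDeg l v.1)
    (h : derBr (𝕜 := 𝕜) (dOp hΓ L) k l (iOp u) (iOp v) = iOp w) : delBr hΩ L u v = w :=
  iOp_injective hΩ (by rw [← h, derBr_eq_iOp L hΩ hu hv])

end DelBracket

end LieBialg

namespace LieBialg

open Filter Topology

/-! ### Existence and uniqueness of the Schouten bracket. -/

section Signs

variable {𝕜 N : Type*} [Field 𝕜] [AddCommGroup N] [Module 𝕜 N]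

lemma sign_leibniz (k l r : ℕ) (a b : N) :
    -((-1 : 𝕜) ^ ((k + 1) * (l + r + 1)) • (-((-1 : 𝕜) ^ ((r + 1) * (k + 1)) • a) +
      (-1 : 𝕜) ^ ((k + 1) * r) • -((-1 : 𝕜) ^ ((l + 1) * (k + 1)) • b))) =
        b + (-1 : 𝕜) ^ ((k + 1) * l) • a := by
  rw [mul_comm (r + 1), mul_comm (l + 1)]
  simp only [pow_mul]
  generalize hs : (-1 : 𝕜) ^ (k + 1) = s
  have h2 : s = 1 ∨ s = -1 := hs ▸ neg_one_pow_eq_or 𝕜 (k + 1)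
  rcases h2 with rfl | rfl
  · simp only [one_pow]; module
  · simp only [pow_add, pow_one]
    rcases neg_one_pow_eq_or 𝕜 l with h | h <;> rcases neg_one_pow_eq_or 𝕜 r with h' | h' <;>
      simp only [h, h'] <;> module

end Signs

section Schouten

variable {𝕜 : Type*} [RCLike 𝕜] {m : ℕ} {M : Type*} [TopologicalSpace M]
  [ChartedSpace (EuclideanSpace ℝ (Fin m)) M]
  {V : M → Type*} [∀ x, AddCommGroup (V x)] [∀ x, Module 𝕜 (V x)]
  {Γ : Submodule (smoothFun 𝕜 m M) (∀ x, V x)} {n : ℕ}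
  {Ω : ∀ x, ExteriorAlgebra 𝕜 (Module.Dual 𝕜 (V x))}
  {hΓ : HasFrames Γ n}
  [T2Space M] [IsManifold (𝓡 m) ∞ M] (L : LieAlgebroid Γ)

section Existence

variable (hΩ : IsVolumeForm Γ n Ω)

lemma delBr_skew {k l : ℕ} {u v : mvSub hΓ} (hu : HasDeg k u.1) (hv : HasDeg l v.1) :
    delBr hΩ L u v = -((-1 : 𝕜) ^ ((k + 1) * (l + 1)) • delBr hΩ L v u) := by
  refine delBr_eq_of_derBr L hΩ hu hv ?_
  rw [← neg_smul, iOp_smul, ← derBr_eq_iOp L hΩ hv hu, neg_smul]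
  refine derBr_skew _ _ _ ?_
  rw [← iOp_mul, ← iOp_mul, mv_mul_comm hu hv, iOp_smul]

lemma delBr_mul_left {k l r : ℕ} {u v w : mvSub hΓ} (hu : HasDeg k u.1) (hv : HasDeg l v.1)
    (hw : HasDeg r w.1) : delBr hΩ L (v * w) u =
      v * delBr hΩ L w u + (-1 : 𝕜) ^ ((k + 1) * r) • (delBr hΩ L v u * w) := by
  refine delBr_eq_of_derBr L hΩ (hv.mul hw : HasDeg (l + r) (v * w).1) hu ?_
  rw [iOp_add, iOp_smul, iOp_mul, iOp_mul, iOp_mul, ← derBr_eq_iOp L hΩ hw hu,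
    ← derBr_eq_iOp L hΩ hv hu]
  exact derBr_mul_left _ _ _ _ _ _ _

/-- Skew-symmetry transfers the Leibniz rule from the left entry to the right one; `sign_leibniz`
collects the three signs this introduces. -/
lemma delBr_mul_right {k l : ℕ} {u v : mvSub hΓ} (hu : HasDeg k u.1) (hv : HasDeg l v.1)
    (w : mvSub hΓ) : delBr hΩ L u (v * w) =
      delBr hΩ L u v * w + (-1 : 𝕜) ^ ((k + 1) * l) • (v * delBr hΩ L u w) := by
  induction w using mv_induction_hom with
  | hadd w w' hw hw' =>
    rw [mul_add, delBr_add_right, hw, hw', delBr_add_right, mul_add, mul_add, smul_add]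
    abel
  | hhom r w hw =>
    rw [delBr_skew L hΩ hu (hv.mul hw : HasDeg (l + r) (v * w).1), delBr_mul_left L hΩ hu hv hw,
      delBr_skew L hΩ hw hu, delBr_skew L hΩ hv hu, mul_neg, mul_smul_comm, neg_mul,
      smul_mul_assoc]
    exact sign_leibniz k l r _ _

/-- The bracket generated by `∂`, on all sections. -/
def delBracket (Ω : ∀ x, ExteriorAlgebra 𝕜 (Module.Dual 𝕜 (V x)))
    (u v : ∀ x, ExteriorAlgebra 𝕜 (V x)) : ∀ x, ExteriorAlgebra 𝕜 (V x) :=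
  del L Ω ((fun x => inv (u x)) * v) - del L Ω (fun x => inv (u x)) * v - u * del L Ω v

-- Each axiom is an identity for derived brackets or the linearity of `∂`. In `fun_fun` the bracket
-- is a right contraction of a function, which is zero.
include hΩ in
lemma isSchouten_delBracket (hΓ : HasFrames Γ n) : IsSchouten L (delBracket L Ω) where
  smooth u v hu hv := (delBr hΩ L (⟨u, hu⟩ : mvSub hΓ) ⟨v, hv⟩).2
  add_left u u' v hu hu' hv := congrArg Subtype.val
    (delBr_add_left hΩ L (⟨u, hu⟩ : mvSub hΓ) ⟨u', hu'⟩ ⟨v, hv⟩)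
  add_right u v v' hu hv hv' := congrArg Subtype.val
    (delBr_add_right hΩ L (⟨u, hu⟩ : mvSub hΓ) ⟨v, hv⟩ ⟨v', hv'⟩)
  smul_left c u v hu hv := congrArg Subtype.val
    (delBr_smul_left hΩ L c (⟨u, hu⟩ : mvSub hΓ) ⟨v, hv⟩)
  smul_right c u v hu hv := congrArg Subtype.val
    (delBr_smul_right hΩ L c (⟨u, hu⟩ : mvSub hΓ) ⟨v, hv⟩)
  fun_fun f hf g hg := by
    refine congrArg Subtype.val (delBr_eq_of_derBr (hΓ := hΓ) L hΩ (u := mvFun hΓ ⟨f, hf⟩)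
      (v := mvFun hΓ ⟨g, hg⟩) (w := 0) (hasDeg_ofFun f) (hasDeg_ofFun g) ?_)
    rw [derBr_fun_left L _ (hasDeg_ofFun g : HasDeg 0 (mvFun hΓ ⟨g, hg⟩).1), pow_zero, one_smul]
    congr 1
    refine Subtype.ext <| funext fun x => ?_
    change cr _ (algebraMap 𝕜 _ (g x)) = 0
    rw [cr, AlgHom.commutes, cl_algebraMap, neg_zero]
  sec_fun X f hf := by
    refine congrArg Subtype.val (delBr_eq_of_derBr (hΓ := hΓ) L hΩ (u := mvSec hΓ X)
      (v := mvFun hΓ ⟨f, hf⟩) (w := mvFun hΓ (L.toLieRinehart.act X ⟨f, hf⟩))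
      (hasDeg_ofSec X.1) (hasDeg_ofFun f) ?_)
    rw [derBr_sec_left L _ (hasDeg_ofFun f : HasDeg 0 (mvFun hΓ ⟨f, hf⟩).1), lieOp_comm_fun]
  sec_sec X Y := by
    refine congrArg Subtype.val (delBr_eq_of_derBr (hΓ := hΓ) L hΩ (u := mvSec hΓ X)
      (v := mvSec hΓ Y) (w := mvSec hΓ (L.bracket X Y)) (hasDeg_ofSec X.1) (hasDeg_ofSec Y.1) ?_)
    rw [derBr_sec_left L _ (hasDeg_ofSec Y.1 : HasDeg 1 (mvSec hΓ Y).1), lieOp_comm_sec]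
  skew k l u v hu hv hk hl := congrArg Subtype.val
    (delBr_skew L hΩ (u := (⟨u, hu⟩ : mvSub hΓ)) (v := ⟨v, hv⟩) hk hl)
  leibniz k l u v w hu hv hw hk hl := congrArg Subtype.val
    (delBr_mul_right L hΩ (u := (⟨u, hu⟩ : mvSub hΓ)) (v := ⟨v, hv⟩) hk hl ⟨w, hw⟩)

end Existence

section Uniqueness

variable {L} {B B' : (∀ x, ExteriorAlgebra 𝕜 (V x)) → (∀ x, ExteriorAlgebra 𝕜 (V x)) →
  (∀ x, ExteriorAlgebra 𝕜 (V x))} (hB : IsSchouten L B) (hB' : IsSchouten L B')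

include hB

/-- Locality from the Leibniz rule: if `v` vanishes near `x`, then `v = (1 - χ) v` for a bump
function `χ` at `x`, and at `x` both terms of `B(u, (1 - χ) v)` contain a vanishing factor, `v` or
`1 - χ`. -/
lemma IsSchouten.apply_eq_zero {k : ℕ} {u v : ∀ x, ExteriorAlgebra 𝕜 (V x)}
    (hu : IsMultivector Γ u) (hk : HasDeg k u) (hv : IsMultivector Γ v) {x : M}
    (h : ∀ᶠ y in 𝓝 x, v y = 0) : B u v x = 0 := by
  obtain ⟨χ, hχ, hχ1, hχ0⟩ := exists_bump_tsupport (m := m) 𝕜 x h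
  have hψ : 1 - χ ∈ smoothFun 𝕜 m M := sub_mem (one_mem _) hχ
  have h1 : ofFun (1 - χ) * v = v := by
    rw [ofFun_mul]
    funext y
    by_cases hy : v y = 0
    · rw [hy, smul_zero]
    · have := (hχ0 y hy).self_of_nhds
      simp [this]
  have h2 := hB.leibniz k 0 u (ofFun (1 - χ)) v hu (isSmoothVia_ofFun hψ) hv hk (hasDeg_ofFun _)
  rw [h1, mul_zero, pow_zero, one_smul, ofFun_mul] at h2
  rw [h2, Pi.add_apply, Pi.mul_apply, h.self_of_nhds]
  have := hχ1.self_of_nhds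
  simp [this]

lemma IsSchouten.congr_right {k : ℕ} {u v v' : ∀ x, ExteriorAlgebra 𝕜 (V x)}
    (hu : IsMultivector Γ u) (hk : HasDeg k u) (hv : IsMultivector Γ v)
    (hv' : IsMultivector Γ v') {x : M} (h : ∀ᶠ y in 𝓝 x, v y = v' y) : B u v x = B u v' x := by
  have hn : IsMultivector Γ ((-1 : 𝕜) • v') := IsSmoothVia.smul (-1) hv'
  have h1 := hB.apply_eq_zero hu hk (IsSmoothVia.add hv hn) (x := x) (by
    filter_upwards [h] with y hy
    rw [Pi.add_apply, Pi.smul_apply, hy, neg_one_smul, add_neg_cancel])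
  rw [hB.add_right _ _ _ hu hv hn, hB.smul_right _ _ _ hu hv', Pi.add_apply, Pi.smul_apply,
    neg_one_smul, ← sub_eq_add_neg, sub_eq_zero] at h1
  exact h1

include hB'

/-- By locality and the Leibniz rule, the bracket with a fixed homogeneous `u` is determined by its
values on functions and sections. -/
lemma IsSchouten.ext_right (hΓ : HasFrames Γ n) {k : ℕ} {u : ∀ x, ExteriorAlgebra 𝕜 (V x)}
    (hu : IsMultivector Γ u) (hk : HasDeg k u)
    (hf : ∀ f ∈ smoothFun 𝕜 m M, B u (ofFun f) = B' u (ofFun f))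
    (hX : ∀ X : Γ, B u (ofSec X.1) = B' u (ofSec X.1)) {v : ∀ x, ExteriorAlgebra 𝕜 (V x)}
    (hv : IsMultivector Γ v) : B u v = B' u v := by
  refine mv_induction hΓ (P := fun v => B u v = B' u v) ?_ ?_ ?_ hv
  · intro v w hv hw h1 h2
    rw [hB.add_right _ _ _ hu hv hw, hB'.add_right _ _ _ hu hv hw, h1, h2]
  · intro v hv h
    funext x
    obtain ⟨l, w, hw, h1, h2⟩ := h x
    rw [hB.congr_right hu hk hv hw.isMultivector h2, hB'.congr_right hu hk hv hw.isMultivector h2,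
      h1]
  · intro l v hv
    induction hv with
    | func f h => exact hf f h
    | mul l Y v hv ih =>
      rw [hB.leibniz k 1 u _ v hu (isMultivector_ofSec Y) hv.isMultivector hk (hasDeg_ofSec _),
        hB'.leibniz k 1 u _ v hu (isMultivector_ofSec Y) hv.isMultivector hk (hasDeg_ofSec _),
        ih, hX]
    | add l v w hv hw ih ih' =>
      rw [hB.add_right _ _ _ hu hv.isMultivector hw.isMultivector,
        hB'.add_right _ _ _ hu hv.isMultivector hw.isMultivector, ih, ih']

/-- The Schouten bracket is unique. -/
lemma IsSchouten.eq_of_isMultivector (hΓ : HasFrames Γ n) {u v : ∀ x, ExteriorAlgebra 𝕜 (V x)}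
    (hu : IsMultivector Γ u) (hv : IsMultivector Γ v) : B u v = B' u v := by
  -- Left entries are treated in the order sections, functions, arbitrary: at each stage the values
  -- still needed on functions or sections are given by an axiom, or by skew-symmetry and an earlier
  -- stage.
  have hX : ∀ (X : Γ) {v : ∀ x, ExteriorAlgebra 𝕜 (V x)}, IsMultivector Γ v →
      B (ofSec X.1) v = B' (ofSec X.1) v := fun X v hv =>
    hB.ext_right hB' hΓ (isMultivector_ofSec X) (hasDeg_ofSec X.1)
      (fun f hf => by rw [hB.sec_fun X f hf, hB'.sec_fun X f hf])
      (fun Y => by rw [hB.sec_sec, hB'.sec_sec]) hv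
  have hf : ∀ f ∈ smoothFun 𝕜 m M, ∀ {v : ∀ x, ExteriorAlgebra 𝕜 (V x)}, IsMultivector Γ v →
      B (ofFun f) v = B' (ofFun f) v := fun f hf v hv =>
    hB.ext_right hB' hΓ (isSmoothVia_ofFun hf) (hasDeg_ofFun f)
      (fun g hg => by rw [hB.fun_fun f hf g hg, hB'.fun_fun f hf g hg])
      (fun Y => by
        rw [hB.skew 0 1 _ _ (isSmoothVia_ofFun hf) (isMultivector_ofSec Y) (hasDeg_ofFun f)
          (hasDeg_ofSec _), hB'.skew 0 1 _ _ (isSmoothVia_ofFun hf) (isMultivector_ofSec Y)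
          (hasDeg_ofFun f) (hasDeg_ofSec _), hX Y (isSmoothVia_ofFun hf)]) hv
  have key : ∀ u : mvSub hΓ, B u.1 v = B' u.1 v := by
    intro u
    induction u using mv_induction_hom with
    | hadd u w h h' =>
      have h1 := hB.add_left _ _ _ u.2 w.2 hv
      have h2 := hB'.add_left _ _ _ u.2 w.2 hv
      rw [h, h', ← h2] at h1
      exact h1
    | hhom k u hk =>
      refine hB.ext_right hB' hΓ u.2 hk (fun f h => ?_) (fun X => ?_) hv
      · rw [hB.skew k 0 _ _ u.2 (isSmoothVia_ofFun h) hk (hasDeg_ofFun f),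
          hB'.skew k 0 _ _ u.2 (isSmoothVia_ofFun h) hk (hasDeg_ofFun f), hf f h u.2]
      · rw [hB.skew k 1 _ _ u.2 (isMultivector_ofSec X) hk (hasDeg_ofSec _),
          hB'.skew k 1 _ _ u.2 (isMultivector_ofSec X) hk (hasDeg_ofSec _), hX X u.2]
  exact key ⟨u, hu⟩

end Uniqueness

/-- Existence shows that `schouten` is a genuine choice, and uniqueness shows that the choice is
immaterial on smooth multivectors; hence `∂` generates it. -/
lemma schouten_eq_delBr (hΩ : IsVolumeForm Γ n Ω) (u v : mvSub hΓ) :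
    schouten L u.1 v.1 = (delBr hΩ L u v).1 := by
  have hB := isSchouten_delBracket L hΩ hΓ
  have h : ∃ B, IsSchouten L B := ⟨_, hB⟩
  rw [schouten, dif_pos h]
  exact h.choose_spec.eq_of_isMultivector hB hΓ u.2 v.2


end Schouten

end LieBialg

namespace LieBialg

/-! ### The Laplacian as a derivation. -/

section SignsRing

variable {𝕜 R : Type*} [Field 𝕜] [Ring R] [Algebra 𝕜 R]

/-- Bookkeeping for `d_*∂(u ∧ v) + ∂d_*(u ∧ v)`: `b * f` is `∂u ∧ d_*v`, `c * e` is `d_*u ∧ ∂v`, and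
`r`, `s` are `[d_*u, v]`, `[u, d_*v]`. Each of these four occurs twice with opposite signs. -/
lemma sign_laplacian (k : ℕ) (a a' b c e f g p q q' r s : R) :
    (a * g + (-1 : 𝕜) ^ (k + 1) • (b * f) + (-1 : 𝕜) ^ k • (c * e + (-1 : 𝕜) ^ k • (p * q)) +
      (-1 : 𝕜) ^ k • (r + (-1 : 𝕜) ^ (k + 1) • s)) +
    (a' * g + (-1 : 𝕜) ^ (k + 1) • (c * e) + (-1 : 𝕜) ^ (k + 1) • r +
      (-1 : 𝕜) ^ k • (b * f + (-1 : 𝕜) ^ k • (p * q') + (-1 : 𝕜) ^ k • s)) =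
    (a + a') * g + p * (q + q') := by
  rw [pow_succ]
  rcases neg_one_pow_eq_or 𝕜 k with h | h <;> simp only [h, add_mul, mul_add] <;> module

end SignsRing

section Laplacian

variable {𝕜 : Type*} [RCLike 𝕜] {m : ℕ} {M : Type*} [TopologicalSpace M]
  [ChartedSpace (EuclideanSpace ℝ (Fin m)) M]
  {V : M → Type*} [∀ x, AddCommGroup (V x)] [∀ x, Module 𝕜 (V x)]
  {Γ : Submodule (smoothFun 𝕜 m M) (∀ x, V x)} {n : ℕ}
  {Ω : ∀ x, ExteriorAlgebra 𝕜 (Module.Dual 𝕜 (V x))}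
  {hΓ : HasFrames Γ n}
  [T2Space M] [IsManifold (𝓡 m) ∞ M] {L : LieAlgebroid Γ} {L' : LieAlgebroid (dualSections Γ)}

section DStar

variable (hbi : IsLieBialgebroid L L')

/-- The differential `d_*` on `Γ(⋀A)`. -/
def dsOp (hbi : IsLieBialgebroid L L') (u : mvSub hΓ) : mvSub hΓ :=
  ⟨dStar L' u.1, hbi.smooth _ u.2⟩

lemma dsOp_deg {k : ℕ} {u : mvSub hΓ} (hu : HasDeg k u.1) : HasDeg (k + 1) (dsOp hbi u).1 :=
  hbi.deg k u.1 u.2 hu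

lemma dsOp_add (u v : mvSub hΓ) : dsOp hbi (u + v) = dsOp hbi u + dsOp hbi v :=
  Subtype.ext <| hbi.add _ _ u.2 v.2

lemma dsOp_smul (c : 𝕜) (u : mvSub hΓ) : dsOp hbi (c • u) = c • dsOp hbi u :=
  Subtype.ext <| hbi.smul c _ u.2

lemma dsOp_zero : dsOp hbi (0 : mvSub hΓ) = 0 := by
  have h := dsOp_smul hbi (0 : 𝕜) (0 : mvSub hΓ)
  rwa [zero_smul, zero_smul] at h

lemma dsOp_mul {k : ℕ} {u : mvSub hΓ} (hu : HasDeg k u.1) (v : mvSub hΓ) :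
    dsOp hbi (u * v) = dsOp hbi u * v + (-1 : 𝕜) ^ k • (u * dsOp hbi v) := by
  have h := hbi.wedge k u.1 v.1 u.2 v.2 hu
  rw [one_mul] at h
  exact Subtype.ext h

lemma dsOp_delBr (hΩ : IsVolumeForm Γ n Ω) {k : ℕ} {u : mvSub hΓ} (hu : HasDeg k u.1)
    (v : mvSub hΓ) : dsOp hbi (delBr hΩ L u v) =
      delBr hΩ L (dsOp hbi u) v + (-1 : 𝕜) ^ (k + 1) • delBr hΩ L u (dsOp hbi v) := by
  have h := hbi.bracket k u.1 v.1 u.2 v.2 hu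
  rw [one_mul] at h
  apply Subtype.ext
  change dStar L' (delBr hΩ L u v).1 = (delBr hΩ L (dsOp hbi u) v).1 +
    (-1 : 𝕜) ^ (k + 1) • (delBr hΩ L u (dsOp hbi v)).1
  rw [← schouten_eq_delBr, ← schouten_eq_delBr, ← schouten_eq_delBr]
  exact h

end DStar

variable (hΩ : IsVolumeForm Γ n Ω) (hbi : IsLieBialgebroid L L')

lemma delOp_mul {k : ℕ} {u : mvSub hΓ} (hu : HasDeg k u.1) (v : mvSub hΓ) :
    delOp hΩ L (u * v) = delOp hΩ L u * v + (-1 : 𝕜) ^ k • (u * delOp hΩ L v) +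
      (-1 : 𝕜) ^ k • delBr hΩ L u v := by
  rw [delBr_of_deg hΩ L hu, smul_sub, smul_smul, ← mul_pow, neg_mul_neg, one_mul, one_pow,
    one_smul]
  abel

/-- The Laplacian on `Γ(⋀A)`. -/
def lapOp (u : mvSub hΓ) : mvSub hΓ :=
  dsOp hbi (delOp hΩ L u) + delOp hΩ L (dsOp hbi u)

lemma lapOp_val (u : mvSub hΓ) : (lapOp hΩ hbi u).1 = laplacian L L' Ω u.1 := rfl

lemma lapOp_add (u v : mvSub hΓ) : lapOp hΩ hbi (u + v) = lapOp hΩ hbi u + lapOp hΩ hbi v := by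
  rw [lapOp, delOp_add, dsOp_add, dsOp_add, delOp_add]
  exact add_add_add_comm _ _ _ _

lemma lapOp_smul (c : 𝕜) (u : mvSub hΓ) : lapOp hΩ hbi (c • u) = c • lapOp hΩ hbi u := by
  rw [lapOp, delOp_smul, dsOp_smul, dsOp_smul, delOp_smul, ← smul_add]
  rfl

lemma lapOp_sub (u v : mvSub hΓ) : lapOp hΩ hbi (u - v) = lapOp hΩ hbi u - lapOp hΩ hbi v := by
  rw [sub_eq_add_neg, ← neg_one_smul 𝕜 v, lapOp_add, lapOp_smul, neg_one_smul, ← sub_eq_add_neg]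

lemma lapOp_deg {k : ℕ} {u : mvSub hΓ} (hu : HasDeg k u.1) : HasDeg k (lapOp hΩ hbi u).1 := by
  refine HasDeg.add (u := (dsOp hbi (delOp hΩ L u)).1) ?_ (delOp_deg hΩ L (dsOp_deg hbi hu))
  cases k with
  | zero =>
    rw [delOp_deg_zero hΩ L hu, dsOp_zero]
    exact fun x => Submodule.zero_mem _
  | succ k => exact dsOp_deg hbi (delOp_deg hΩ L hu)

/-- The sign `(-1)^(k+1)` stands for `(-1)^(k-1)`, so degree zero needs no exception: there `∂u =
0`. -/
lemma dsOp_delOp_mul {k : ℕ} {u : mvSub hΓ} (hu : HasDeg k u.1) (v : mvSub hΓ) :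
    dsOp hbi (delOp hΩ L u * v) =
      dsOp hbi (delOp hΩ L u) * v + (-1 : 𝕜) ^ (k + 1) • (delOp hΩ L u * dsOp hbi v) := by
  cases k with
  | zero => rw [delOp_deg_zero hΩ L hu, zero_mul, dsOp_zero, zero_mul, zero_mul, smul_zero, add_zero]
  | succ k =>
    rw [dsOp_mul hbi (delOp_deg hΩ L hu), pow_succ, pow_succ, mul_assoc, neg_mul_neg, one_mul,
      mul_one]

/-- This is where the bialgebroid condition on brackets is needed: it makes `d_*` of the defect of
`∂` cancel the defects arising in `∂ d_*`. -/
lemma lapOp_mul (u v : mvSub hΓ) :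
    lapOp hΩ hbi (u * v) = lapOp hΩ hbi u * v + u * lapOp hΩ hbi v := by
  induction u using mv_induction_hom with
  | hadd u w hu hw =>
    rw [add_mul, lapOp_add, hu, hw, lapOp_add, add_mul, add_mul]
    exact add_add_add_comm _ _ _ _
  | hhom k u hu =>
    rw [lapOp, dsOp_mul hbi hu v, delOp_mul hΩ hu v, dsOp_add, dsOp_add, dsOp_smul, dsOp_smul,
      dsOp_delOp_mul hΩ hbi hu v, dsOp_mul hbi hu (delOp hΩ L v), dsOp_delBr hbi hΩ hu v,
      delOp_add, delOp_smul, delOp_mul hΩ (dsOp_deg hbi hu) v, delOp_mul hΩ hu (dsOp hbi v)]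
    exact sign_laplacian k _ _ _ _ _ _ _ _ _ _ _ _

/-- Both sides equal `∂ d_* ∂ u`; only `∂² = 0` is used, not `d_*² = 0`. -/
lemma lapOp_delOp (u : mvSub hΓ) : lapOp hΩ hbi (delOp hΩ L u) = delOp hΩ L (lapOp hΩ hbi u) := by
  rw [lapOp, lapOp, delOp_delOp, dsOp_zero, zero_add, delOp_add, delOp_delOp, add_zero]

lemma lapOp_mvInv (u : mvSub hΓ) : lapOp hΩ hbi (mvInv u) = mvInv (lapOp hΩ hbi u) := by
  induction u using mv_induction_hom with
  | hadd u w hu hw => rw [mvInv_add, lapOp_add, hu, hw, lapOp_add, mvInv_add]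
  | hhom k u hu => rw [mvInv_of_deg hu, mvInv_of_deg (lapOp_deg hΩ hbi hu), lapOp_smul]

/-- The bracket is a combination of `∂`, `∧` and the grade involution. `Δ` is a derivation of `∧`
and commutes with the other two. -/
lemma lapOp_delBr (u v : mvSub hΓ) : lapOp hΩ hbi (delBr hΩ L u v) =
    delBr hΩ L (lapOp hΩ hbi u) v + delBr hΩ L u (lapOp hΩ hbi v) := by
  simp only [delBr, lapOp_sub, lapOp_mul, lapOp_delOp, lapOp_mvInv, delOp_add]
  abel

include hΩ hbi in
lemma laplacian_schouten (u v : mvSub hΓ) : laplacian L L' Ω (schouten L u.1 v.1) =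
    schouten L (laplacian L L' Ω u.1) v.1 + schouten L u.1 (laplacian L L' Ω v.1) := by
  rw [← lapOp_val hΩ hbi, ← lapOp_val hΩ hbi, schouten_eq_delBr L hΩ, schouten_eq_delBr L hΩ,
    schouten_eq_delBr L hΩ, ← lapOp_val hΩ hbi, lapOp_delBr]
  rfl

include hΩ hbi in
/-- The Laplacian is a derivation of degree zero of the Gerstenhaber algebra. -/
lemma isGerstenhaberDerivation_laplacian (hΓ : HasFrames Γ n) :
    IsGerstenhaberDerivation L 0 (laplacian L L' Ω) where
  smooth u hu := (lapOp hΩ hbi (⟨u, hu⟩ : mvSub hΓ)).2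
  deg k u hu hk := lapOp_deg hΩ hbi (u := (⟨u, hu⟩ : mvSub hΓ)) hk
  add u v hu hv := congrArg Subtype.val (lapOp_add hΩ hbi (⟨u, hu⟩ : mvSub hΓ) ⟨v, hv⟩)
  smul c u hu := congrArg Subtype.val (lapOp_smul hΩ hbi c (⟨u, hu⟩ : mvSub hΓ))
  wedge k u v hu hv hk := by
    rw [zero_mul, pow_zero, one_smul]
    exact congrArg Subtype.val (lapOp_mul hΩ hbi (⟨u, hu⟩ : mvSub hΓ) ⟨v, hv⟩)
  bracket k u v hu hv hk := by
    rw [zero_mul, pow_zero, one_smul]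
    exact laplacian_schouten hΩ hbi (⟨u, hu⟩ : mvSub hΓ) ⟨v, hv⟩

end Laplacian

end LieBialg

end

theorem corollary2p6 {𝕜 : Type*} [RCLike 𝕜] {m : ℕ}
    {M : Type*} [TopologicalSpace M] [T2Space M] [SecondCountableTopology M]
    [ChartedSpace (EuclideanSpace ℝ (Fin m)) M] [IsManifold (𝓡 m) ∞ M]
    {F : Type*} [NormedAddCommGroup F] [NormedSpace ℝ F] [NormedSpace 𝕜 F] [IsScalarTower ℝ 𝕜 F]
    [FiniteDimensional 𝕜 F]
    (A : M → Type*) [TopologicalSpace (Bundle.TotalSpace F A)]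
    [∀ x, AddCommGroup (A x)] [∀ x, Module ℝ (A x)] [∀ x, Module 𝕜 (A x)]
    [∀ x, IsScalarTower ℝ 𝕜 (A x)]
    [∀ x, TopologicalSpace (A x)] [FiberBundle F A]
    [VectorBundle ℝ F A] [VectorBundle 𝕜 F A]
    [ContMDiffVectorBundle ∞ F A (𝓡 m)]
    (L : LieBialg.LieAlgebroid (LieBialg.sections 𝕜 m F A))
    (L' : LieBialg.LieAlgebroid (LieBialg.dualSections (LieBialg.sections 𝕜 m F A)))
    (Ω : ∀ x, ExteriorAlgebra 𝕜 (Module.Dual 𝕜 (A x)))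
    (hΩ : LieBialg.IsForm (LieBialg.sections 𝕜 m F A) Ω)
    (hΩ_deg : LieBialg.HasDeg (Module.finrank 𝕜 F) Ω) (hΩ_ne : ∀ x, Ω x ≠ 0)
    (hbi : LieBialg.IsLieBialgebroid L L') :
    LieBialg.IsGerstenhaberDerivation L 0 (LieBialg.laplacian L L' Ω) ∧
    (∀ u v : (∀ x, ExteriorAlgebra 𝕜 (A x)),
      LieBialg.IsMultivector (LieBialg.sections 𝕜 m F A) u →
      LieBialg.IsMultivector (LieBialg.sections 𝕜 m F A) v →
      LieBialg.laplacian L L' Ω (u * v) =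
        LieBialg.laplacian L L' Ω u * v + u * LieBialg.laplacian L L' Ω v) ∧
    (∀ u v : (∀ x, ExteriorAlgebra 𝕜 (A x)),
      LieBialg.IsMultivector (LieBialg.sections 𝕜 m F A) u →
      LieBialg.IsMultivector (LieBialg.sections 𝕜 m F A) v →
      LieBialg.laplacian L L' Ω (LieBialg.schouten L u v) =
        LieBialg.schouten L (LieBialg.laplacian L L' Ω u) v +
          LieBialg.schouten L u (LieBialg.laplacian L L' Ω v)) := by
  have hΓ := LieBialg.hasFrames_sections (𝕜 := 𝕜) (m := m) (F := F) A
  have hvol : LieBialg.IsVolumeForm _ _ Ω := ⟨hΩ, hΩ_deg, hΩ_ne⟩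
  exact ⟨LieBialg.isGerstenhaberDerivation_laplacian hvol hbi hΓ,
    fun u v hu hv => congrArg Subtype.val
      (LieBialg.lapOp_mul hvol hbi (⟨u, hu⟩ : LieBialg.mvSub hΓ) ⟨v, hv⟩),
    fun u v hu hv => LieBialg.laplacian_schouten hvol hbi
      (⟨u, hu⟩ : LieBialg.mvSub hΓ) ⟨v, hv⟩⟩
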